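/- Let $\mathbb D=\{z\in\mathbb C:|z|<1\}$ and $dA=\pi^{-1}\,dx\,dy$. Let $\omega$ be a radial weight on $\mathbb D$: $\omega(z)=\omega(|z|)\ge 0$, $\int_{\mathbb D}\omega\,dA<\infty$, and $\widehat\omega(z)=\widehat\omega(|z|):=\int_{|z|}^1\omega(s)\,ds\neq 0$ for all $z\in\mathbb D$. Assume $\omega\in\mathcal D$, that is, there are $C>0$, $K>1$, $C'>1$ with $$C'\,\widehat\omega\Big(1-\frac{1-r}{K}\Big)\le\widehat\omega(r)\le C\,\widehat\omega\Big(\frac{1+r}{2}\Big)\qquad(0\le r<1).$$ For a radial weight $\nu$ let $A^2_\nu$ be the space of analytic functions on $\mathbb D$ in $L^2(\nu\,dA)$, and let $B_z^\nu\in A^2_\nu$ be its reproducing kernel, $f(z)=\int_{\mathbb D}f\,\overline{B_z^\nu}\,\nu\,dA$ for $f\in A^2_\nu$, $z\in\mathbb D$. The Bergman projection is the integral operator $$P_\omega f(z)=\int_{\mathbb D}f(\xi)\,\overline{B_z^\omega(\xi)}\,\omega(\xi)\,dA(\xi).$$ Let $$d\lambda_\omega(z)=\frac{\omega(z)\,dA(z)}{\widehat\omega(z)(1-|z|)},\qquad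 d\lambda(z)=\frac{dA(z)}{(1-|z|^2)^2}.$$ Fix an integer $N\ge2$. For $1\le p<\infty$ the Besov space $\mathcal B^p$ consists of the analytic functions $f$ on $\mathbb D$ with $$\|f\|_{\mathcal B^p}=\Big(\int_{\mathbb D}|f^{(N)}(z)|^p(1-|z|)^{Np}\,d\lambda(z)\Big)^{1/p}+\sum_{j=0}^{N-1}|f^{(j)}(0)|<\infty,$$ and $\mathcal B^\infty$ is the Bloch space, with norm $\|f\|_{\mathcal B^\infty}=\sup_{z\in\mathbb D}(1-|z|^2)|f'(z)|+|f(0)|$. For $\alpha>0$ put $\omega_\alpha(z)=(1-|z|)^\alpha\omega(z)$, and let $R^{\omega,\omega_\alpha}$ be the unique continuous linear operator on the space of analytic functions on $\mathbb D$ (with locally uniform convergence) that commutes with the dilations $f\mapsto f(r\,\cdot)$, $0<r<1$, and satisfies $R^{\omega,\omega_\alpha}B_z^\omega=B_z^{\omega_\alpha}$ for all $z\in\mathbb D$. **Theorem.** Let $\omega\in\mathcal D$ and $1\le p\le\infty$. Then the integral defining $P_\omega f(z)$ converges absolutely for all $f\in L^p(\lambda_\omega)$ and $z\in\mathbb D$,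 and $P_\omega:L^p(\lambda_\omega)\to\mathcal B^p$ is bounded and onto: there is a constant $C<\infty$, depending only on $\omega$, $p$ and $N$, with $\|P_\omega f\|_{\mathcal B^p}\le C\|f\|_{L^p(\lambda_\omega)}$ for all $f\in L^p(\lambda_\omega)$, and every $h\in\mathcal B^p$ equals $P_\omega f$ for some $f\in L^p(\lambda_\omega)$. Moreover, for every $\alpha>1$ and $h\in\mathcal B^p$, the function $$g_\alpha(z)=(1-|z|)^\alpha R^{\omega,\omega_\alpha}h(z)$$ belongs to $L^p(\lambda_\omega)$ and $P_\omega(g_\alpha)=h$. -/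

import Mathlib

open MeasureTheory Set Filter Topology
open scoped ENNReal NNReal ComplexConjugate

noncomputable section

namespace BergmanBesov

/-- The open unit disk. -/
abbrev disk : Set ℂ := Metric.ball (0 : ℂ) 1

/-- Analytic functions on the unit disk; a function on the disk is represented by any function
`ℂ → ℂ`, of which only the values on the disk matter. -/
def IsHol (f : ℂ → ℂ) : Prop := AnalyticOnNhd ℂ f disk

/-- Normalized area measure `dA = π⁻¹ dx dy` on the unit disk. -/
def areaMeasure : Measure ℂ := (ENNReal.ofReal Real.pi)⁻¹ • volume.restrict disk

/-! A radial weight `ω(z) = ω(|z|)` is represented by its profile `ω : ℝ → ℝ`, of which only the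
values on `[0, 1)` matter. -/

/-- The tail integral `∫_r^1 ω(s) ds`, as an extended non-negative number. -/
def wHat (ω : ℝ → ℝ) (r : ℝ) : ℝ≥0∞ := ∫⁻ s in Ioo r 1, ENNReal.ofReal (ω s)

/-- Radial weights: non-negative, integrable over the disk, with non-vanishing tail integrals. -/
structure IsRadialWeight (ω : ℝ → ℝ) : Prop where
  nonneg : ∀ r ∈ Ico (0 : ℝ) 1, 0 ≤ ω r
  integrable : IntegrableOn (fun z : ℂ => ω ‖z‖) disk
  wHat_ne_zero : ∀ r ∈ Ico (0 : ℝ) 1, wHat ω r ≠ 0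

/-- The upper doubling class. -/
def UpperDoubling (ω : ℝ → ℝ) : Prop :=
  ∃ C : ℝ≥0, ∀ r ∈ Ico (0 : ℝ) 1, wHat ω r ≤ C * wHat ω ((1 + r) / 2)

/-- The lower doubling class. -/
def LowerDoubling (ω : ℝ → ℝ) : Prop :=
  ∃ K : ℝ, 1 < K ∧ ∃ C : ℝ≥0, 1 < C ∧
    ∀ r ∈ Ico (0 : ℝ) 1, C * wHat ω (1 - (1 - r) / K) ≤ wHat ω r

/-- The class of (two-sided) doubling radial weights. -/
structure IsDoubling (ω : ℝ → ℝ) : Prop where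
  weight : IsRadialWeight ω
  upper : UpperDoubling ω
  lower : LowerDoubling ω

/-- The measure `ω dA` on the disk. -/
def weightMeasure (ω : ℝ → ℝ) : Measure ℂ :=
  areaMeasure.withDensity fun z => ENNReal.ofReal (ω ‖z‖)

/-- The measure `ω(z) dA(z) / (ω̂(z) (1 - |z|))` on the disk. -/
def lambdaMeasure (ω : ℝ → ℝ) : Measure ℂ :=
  areaMeasure.withDensity fun z =>
    ENNReal.ofReal (ω ‖z‖) / (wHat ω ‖z‖ * ENNReal.ofReal (1 - ‖z‖))

/-- The Möbius invariant measure `dA(z) / (1 - |z|²)²` on the disk. -/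
def mobiusMeasure : Measure ℂ :=
  areaMeasure.withDensity fun z => ENNReal.ofReal (1 / (1 - ‖z‖ ^ 2) ^ 2)

/-- The weighted Bergman space `A²_ω`. -/
def MemBergmanTwo (ω : ℝ → ℝ) (f : ℂ → ℂ) : Prop :=
  IsHol f ∧ MemLp f 2 (weightMeasure ω)

/-- `B` is the reproducing kernel of `A²_ω` at the point `z`. -/
def IsReproducing (ω : ℝ → ℝ) (z : ℂ) (B : ℂ → ℂ) : Prop :=
  MemBergmanTwo ω B ∧
    ∀ f, MemBergmanTwo ω f → f z = ∫ ξ, f ξ * conj (B ξ) ∂(weightMeasure ω)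

open Classical in
/-- The Bergman kernel `B_z^ω` (on the disk it is determined by its reproducing property). -/
def bergmanKernel (ω : ℝ → ℝ) (z : ℂ) : ℂ → ℂ :=
  if h : ∃ B, IsReproducing ω z B then h.choose else 0

/-- The Bergman projection, as an integral operator. -/
def bergmanProj (ω : ℝ → ℝ) (f : ℂ → ℂ) (z : ℂ) : ℂ :=
  ∫ ξ, f ξ * conj (bergmanKernel ω z ξ) ∂(weightMeasure ω)

/-- `R` is a linear operator on the space of analytic functions on the disk which is continuous for
locally uniform convergence (a metrizable topology, so that sequences suffice), commutes with
dilations, and maps the Bergman kernels of `ω` to those of `ν`. -/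
structure IsFracDeriv (ω ν : ℝ → ℝ) (R : (ℂ → ℂ) → ℂ → ℂ) : Prop where
  hol : ∀ f, IsHol f → IsHol (R f)
  map_add : ∀ f g, IsHol f → IsHol g → EqOn (R (f + g)) (R f + R g) disk
  map_smul : ∀ (c : ℂ) f, IsHol f → EqOn (R (c • f)) (c • R f) disk
  continuous : ∀ (F : ℕ → ℂ → ℂ) (f : ℂ → ℂ), (∀ n, IsHol (F n)) → IsHol f →
    TendstoLocallyUniformlyOn F f atTop disk →
    TendstoLocallyUniformlyOn (fun n => R (F n)) (R f) atTop disk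
  dilation : ∀ r ∈ Ioo (0 : ℝ) 1, ∀ f, IsHol f →
    EqOn (fun z => R f (r * z)) (R fun z => f (r * z)) disk
  kernel : ∀ z ∈ disk, EqOn (R (bergmanKernel ω z)) (bergmanKernel ν z) disk

open Classical in
/-- The fractional derivative `R^{ω,ν}` (on analytic functions it is determined, as a function on
the disk, by the properties above). -/
def fracDeriv (ω ν : ℝ → ℝ) : (ℂ → ℂ) → ℂ → ℂ :=
  if h : ∃ R, IsFracDeriv ω ν R then h.choose else fun _ => 0

/-- The weight `ω_α(r) = (1 - r)^α ω(r)`. -/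
def powWeight (ω : ℝ → ℝ) (α : ℝ) : ℝ → ℝ := fun r => (1 - r) ^ α * ω r

/-- The Bloch norm, with value `∞` off the Bloch space. -/
def blochNorm (f : ℂ → ℂ) : ℝ≥0∞ :=
  (⨆ z ∈ disk, ENNReal.ofReal ((1 - ‖z‖ ^ 2) * ‖deriv f z‖)) + ‖f 0‖ₑ

/-- The Besov norm (in terms of the `N`-th derivative if `p < ∞`), with value `∞` off the Besov
space. For `p = ∞` it is the Bloch norm. -/
def besovNorm (N : ℕ) (p : ℝ≥0∞) (f : ℂ → ℂ) : ℝ≥0∞ :=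
  if p = ∞ then blochNorm f
  else
    (∫⁻ z, ‖iteratedDeriv N f z‖ₑ ^ p.toReal * ENNReal.ofReal (1 - ‖z‖) ^ (N * p.toReal)
      ∂mobiusMeasure) ^ (1 / p.toReal) + ∑ j ∈ Finset.range N, ‖iteratedDeriv j f 0‖ₑ

/-- The Besov space `B^p`; `B^∞` is the Bloch space. -/
def MemBesov (N : ℕ) (p : ℝ≥0∞) (f : ℂ → ℂ) : Prop :=
  IsHol f ∧ besovNorm N p f < ∞

end BergmanBesov

end

/-! Everything is diagonal on monomials. In polar coordinates the pairing of f with ξ^n in L²(ω dA)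
equals the n-th Taylor coefficient of f times 2ω_n, where ω_n is `moment ω n`. Hence B_z^ω(ξ) =
k(conj z · ξ) with k(w) = Σ w^n / (2ω_n), and P_ω f is a power series with explicit coefficients.
The conditions on R^{ω,ν} force it to multiply the n-th coefficient by ω_n / ν_n. Therefore P_ω(g_α)
= h is an identity between coefficients (`bergmanProj_fracDeriv`), valid as soon as g_α is
integrable against ω dA. Two norm estimates remain: f ↦ P_ω f from L^p(λ_ω) to B^p, and h ↦ g_α from
B^p to L^p(λ_ω).

Both are Schur tests with constant test functions (`lintegral_schur_le`). The first kernel is (1 -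
|z|)^N |k^(N)(z conj ξ)| ω̂(ξ)(1 - |ξ|), because (P_ω f)^(N)(z) = ∫ f(ξ) conj(ξ)^N k^(N)(z conj ξ) ω
dA. For the second, `coeffMul_momentRatio_eq` writes R h as a polynomial plus (z^N / N!) ∫ h^(N)(ξ)
K(z conj ξ) (1 - |ξ|²)^N dA, where K has coefficients (n + N + 1) ω_{n+N} / (ω_α)_{n+N}. For p = ∞
only the row bounds are needed, with N = 1.

By rotation invariance the row and column integrals reduce to integral means over circles. The
required bounds are C / (ω̂(ρ)(1 - ρ)^N) for k^(N) and C (1 - ρ)^(-α-1) for K. They come from the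
coefficients alone. The two doubling conditions make (ω_x)_n comparable with (n + 1)^(-x) ω̂(1 -
1/(n+2)), and consecutive differences are smaller by a further factor n + 1; such bounds
(`SymbolBound`) survive products and inverses. Multiplication by 1 - w turns coefficients into
differences, and Cauchy–Schwarz against (1 - w)^(-1) with Parseval gives the mean
(`circleMass_powerSum_le`).

The remaining radial integrals contain the possibly very irregular density ω / ω̂. For functions
that vary slowly on hyperbolic scale, `IsDoubling.lintegral_div_wHat_le` replaces it by 1 / (1 - r),
after which only powers are integrated. -/

namespace BergmanBesov

/-! ### Power series in the disk -/

/-- The sum of the power series with coefficients `a`. -/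
noncomputable def powerSum (a : ℕ → ℂ) (z : ℂ) : ℂ := ∑' n, a n * z ^ n

/-- The power series with coefficients `a` converges in the unit disk. -/
def DiskSummable (a : ℕ → ℂ) : Prop := ∀ r : ℝ, 0 ≤ r → r < 1 → Summable fun n => ‖a n‖ * r ^ n

/-- The Taylor coefficients at the origin. -/
noncomputable def coeff (f : ℂ → ℂ) (n : ℕ) : ℂ := iteratedDeriv n f 0 / n.factorial

lemma mem_disk {z : ℂ} : z ∈ disk ↔ ‖z‖ < 1 := by simp [disk]

lemma DiskSummable.summable_norm {a : ℕ → ℂ} (ha : DiskSummable a) {z : ℂ} (hz : ‖z‖ < 1) :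
    Summable fun n => ‖a n * z ^ n‖ := by
  simpa using ha ‖z‖ (norm_nonneg z) hz

lemma DiskSummable.hasSum {a : ℕ → ℂ} (ha : DiskSummable a) {z : ℂ} (hz : ‖z‖ < 1) :
    HasSum (fun n => a n * z ^ n) (powerSum a z) :=
  (ha.summable_norm hz).of_norm.hasSum

lemma DiskSummable.of_norm_le {a b : ℕ → ℂ} (hb : DiskSummable b) (C : ℝ)
    (h : ∀ n, ‖a n‖ ≤ C * ‖b n‖) : DiskSummable a := fun r h0 h1 =>
  Summable.of_nonneg_of_le (fun n => by positivity)
    (fun n => by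
      have := mul_le_mul_of_nonneg_right (h n) (pow_nonneg h0 n)
      rwa [mul_assoc] at this) ((hb r h0 h1).mul_left C)

lemma DiskSummable.isHol {a : ℕ → ℂ} (ha : DiskSummable a) : IsHol (powerSum a) := by
  refine DifferentiableOn.analyticOnNhd (fun z hz => ?_) Metric.isOpen_ball
  rw [mem_disk] at hz
  obtain ⟨r, hzr, hr⟩ := exists_between hz
  have hr0 : 0 ≤ r := (norm_nonneg z).trans hzr.le
  have := Complex.differentiableOn_tsum_of_summable_norm (F := fun n (z : ℂ) => a n * z ^ n)
    (U := Metric.ball 0 r) (ha r hr0 hr) (fun i => by fun_prop) Metric.isOpen_ball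
    (fun i w hw => by
      have hw : ‖w‖ ≤ r := by simpa using (Metric.mem_ball.1 hw).le
      rw [norm_mul, norm_pow]; gcongr)
  exact ((this z (by simpa using hzr)).differentiableAt
    (Metric.isOpen_ball.mem_nhds (by simpa using hzr))).differentiableWithinAt

/-- The Taylor series and the series with scalars `a` both represent the function at 0, and a power
series expansion at a point is unique. -/
lemma DiskSummable.coeff_powerSum {a : ℕ → ℂ} (ha : DiskSummable a) : coeff (powerSum a) = a := by
  have h1 := (ha.isHol 0 (by simp)).hasFPowerSeriesAt
  have hrad : 0 < (FormalMultilinearSeries.ofScalars ℂ a).radius := by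
    refine lt_of_lt_of_le ?_ (FormalMultilinearSeries.le_radius_of_summable _
      (r := (1 / 2 : ℝ≥0)) ?_)
    · simp
    · simpa using ha (1 / 2) (by norm_num) (by norm_num)
  have h2 := (FormalMultilinearSeries.hasFPowerSeriesOnBall _ hrad).hasFPowerSeriesAt
  have h3 : (FormalMultilinearSeries.ofScalars ℂ a).sum = powerSum a := by
    funext z
    have := FormalMultilinearSeries.ofScalars_sum_eq a z
    simpa [FormalMultilinearSeries.ofScalarsSum, powerSum] using this
  rw [h3] at h2
  have h4 := h1.eq_formalMultilinearSeries h2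
  have h5 := FormalMultilinearSeries.ofScalars_series_injective ℂ ℂ h4
  exact h5

lemma coeff_congr {f g : ℂ → ℂ} (h : EqOn f g disk) : coeff f = coeff g := by
  funext n
  have : f =ᶠ[𝓝 0] g := h.eventuallyEq_of_mem (Metric.isOpen_ball.mem_nhds (by simp))
  simp only [coeff]
  rw [this.iteratedDeriv_eq]

lemma IsHol.congr {f g : ℂ → ℂ} (hf : IsHol f) (h : EqOn f g disk) : IsHol g :=
  AnalyticOnNhd.congr Metric.isOpen_ball hf h

lemma IsHol.differentiableOn {f : ℂ → ℂ} (hf : IsHol f) : DifferentiableOn ℂ f disk :=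
  AnalyticOnNhd.differentiableOn hf

lemma IsHol.continuousOn {f : ℂ → ℂ} (hf : IsHol f) : ContinuousOn f disk :=
  hf.differentiableOn.continuousOn

lemma IsHol.hasSum {f : ℂ → ℂ} (hf : IsHol f) {z : ℂ} (hz : ‖z‖ < 1) :
    HasSum (fun n => coeff f n * z ^ n) (f z) := by
  have := Complex.hasSum_taylorSeries_on_ball hf.differentiableOn (mem_disk.2 hz)
  refine this.congr_fun ?_ |> fun h => h
  intro n
  simp only [coeff, sub_zero, smul_eq_mul]
  ring

lemma IsHol.diskSummable_coeff {f : ℂ → ℂ} (hf : IsHol f) : DiskSummable (coeff f) := by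
  intro r h0 h1
  have := (hf.hasSum (z := r) (by simpa [abs_of_nonneg h0] using h1)).summable.norm
  simpa [abs_of_nonneg h0] using this

lemma IsHol.eqOn_powerSum {f : ℂ → ℂ} (hf : IsHol f) : EqOn (powerSum (coeff f)) f disk :=
  fun _ hz => (hf.hasSum (mem_disk.1 hz)).tsum_eq

lemma IsHol.isHol_iteratedDeriv {f : ℂ → ℂ} (hf : IsHol f) (N : ℕ) : IsHol (iteratedDeriv N f) := by
  rw [iteratedDeriv_eq_iterate]
  exact AnalyticOnNhd.iterated_deriv hf N

lemma coeff_iteratedDeriv (f : ℂ → ℂ) (N n : ℕ) :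
    coeff (iteratedDeriv N f) n = ((n + N).factorial / n.factorial : ℂ) * coeff f (n + N) := by
  have h : iteratedDeriv n (iteratedDeriv N f) = iteratedDeriv (n + N) f := by
    simp only [iteratedDeriv_eq_iterate, Function.iterate_add_apply]
  have h1 : ((n + N).factorial : ℂ) ≠ 0 := by exact_mod_cast Nat.factorial_ne_zero _
  simp only [coeff, h]
  field_simp

lemma iteratedDeriv_zero_eq_coeff (f : ℂ → ℂ) (n : ℕ) :
    iteratedDeriv n f 0 = n.factorial * coeff f n := by
  have h1 : (n.factorial : ℂ) ≠ 0 := by exact_mod_cast Nat.factorial_ne_zero _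
  simp only [coeff]
  field_simp

/-- Cauchy estimate for Taylor coefficients. -/
lemma IsHol.norm_coeff_mul_le {f : ℂ → ℂ} (hf : IsHol f) {ρ C : ℝ} (h0 : 0 < ρ) (h1 : ρ < 1)
    (hC : ∀ z : ℂ, ‖z‖ = ρ → ‖f z‖ ≤ C) (n : ℕ) : ‖coeff f n‖ ≤ C * (ρ⁻¹) ^ n := by
  have hd : DiffContOnCl ℂ f (Metric.ball 0 ρ) := by
    refine (hf.differentiableOn.mono ?_).diffContOnCl
    rw [closure_ball _ h0.ne']
    exact Metric.closedBall_subset_ball h1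
  have := Complex.norm_iteratedDeriv_le_of_forall_mem_sphere_norm_le n h0 hd
    (fun z hz => hC z (by simpa using hz))
  have hn : (0 : ℝ) < n.factorial := by exact_mod_cast Nat.factorial_pos n
  simp only [coeff, norm_div, Complex.norm_natCast]
  rw [div_le_iff₀ hn]
  calc _ ≤ _ := this
    _ = _ := by rw [inv_pow]; ring

/-- Taylor coefficients as integrals over circles. -/
lemma IsHol.integral_circle {f : ℂ → ℂ} (hf : IsHol f) {ρ : ℝ} (h0 : 0 ≤ ρ) (h1 : ρ < 1) (n : ℕ) :
    ∫ θ in (-Real.pi)..Real.pi, f (circleMap 0 ρ θ) * conj (circleMap 0 ρ θ) ^ n =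
      2 * Real.pi * ρ ^ (2 * n) * coeff f n := by
  rcases h0.eq_or_lt with rfl | h0
  · rcases n with _ | n
    · simp [coeff, circleMap]; ring_nf; simp
    · simp [circleMap]
  have hd : DiffContOnCl ℂ f (Metric.ball 0 ρ) := by
    refine (hf.differentiableOn.mono ?_).diffContOnCl
    rw [closure_ball _ h0.ne']
    exact Metric.closedBall_subset_ball h1
  have key := hd.circleIntegral_one_div_sub_center_pow_smul h0 n
  have hper : Function.Periodic
      (fun θ => f (circleMap 0 ρ θ) * conj (circleMap 0 ρ θ) ^ n) (2 * Real.pi) := by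
    intro θ
    simp only [periodic_circleMap 0 ρ θ]
  have h2 := hper.intervalIntegral_add_eq (-Real.pi) 0
  rw [show -Real.pi + 2 * Real.pi = Real.pi by ring, zero_add] at h2
  rw [h2]
  -- On the circle conj w = ρ² / w, so conj(w)^n is ρ^(2n) w^(-n) and the integrand becomes that of
  -- Cauchy's formula; the factor I⁻¹ compensates dw = I w dθ.
  have h3 : ∀ θ, f (circleMap 0 ρ θ) * conj (circleMap 0 ρ θ) ^ n =
      (ρ : ℂ) ^ (2 * n) * Complex.I⁻¹ * (deriv (circleMap 0 ρ) θ •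
        (1 / (circleMap 0 ρ θ - 0) ^ (n + 1)) • f (circleMap 0 ρ θ)) := by
    intro θ
    have hc : circleMap 0 ρ θ ≠ 0 := circleMap_ne_center h0.ne'
    have hm : conj (circleMap 0 ρ θ) * circleMap 0 ρ θ = (ρ : ℂ) ^ 2 := by
      rw [mul_comm, Complex.mul_conj, Complex.normSq_eq_norm_sq]
      simp
    have hm' : conj (circleMap 0 ρ θ) = (ρ : ℂ) ^ 2 / circleMap 0 ρ θ := by
      rw [← hm]; field_simp
    rw [hm', deriv_circleMap]
    simp only [sub_zero, smul_eq_mul]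
    rw [div_pow, ← pow_mul]
    field_simp
    ring
  simp_rw [h3]
  rw [intervalIntegral.integral_const_mul]
  unfold circleIntegral at key
  rw [key]
  simp only [coeff, smul_eq_mul]
  have hI : Complex.I ≠ 0 := Complex.I_ne_zero
  field_simp

/-! ### Polar coordinates on the disk -/

/-- The parameter domain of polar coordinates on the disk. -/
abbrev polarRect : Set (ℝ × ℝ) := Ioo (0 : ℝ) 1 ×ˢ Ioo (-Real.pi) Real.pi

lemma polarCoord_symm_eq_circleMap (p : ℝ × ℝ) :
    Complex.polarCoord.symm p = circleMap 0 p.1 p.2 := by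
  rw [Complex.polarCoord_symm_apply, circleMap, Complex.exp_mul_I]
  simp

lemma measurableSet_polarRect : MeasurableSet polarRect := measurableSet_Ioo.prod measurableSet_Ioo

lemma lintegral_disk_polar (g : ℂ → ℝ≥0∞) :
    ∫⁻ z in disk, g z = ∫⁻ p in polarRect, ENNReal.ofReal p.1 * g (circleMap 0 p.1 p.2) := by
  rw [← lintegral_indicator measurableSet_ball, ← Complex.lintegral_comp_polarCoord_symm,
    ← lintegral_indicator measurableSet_polarRect, ← lintegral_indicator]
  · congr 1
    funext p
    simp only [indicator, polarCoord_symm_eq_circleMap, polarRect, polarCoord_target, mem_prod,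
      mem_Ioo, mem_Ioi, smul_eq_mul, mem_ball_zero_iff, norm_circleMap_zero]
    by_cases h0 : 0 < p.1
    · rw [abs_of_pos h0]
      by_cases h1 : p.1 < 1 <;> simp [h0, h1]
    · simp [h0]
  · exact polarCoord.open_target.measurableSet

lemma integral_disk_polar {E : Type*} [NormedAddCommGroup E] [NormedSpace ℝ E] (g : ℂ → E) :
    ∫ z in disk, g z = ∫ p in polarRect, p.1 • g (circleMap 0 p.1 p.2) := by
  rw [← integral_indicator measurableSet_ball, ← Complex.integral_comp_polarCoord_symm,
    ← integral_indicator measurableSet_polarRect, ← integral_indicator]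
  · congr 1
    funext p
    simp only [indicator, polarCoord_symm_eq_circleMap, polarRect, polarCoord_target, mem_prod,
      mem_Ioo, mem_Ioi, mem_ball_zero_iff, norm_circleMap_zero]
    by_cases h0 : 0 < p.1
    · rw [abs_of_pos h0]
      by_cases h1 : p.1 < 1 <;> simp [h0, h1]
    · simp [h0]
  · exact polarCoord.open_target.measurableSet

/-- Change of variables with Jacobian r. The iterated integrals in polar coordinates need
integrability on the rectangle, not only equality of integrals. -/
lemma integrableOn_polarRect {E : Type*} [NormedAddCommGroup E] [NormedSpace ℝ E] {g : ℂ → E}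
    (hg : IntegrableOn g disk) :
    IntegrableOn (fun p : ℝ × ℝ => p.1 • g (circleMap 0 p.1 p.2)) polarRect := by
  have hsub : polarRect ⊆ polarCoord.target := by
    rintro p ⟨h1, h2⟩
    exact ⟨h1.1, h2⟩
  have key := (integrableOn_image_iff_integrableOn_abs_det_fderiv_smul (volume : Measure (ℝ × ℝ))
    measurableSet_polarRect
    (fun p _ => (hasFDerivAt_polarCoord_symm p).hasFDerivWithinAt)
    (polarCoord.symm.injOn.mono hsub)
    (fun q => g (Complex.measurableEquivRealProd.symm q))).1 ?_
  · refine key.congr_fun (fun p hp => ?_) measurableSet_polarRect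
    dsimp only
    rw [det_fderivPolarCoordSymm, abs_of_pos hp.1.1,
      Complex.measurableEquivRealProd_symm_polarCoord_symm_apply, polarCoord_symm_eq_circleMap]
  · have h1 : IntegrableOn (fun q => g (Complex.measurableEquivRealProd.symm q))
        (Complex.measurableEquivRealProd.symm ⁻¹' disk) :=
      (MeasurePreserving.integrableOn_comp_preimage
        (Complex.volume_preserving_equiv_real_prod.symm _)
        (MeasurableEquiv.measurableEmbedding _)).2 hg
    refine h1.mono_set ?_
    rintro _ ⟨p, hp, rfl⟩
    rw [mem_preimage, Complex.measurableEquivRealProd_symm_polarCoord_symm_apply,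
      polarCoord_symm_eq_circleMap, mem_disk, norm_circleMap_zero, abs_of_pos hp.1.1]
    exact hp.1.2

lemma lintegral_areaMeasure (g : ℂ → ℝ≥0∞) :
    ∫⁻ z, g z ∂areaMeasure = (ENNReal.ofReal Real.pi)⁻¹ *
      ∫⁻ p in polarRect, ENNReal.ofReal p.1 * g (circleMap 0 p.1 p.2) := by
  rw [areaMeasure, lintegral_smul_measure, lintegral_disk_polar, smul_eq_mul]

/-- Total integral over the circle of radius `r`. -/
noncomputable def circleMass (Φ : ℂ → ℝ≥0∞) (r : ℝ) : ℝ≥0∞ :=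
  ∫⁻ θ in Ioo (-Real.pi) Real.pi, Φ (circleMap 0 r θ)

lemma measurable_circleMap_prod : Measurable fun p : ℝ × ℝ => circleMap 0 p.1 p.2 := by
  unfold circleMap
  fun_prop

lemma lintegral_radial_mul {φ : ℝ → ℝ≥0∞} (hφ : AEMeasurable φ (volume.restrict (Ioo 0 1)))
    {Φ : ℂ → ℝ≥0∞} (hΦ : Measurable Φ) :
    ∫⁻ z, φ ‖z‖ * Φ z ∂areaMeasure = (ENNReal.ofReal Real.pi)⁻¹ *
      ∫⁻ r in Ioo 0 1, ENNReal.ofReal r * φ r * circleMass Φ r := by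
  rw [lintegral_areaMeasure]
  congr 1
  have h1 : ∀ p ∈ polarRect, ENNReal.ofReal p.1 * (φ ‖circleMap 0 p.1 p.2‖ *
      Φ (circleMap 0 p.1 p.2)) = ENNReal.ofReal p.1 * φ p.1 * Φ (circleMap 0 p.1 p.2) := by
    intro p hp
    rw [norm_circleMap_zero, abs_of_pos hp.1.1, mul_assoc]
  rw [setLIntegral_congr_fun measurableSet_polarRect h1, polarRect, Measure.volume_eq_prod,
    ← Measure.prod_restrict, lintegral_prod]
  · refine lintegral_congr fun r => ?_
    dsimp only
    rw [lintegral_const_mul]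
    · rfl
    · exact hΦ.comp (measurable_circleMap_prod.comp measurable_prodMk_left)
  · refine AEMeasurable.mul (AEMeasurable.mul (by fun_prop) ?_) ?_
    · exact hφ.comp_fst
    · exact (hΦ.comp measurable_circleMap_prod).aemeasurable

/-- The area integral of a radial function. -/
lemma lintegral_radial {φ : ℝ → ℝ≥0∞} (hφ : AEMeasurable φ (volume.restrict (Ioo 0 1))) :
    ∫⁻ z, φ ‖z‖ ∂areaMeasure = 2 * ∫⁻ r in Ioo 0 1, ENNReal.ofReal r * φ r := by
  have := lintegral_radial_mul hφ (Φ := fun _ => 1) measurable_const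
  simp only [mul_one] at this
  have hc : ∀ r, circleMass (fun _ => 1) r = ENNReal.ofReal Real.pi * 2 := by
    intro r
    simp only [circleMass, lintegral_const, Measure.restrict_apply_univ, Real.volume_Ioo, one_mul]
    rw [show (2 : ℝ≥0∞) = ENNReal.ofReal 2 by simp, ← ENNReal.ofReal_mul Real.pi_pos.le]
    congr 1
    ring
  have hm : AEMeasurable (fun r => ENNReal.ofReal r * φ r) (volume.restrict (Ioo 0 1)) :=
    AEMeasurable.mul (by fun_prop) hφ
  simp only [hc] at this
  rw [this, lintegral_mul_const'' _ hm, mul_comm _ (ENNReal.ofReal Real.pi * 2), ← mul_assoc,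
    ← mul_assoc, ENNReal.inv_mul_cancel (by simp [Real.pi_pos]) (by simp), one_mul]

lemma lintegral_area_comp_isometry (e : ℂ ≃ₗᵢ[ℝ] ℂ) (g : ℂ → ℝ≥0∞) :
    ∫⁻ ξ, g (e ξ) ∂areaMeasure = ∫⁻ ξ, g ξ ∂areaMeasure := by
  have hpre : e ⁻¹' disk = disk := by
    ext ξ
    simp
  have := e.measurePreserving.setLIntegral_comp_preimage_emb
    e.toHomeomorph.measurableEmbedding g disk
  rw [hpre] at this
  simp only [areaMeasure, lintegral_smul_measure]
  rw [this]

lemma circleMass_comp_mul (Φ : ℂ → ℝ≥0∞) (s r : ℝ) :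
    circleMass (fun w => Φ (s * w)) r = circleMass Φ (s * r) := by
  refine lintegral_congr fun θ => ?_
  simp [circleMap, mul_assoc]

/-- Polar coordinates for a radial function times a function of `e ξ`, `e` an isometry times a
dilation. -/
lemma lintegral_radial_mul_comp {φ : ℝ → ℝ≥0∞} (hφ : AEMeasurable φ (volume.restrict (Ioo 0 1)))
    {Φ : ℂ → ℝ≥0∞} (hΦ : Measurable Φ) (s : ℝ) (e : ℂ ≃ₗᵢ[ℝ] ℂ) :
    ∫⁻ ξ, φ ‖ξ‖ * Φ (s * e ξ) ∂areaMeasure = (ENNReal.ofReal Real.pi)⁻¹ *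
      ∫⁻ r in Ioo 0 1, ENNReal.ofReal r * φ r * circleMass Φ (s * r) := by
  have h1 := lintegral_area_comp_isometry e fun ξ => φ ‖ξ‖ * Φ (s * ξ)
  simp only [e.norm_map] at h1
  rw [h1, lintegral_radial_mul hφ (Φ := fun w => Φ (s * w)) (hΦ.comp (by fun_prop))]
  simp only [circleMass_comp_mul]

/-- Area measure on the disk is invariant under isometries fixing 0, so integrals of functions of z
conj ξ depend on z only through |z|. At z = 0 any isometry serves. -/
lemma exists_isometry_mul (z : ℂ) : ∃ e : ℂ ≃ₗᵢ[ℝ] ℂ, ∀ ξ, z * ξ = (‖z‖ : ℝ) * e ξ := by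
  rcases eq_or_ne z 0 with rfl | hz
  · exact ⟨LinearIsometryEquiv.refl ℝ ℂ, fun ξ => by simp⟩
  have hz' : ‖z‖ ≠ 0 := norm_ne_zero_iff.2 hz
  have hu : ‖z / ‖z‖‖ = 1 := by
    rw [norm_div, Complex.norm_real, norm_norm, div_self hz']
  refine ⟨rotation ⟨z / ‖z‖, mem_sphere_zero_iff_norm.2 hu⟩, fun ξ => ?_⟩
  change z * ξ = ‖z‖ * (z / ‖z‖ * ξ)
  have : (‖z‖ : ℂ) ≠ 0 := by exact_mod_cast hz'
  field_simp

lemma lintegral_radial_mul_conj {φ : ℝ → ℝ≥0∞} (hφ : AEMeasurable φ (volume.restrict (Ioo 0 1)))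
    {Φ : ℂ → ℝ≥0∞} (hΦ : Measurable Φ) (z : ℂ) :
    ∫⁻ ξ, φ ‖ξ‖ * Φ (z * conj ξ) ∂areaMeasure = (ENNReal.ofReal Real.pi)⁻¹ *
      ∫⁻ r in Ioo 0 1, ENNReal.ofReal r * φ r * circleMass Φ (‖z‖ * r) := by
  obtain ⟨e, he⟩ := exists_isometry_mul z
  have := lintegral_radial_mul_comp hφ hΦ ‖z‖ (Complex.conjLIE.trans e)
  rw [← this]
  refine lintegral_congr fun ξ => ?_
  rw [he]
  rfl

lemma lintegral_radial_mul_conj_left {φ : ℝ → ℝ≥0∞}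
    (hφ : AEMeasurable φ (volume.restrict (Ioo 0 1))) {Φ : ℂ → ℝ≥0∞} (hΦ : Measurable Φ) (ξ : ℂ) :
    ∫⁻ z, φ ‖z‖ * Φ (z * conj ξ) ∂areaMeasure = (ENNReal.ofReal Real.pi)⁻¹ *
      ∫⁻ r in Ioo 0 1, ENNReal.ofReal r * φ r * circleMass Φ (‖ξ‖ * r) := by
  obtain ⟨e, he⟩ := exists_isometry_mul (conj ξ)
  rw [RCLike.norm_conj] at he
  rw [← lintegral_radial_mul_comp hφ hΦ ‖ξ‖ e]
  refine lintegral_congr fun z => ?_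
  rw [mul_comm z, he]

/-! ### Radial weights -/

section Weight

variable {ν : ℝ → ℝ}

/-- The moments `∫₀¹ r^(2n+1) ν(r) dr`. -/
noncomputable def moment (ν : ℝ → ℝ) (n : ℕ) : ℝ := ∫ r in Ioo (0 : ℝ) 1, r ^ (2 * n + 1) * ν r

/-- The Jacobian r may hide a non-integrable singularity of ν at 0, hence the factor r. Almost every
ray carries an integrable section, and all sections coincide. -/
lemma integrableOn_profile (hν : IntegrableOn (fun z : ℂ => ν ‖z‖) disk) :
    IntegrableOn (fun r => r * ν r) (Ioo 0 1) := by
  have h := integrableOn_polarRect hν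
  have h' : IntegrableOn (fun p : ℝ × ℝ => p.1 * ν p.1) polarRect := by
    refine h.congr_fun (fun p hp => ?_) measurableSet_polarRect
    simp [abs_of_pos hp.1.1]
  rw [IntegrableOn, polarRect, Measure.volume_eq_prod, ← Measure.prod_restrict] at h'
  have h2 := h'.prod_left_ae
  have : (ae (volume.restrict (Ioo (-Real.pi) Real.pi))).NeBot := by
    rw [ae_neBot]
    intro h0
    have := congrArg (fun m : Measure ℝ => m univ) h0
    simp at this
    linarith [Real.pi_pos]
  exact h2.exists.choose_spec

lemma aemeasurable_profile (hν : IntegrableOn (fun z : ℂ => ν ‖z‖) disk) :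
    AEMeasurable ν (volume.restrict (Ioo 0 1)) := by
  have h := (integrableOn_profile hν).aestronglyMeasurable.aemeasurable
  have h2 : AEMeasurable (fun r : ℝ => r⁻¹ * (r * ν r)) (volume.restrict (Ioo 0 1)) :=
    AEMeasurable.mul (by fun_prop) h
  refine h2.congr ?_
  filter_upwards [ae_restrict_mem measurableSet_Ioo] with r hr
  have : r ≠ 0 := hr.1.ne'
  field_simp

lemma aemeasurable_density (hν : IntegrableOn (fun z : ℂ => ν ‖z‖) disk) :
    AEMeasurable (fun z : ℂ => ENNReal.ofReal (ν ‖z‖)) areaMeasure :=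
  (hν.aestronglyMeasurable.aemeasurable.ennreal_ofReal).smul_measure _

lemma ae_area_mem_disk : ∀ᵐ z ∂areaMeasure, ‖z‖ < 1 := by
  refine Measure.ae_smul_measure ?_ _
  filter_upwards [ae_restrict_mem measurableSet_ball] with z hz
  exact mem_disk.1 hz

lemma ae_weight_mem_disk : ∀ᵐ z ∂(weightMeasure ν), ‖z‖ < 1 :=
  (withDensity_absolutelyContinuous _ _).ae_le ae_area_mem_disk

instance isFiniteMeasure_areaMeasure : IsFiniteMeasure areaMeasure := by
  refine ⟨?_⟩
  have := lintegral_radial (φ := fun _ => 1) (by fun_prop)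
  simp only [lintegral_one, mul_one] at this
  rw [this]
  refine ENNReal.mul_lt_top (by simp) ?_
  calc ∫⁻ r in Ioo (0 : ℝ) 1, ENNReal.ofReal r ≤ ∫⁻ r in Ioo (0 : ℝ) 1, 1 := by
        refine setLIntegral_mono' measurableSet_Ioo fun r hr => ?_
        simpa using hr.2.le
    _ < ∞ := by simp

lemma isFiniteMeasure_weightMeasure (hν : IntegrableOn (fun z : ℂ => ν ‖z‖) disk) :
    IsFiniteMeasure (weightMeasure ν) := by
  refine isFiniteMeasure_withDensity ?_
  rw [areaMeasure, lintegral_smul_measure]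
  refine (ENNReal.mul_lt_top (by simp [Real.pi_pos]) ?_).ne
  exact lt_of_le_of_lt (lintegral_mono fun z => Real.ofReal_le_enorm _) hν.hasFiniteIntegral

lemma integrable_weight_iff (hν : IntegrableOn (fun z : ℂ => ν ‖z‖) disk)
    (h0 : ∀ r ∈ Ico (0 : ℝ) 1, 0 ≤ ν r) (G : ℂ → ℂ) :
    Integrable G (weightMeasure ν) ↔ IntegrableOn (fun z => (ν ‖z‖ : ℝ) • G z) disk := by
  have hpi : (ENNReal.ofReal Real.pi)⁻¹ ≠ 0 := by simp
  have hpi' : (ENNReal.ofReal Real.pi)⁻¹ ≠ ∞ := by simp [Real.pi_pos]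
  rw [weightMeasure, integrable_withDensity_iff_integrable_smul₀' (aemeasurable_density hν)
    (by simp), areaMeasure, integrable_smul_measure hpi hpi']
  refine integrable_congr ?_
  filter_upwards [ae_restrict_mem measurableSet_ball] with z hz
  rw [ENNReal.toReal_ofReal (h0 _ ⟨norm_nonneg z, mem_disk.1 hz⟩)]

lemma integral_weight (hν : IntegrableOn (fun z : ℂ => ν ‖z‖) disk)
    (h0 : ∀ r ∈ Ico (0 : ℝ) 1, 0 ≤ ν r) (G : ℂ → ℂ) :
    ∫ z, G z ∂(weightMeasure ν) = Real.pi⁻¹ • ∫ z in disk, (ν ‖z‖ : ℝ) • G z := by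
  rw [weightMeasure, integral_withDensity_eq_integral_toReal_smul₀ (aemeasurable_density hν)
    (by simp), areaMeasure, integral_smul_measure]
  congr 1
  · simp [ENNReal.toReal_ofReal Real.pi_pos.le]
  · refine setIntegral_congr_fun measurableSet_ball fun z hz => ?_
    rw [ENNReal.toReal_ofReal (h0 _ ⟨norm_nonneg z, mem_disk.1 hz⟩)]

lemma integrable_mul_conj_pow {f : ℂ → ℂ} (hf : Integrable f (weightMeasure ν)) (n : ℕ) :
    Integrable (fun ξ => f ξ * conj ξ ^ n) (weightMeasure ν) := by
  refine hf.mul_bdd (c := 1) (by fun_prop) ?_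
  filter_upwards [ae_weight_mem_disk] with z hz
  rw [norm_pow, RCLike.norm_conj]
  exact pow_le_one₀ (norm_nonneg z) hz.le

/-- Monomials extract Taylor coefficients in the pairing of a radial weight. -/
lemma integral_mul_conj_pow (hν : IntegrableOn (fun z : ℂ => ν ‖z‖) disk)
    (h0 : ∀ r ∈ Ico (0 : ℝ) 1, 0 ≤ ν r) {f : ℂ → ℂ} (hf : IsHol f)
    (hfi : Integrable f (weightMeasure ν)) (n : ℕ) :
    ∫ ξ, f ξ * conj ξ ^ n ∂(weightMeasure ν) = coeff f n * (2 * moment ν n) := by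
  have hint := integrableOn_polarRect
    ((integrable_weight_iff hν h0 _).1 (integrable_mul_conj_pow hfi n))
  rw [integral_weight hν h0, integral_disk_polar, polarRect, Measure.volume_eq_prod,
    setIntegral_prod _ hint]
  have h1 : ∀ r ∈ Ioo (0 : ℝ) 1, ∫ θ in Ioo (-Real.pi) Real.pi, r • (ν ‖circleMap 0 r θ‖ : ℝ) •
      (f (circleMap 0 r θ) * conj (circleMap 0 r θ) ^ n) =
      ((r ^ (2 * n + 1) * ν r : ℝ) : ℂ) * (2 * Real.pi * coeff f n) := by
    intro r hr
    have := hf.integral_circle hr.1.le hr.2 n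
    rw [intervalIntegral.integral_of_le (by linarith [Real.pi_pos]), integral_Ioc_eq_integral_Ioo]
      at this
    simp only [norm_circleMap_zero, abs_of_pos hr.1]
    rw [integral_smul, integral_smul, this]
    simp only [Complex.real_smul]
    push_cast
    ring
  rw [setIntegral_congr_fun measurableSet_Ioo h1, integral_mul_const, integral_complex_ofReal]
  have hpi : (Real.pi : ℂ) ≠ 0 := by exact_mod_cast Real.pi_ne_zero
  simp only [Complex.real_smul, moment]
  push_cast
  field_simp

end Weight

/-! ### The Bergman kernel of a radial weight -/

section Kernel

variable {ν : ℝ → ℝ}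

/-- The tail integral as a real number. -/
noncomputable def tail (ν : ℝ → ℝ) (r : ℝ) : ℝ := (wHat ν r).toReal

lemma integrableOn_pow_mul_profile (hν : IsRadialWeight ν) (k : ℕ) :
    IntegrableOn (fun r => r ^ (k + 1) * ν r) (Ioo 0 1) := by
  have h := integrableOn_profile hν.integrable
  have : IntegrableOn (fun r => r ^ k * (r * ν r)) (Ioo 0 1) := by
    refine h.bdd_mul (c := 1) (by fun_prop) ?_
    filter_upwards [ae_restrict_mem measurableSet_Ioo] with r hr
    rw [norm_pow, Real.norm_of_nonneg hr.1.le]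
    exact pow_le_one₀ hr.1.le hr.2.le
  refine this.congr_fun (fun r _ => ?_) measurableSet_Ioo
  ring

lemma integrableOn_profile_Ioo (hν : IsRadialWeight ν) {t : ℝ} (ht : 0 < t) :
    IntegrableOn ν (Ioo t 1) := by
  have h := (integrableOn_profile hν.integrable).mono_set (Ioo_subset_Ioo_left ht.le)
  have : IntegrableOn (fun r => r⁻¹ * (r * ν r)) (Ioo t 1) := by
    refine h.bdd_mul (c := t⁻¹) (by fun_prop) ?_
    filter_upwards [ae_restrict_mem measurableSet_Ioo] with r hr
    rw [norm_inv, Real.norm_of_nonneg (ht.trans hr.1).le]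
    exact inv_anti₀ ht hr.1.le
  refine this.congr_fun (fun r hr => ?_) measurableSet_Ioo
  have : r ≠ 0 := (ht.trans hr.1).ne'
  field_simp

lemma wHat_ne_top_of_pos (hν : IsRadialWeight ν) {t : ℝ} (ht : 0 < t) : wHat ν t ≠ ∞ :=
  (lt_of_le_of_lt (lintegral_mono fun _ => Real.ofReal_le_enorm _)
    (integrableOn_profile_Ioo hν ht).hasFiniteIntegral).ne

lemma tail_pos_of_pos (hν : IsRadialWeight ν) {t : ℝ} (ht : 0 < t) (ht1 : t < 1) : 0 < tail ν t :=
  ENNReal.toReal_pos (hν.wHat_ne_zero t ⟨ht.le, ht1⟩) (wHat_ne_top_of_pos hν ht)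

lemma tail_eq_integral (hν : IsRadialWeight ν) {t : ℝ} (ht : 0 ≤ t) :
    tail ν t = ∫ s in Ioo t 1, ν s := by
  rw [tail, wHat, integral_eq_lintegral_of_nonneg_ae]
  · filter_upwards [ae_restrict_mem measurableSet_Ioo] with r hr
    exact hν.nonneg r ⟨ht.trans hr.1.le, hr.2⟩
  · exact ((aemeasurable_profile hν.integrable).mono_measure
      (Measure.restrict_mono_set _ (Ioo_subset_Ioo_left ht))).aestronglyMeasurable

/-- Drop the mass on (0, t] and bound the power below by its value at t. Since t < 1 is arbitrary,
the inverse moments grow more slowly than any q^n with q > 1, which makes the kernel series converge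
in the disk. -/
lemma pow_mul_tail_le_moment (hν : IsRadialWeight ν) {t : ℝ} (ht : 0 < t) (n : ℕ) :
    t ^ (2 * n + 1) * tail ν t ≤ moment ν n := by
  rw [tail_eq_integral hν ht.le, ← integral_const_mul, moment]
  calc ∫ r in Ioo t 1, t ^ (2 * n + 1) * ν r ≤ ∫ r in Ioo t 1, r ^ (2 * n + 1) * ν r := by
        refine setIntegral_mono_on ((integrableOn_profile_Ioo hν ht).const_mul _)
          ((integrableOn_pow_mul_profile hν _).mono_set (Ioo_subset_Ioo_left ht.le))
          measurableSet_Ioo fun r hr => ?_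
        have := hν.nonneg r ⟨(ht.trans hr.1).le, hr.2⟩
        have := hr.1.le
        gcongr
    _ ≤ _ := by
        refine setIntegral_mono_set (integrableOn_pow_mul_profile hν _) ?_
          (Ioo_subset_Ioo_left ht.le).eventuallyLE
        filter_upwards [ae_restrict_mem measurableSet_Ioo] with r hr
        have := hν.nonneg r ⟨hr.1.le, hr.2⟩
        have := hr.1.le
        simp only [Pi.zero_apply]
        positivity

lemma moment_pos (hν : IsRadialWeight ν) (n : ℕ) : 0 < moment ν n :=
  lt_of_lt_of_le (mul_pos (by positivity) (tail_pos_of_pos hν (t := 1 / 2) (by norm_num)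
    (by norm_num))) (pow_mul_tail_le_moment hν (by norm_num) n)

lemma diskSummable_inv_moment (hν : IsRadialWeight ν) :
    DiskSummable fun n => ((2 * moment ν n : ℝ) : ℂ)⁻¹ := by
  intro r h0 h1
  -- Here r < t² < 1, so the series is dominated by the geometric series of ratio r / t².
  set t := √((1 + r) / 2) with ht
  have ht2 : t ^ 2 = (1 + r) / 2 := Real.sq_sqrt (by linarith)
  have ht0 : 0 < t := Real.sqrt_pos.2 (by linarith)
  have ht1 : t < 1 := by nlinarith
  have hT := tail_pos_of_pos hν ht0 ht1
  have hq : r / t ^ 2 < 1 := by rw [div_lt_one (by positivity), ht2]; linarith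
  refine Summable.of_nonneg_of_le (fun n => by positivity) (fun n => ?_)
    ((summable_geometric_of_lt_one (by positivity) hq).mul_left (2 * t * tail ν t)⁻¹)
  have hM := moment_pos hν n
  have h := pow_mul_tail_le_moment hν ht0 n
  rw [norm_inv, Complex.norm_real, Real.norm_of_nonneg (by positivity), div_pow,
    div_eq_mul_inv, mul_comm (r ^ n), ← mul_assoc, ← mul_inv, ← pow_mul]
  refine mul_le_mul_of_nonneg_right (inv_anti₀ (by positivity) ?_) (by positivity)
  calc 2 * t * tail ν t * t ^ (2 * n) = 2 * (t ^ (2 * n + 1) * tail ν t) := by ring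
    _ ≤ _ := by linarith

/-- The power series of the Bergman kernel of a radial weight. -/
noncomputable def kernelSeries (ν : ℝ → ℝ) : ℂ → ℂ :=
  powerSum fun n => ((2 * moment ν n : ℝ) : ℂ)⁻¹

lemma diskSummable_kernel (hν : IsRadialWeight ν) {z : ℂ} (hz : ‖z‖ < 1) :
    DiskSummable fun n => conj z ^ n * ((2 * moment ν n : ℝ) : ℂ)⁻¹ := by
  refine (diskSummable_inv_moment hν).of_norm_le 1 fun n => ?_
  rw [norm_mul, norm_pow, RCLike.norm_conj]
  gcongr
  exact pow_le_one₀ (norm_nonneg z) hz.le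

lemma powerSum_kernel (z ξ : ℂ) :
    powerSum (fun n => conj z ^ n * ((2 * moment ν n : ℝ) : ℂ)⁻¹) ξ =
      kernelSeries ν (conj z * ξ) := by
  simp only [powerSum, kernelSeries, mul_pow]
  exact tsum_congr fun n => by ring

lemma norm_powerSum_le {a : ℕ → ℂ} (ha : Summable fun n => ‖a n‖) {ξ : ℂ} (hξ : ‖ξ‖ ≤ 1) :
    ‖powerSum a ξ‖ ≤ ∑' n, ‖a n‖ := by
  have h : ∀ n, ‖a n * ξ ^ n‖ ≤ ‖a n‖ := fun n => by
    rw [norm_mul, norm_pow]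
    exact mul_le_of_le_one_right (norm_nonneg _) (pow_le_one₀ (norm_nonneg _) hξ)
  have hs : Summable fun n => ‖a n * ξ ^ n‖ :=
    Summable.of_nonneg_of_le (fun _ => norm_nonneg _) h ha
  exact (norm_tsum_le_tsum_norm hs).trans (hs.tsum_le_tsum h ha)

lemma summable_norm_kernel (hν : IsRadialWeight ν) {z : ℂ} (hz : ‖z‖ < 1) :
    Summable fun n => ‖conj z ^ n * ((2 * moment ν n : ℝ) : ℂ)⁻¹‖ := by
  refine ((diskSummable_inv_moment hν) ‖z‖ (norm_nonneg z) hz).congr fun n => ?_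
  rw [norm_mul, norm_pow, RCLike.norm_conj, mul_comm]

lemma aestronglyMeasurable_of_isHol {f : ℂ → ℂ} (hf : IsHol f) :
    AEStronglyMeasurable f areaMeasure :=
  (hf.continuousOn.aestronglyMeasurable measurableSet_ball).smul_measure _

lemma memBergmanTwo_kernel (hν : IsRadialWeight ν) {z : ℂ} (hz : ‖z‖ < 1) :
    MemBergmanTwo ν (powerSum fun n => conj z ^ n * ((2 * moment ν n : ℝ) : ℂ)⁻¹) := by
  have hhol := (diskSummable_kernel hν hz).isHol
  have := isFiniteMeasure_weightMeasure hν.integrable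
  refine ⟨hhol, MemLp.of_bound ((aestronglyMeasurable_of_isHol hhol).mono_ac
    (withDensity_absolutelyContinuous _ _))
    (∑' n, ‖conj z ^ n * ((2 * moment ν n : ℝ) : ℂ)⁻¹‖) ?_⟩
  filter_upwards [ae_weight_mem_disk] with ξ hξ
  exact norm_powerSum_le (summable_norm_kernel hν hz) hξ.le

/-- Termwise integration of a power series in `z * conj ξ`. -/
lemma hasSum_integral_mul_powerSum {κ : ℕ → ℂ} (hκ : DiskSummable κ) {f : ℂ → ℂ}
    (hf : Integrable f (weightMeasure ν)) {z : ℂ} (hz : ‖z‖ < 1) :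
    HasSum (fun n => κ n * (∫ ξ, f ξ * conj ξ ^ n ∂(weightMeasure ν)) * z ^ n)
      (∫ ξ, f ξ * powerSum κ (z * conj ξ) ∂(weightMeasure ν)) := by
  have hterm : ∀ n, Integrable (fun ξ => f ξ * conj ξ ^ n * (κ n * z ^ n))
      (weightMeasure ν) := fun n => (integrable_mul_conj_pow hf n).mul_const _
  have hsum : Summable fun n => ∫ ξ, ‖f ξ * conj ξ ^ n * (κ n * z ^ n)‖ ∂(weightMeasure ν) := by
    refine Summable.of_nonneg_of_le (fun n => integral_nonneg fun _ => norm_nonneg _)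
      (fun n => ?_) ((hκ.summable_norm hz).mul_left (∫ ξ, ‖f ξ‖ ∂(weightMeasure ν)))
    rw [← integral_mul_const]
    refine integral_mono_ae (hterm n).norm (hf.norm.mul_const _) ?_
    filter_upwards [ae_weight_mem_disk] with ξ hξ
    simp only [norm_mul, norm_pow, RCLike.norm_conj]
    gcongr
    exact mul_le_of_le_one_right (norm_nonneg _) (pow_le_one₀ (norm_nonneg _) hξ.le)
  have key := hasSum_integral_of_summable_integral_norm hterm hsum
  have h2 : ∫ ξ, ∑' n, f ξ * conj ξ ^ n * (κ n * z ^ n) ∂(weightMeasure ν) =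
      ∫ ξ, f ξ * powerSum κ (z * conj ξ) ∂(weightMeasure ν) := by
    refine integral_congr_ae (Eventually.of_forall fun ξ => ?_)
    simp only [powerSum, ← tsum_mul_left]
    refine tsum_congr fun n => ?_
    ring
  rw [← h2]
  refine key.congr_fun ?_ |> fun h => h
  intro n
  rw [integral_mul_const]
  ring

lemma conj_kernelSeries (w : ℂ) : conj (kernelSeries ν w) = kernelSeries ν (conj w) := by
  simp only [kernelSeries, powerSum, Complex.conj_tsum, map_mul, map_pow, map_inv₀,
    Complex.conj_ofReal]

/-- Absolute convergence and series expansion of the integral against the kernel series. -/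
lemma integral_mul_conj_kernelSeries (hν : IsRadialWeight ν) {f : ℂ → ℂ}
    (hf : Integrable f (weightMeasure ν)) {z : ℂ} (hz : ‖z‖ < 1) :
    Integrable (fun ξ => f ξ * conj (kernelSeries ν (conj z * ξ))) (weightMeasure ν) ∧
    HasSum (fun n => (∫ ξ, f ξ * conj ξ ^ n ∂(weightMeasure ν)) * ((2 * moment ν n : ℝ) : ℂ)⁻¹ *
        z ^ n) (∫ ξ, f ξ * conj (kernelSeries ν (conj z * ξ)) ∂(weightMeasure ν)) := by
  have hB := diskSummable_kernel hν hz
  constructor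
  · simp only [← powerSum_kernel]
    refine hf.mul_bdd (c := ∑' n, ‖conj z ^ n * ((2 * moment ν n : ℝ) : ℂ)⁻¹‖) ?_ ?_
    · exact Complex.continuous_conj.comp_aestronglyMeasurable
        ((aestronglyMeasurable_of_isHol hB.isHol).mono_ac (withDensity_absolutelyContinuous _ _))
    · filter_upwards [ae_weight_mem_disk] with ξ hξ
      rw [RCLike.norm_conj]
      exact norm_powerSum_le (summable_norm_kernel hν hz) hξ.le
  · simp only [conj_kernelSeries, map_mul, Complex.conj_conj]
    simpa only [mul_comm (∫ ξ, f ξ * conj ξ ^ _ ∂(weightMeasure ν)), kernelSeries] using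
      hasSum_integral_mul_powerSum (diskSummable_inv_moment hν) hf hz

lemma isReproducing_kernel (hν : IsRadialWeight ν) {z : ℂ} (hz : ‖z‖ < 1) :
    IsReproducing ν z (powerSum fun n => conj z ^ n * ((2 * moment ν n : ℝ) : ℂ)⁻¹) := by
  refine ⟨memBergmanTwo_kernel hν hz, fun f hf => ?_⟩
  have := isFiniteMeasure_weightMeasure hν.integrable
  have hfi : Integrable f (weightMeasure ν) := hf.2.integrable (by norm_num)
  have h := (integral_mul_conj_kernelSeries hν hfi hz).2
  simp only [powerSum_kernel]
  refine (hf.1.hasSum hz).unique ?_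
  refine h.congr_fun ?_ |> fun h => h
  intro n
  have hM : (moment ν n : ℂ) ≠ 0 := by exact_mod_cast (moment_pos hν n).ne'
  rw [integral_mul_conj_pow hν.integrable hν.nonneg hf.1 hfi]
  push_cast
  field_simp

lemma memBergmanTwo_pow (hν : IsRadialWeight ν) (n : ℕ) : MemBergmanTwo ν fun ξ => ξ ^ n := by
  have := isFiniteMeasure_weightMeasure hν.integrable
  have hhol : IsHol fun ξ => ξ ^ n := fun z _ => by fun_prop
  refine ⟨hhol, MemLp.of_bound (Continuous.aestronglyMeasurable (by fun_prop)) 1 ?_⟩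
  filter_upwards [ae_weight_mem_disk] with ξ hξ
  rw [norm_pow]
  exact pow_le_one₀ (norm_nonneg ξ) hξ.le

/-- The kernel is an arbitrary choice among reproducing functions; testing the reproducing property
on ξ^n and conjugating fixes each of its Taylor coefficients. -/
lemma bergmanKernel_eqOn (hν : IsRadialWeight ν) {z : ℂ} (hz : ‖z‖ < 1) :
    EqOn (bergmanKernel ν z) (fun ξ => kernelSeries ν (conj z * ξ)) disk := by
  have hex : ∃ B, IsReproducing ν z B := ⟨_, isReproducing_kernel hν hz⟩
  have hB : IsReproducing ν z (bergmanKernel ν z) := by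
    rw [bergmanKernel, dif_pos hex]
    exact hex.choose_spec
  have := isFiniteMeasure_weightMeasure hν.integrable
  have hBi : Integrable (bergmanKernel ν z) (weightMeasure ν) := hB.1.2.integrable (by norm_num)
  have hco : coeff (bergmanKernel ν z) = fun n => conj z ^ n * ((2 * moment ν n : ℝ) : ℂ)⁻¹ := by
    funext n
    have h1 := hB.2 _ (memBergmanTwo_pow hν n)
    have h2 := integral_mul_conj_pow hν.integrable hν.nonneg hB.1.1 hBi n
    have h3 := congrArg conj h2
    rw [← integral_conj] at h3
    simp only [map_mul, map_pow, Complex.conj_conj, map_ofNat, Complex.conj_ofReal] at h3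
    have hM : (moment ν n : ℂ) ≠ 0 := by exact_mod_cast (moment_pos hν n).ne'
    have h4 : z ^ n = conj (coeff (bergmanKernel ν z) n) * (2 * moment ν n) := by
      rw [h1, ← h3]
      exact integral_congr_ae (Eventually.of_forall fun ξ => mul_comm _ _)
    have h5 := congrArg conj h4
    simp only [map_mul, map_pow, Complex.conj_conj, map_ofNat, Complex.conj_ofReal] at h5
    rw [h5]
    push_cast
    field_simp
  intro ξ hξ
  rw [← hB.1.1.eqOn_powerSum hξ, hco, powerSum_kernel]

/-- The coefficients of the Bergman projection. -/
noncomputable def projCoeff (ν : ℝ → ℝ) (f : ℂ → ℂ) (n : ℕ) : ℂ :=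
  (∫ ξ, f ξ * conj ξ ^ n ∂(weightMeasure ν)) * ((2 * moment ν n : ℝ) : ℂ)⁻¹

lemma norm_integral_mul_conj_pow_le {f : ℂ → ℂ} (hf : Integrable f (weightMeasure ν)) (n : ℕ) :
    ‖∫ ξ, f ξ * conj ξ ^ n ∂(weightMeasure ν)‖ ≤ ∫ ξ, ‖f ξ‖ ∂(weightMeasure ν) := by
  refine (norm_integral_le_integral_norm _).trans
    (integral_mono_ae (integrable_mul_conj_pow hf n).norm hf.norm ?_)
  filter_upwards [ae_weight_mem_disk] with ξ hξ
  simp only [norm_mul, norm_pow, RCLike.norm_conj]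
  exact mul_le_of_le_one_right (norm_nonneg _) (pow_le_one₀ (norm_nonneg _) hξ.le)

lemma diskSummable_projCoeff (hν : IsRadialWeight ν) {f : ℂ → ℂ}
    (hf : Integrable f (weightMeasure ν)) : DiskSummable (projCoeff ν f) := by
  refine (diskSummable_inv_moment hν).of_norm_le (∫ ξ, ‖f ξ‖ ∂(weightMeasure ν)) fun n => ?_
  rw [projCoeff, norm_mul]
  gcongr
  exact norm_integral_mul_conj_pow_le hf n

lemma integrable_mul_conj_bergmanKernel (hν : IsRadialWeight ν) {f : ℂ → ℂ}
    (hf : Integrable f (weightMeasure ν)) {z : ℂ} (hz : ‖z‖ < 1) :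
    Integrable (fun ξ => f ξ * conj (bergmanKernel ν z ξ)) (weightMeasure ν) := by
  refine (integral_mul_conj_kernelSeries hν hf hz).1.congr ?_
  filter_upwards [ae_weight_mem_disk] with ξ hξ
  rw [bergmanKernel_eqOn hν hz (mem_disk.2 hξ)]

lemma bergmanProj_eqOn (hν : IsRadialWeight ν) {f : ℂ → ℂ} (hf : Integrable f (weightMeasure ν)) :
    EqOn (bergmanProj ν f) (powerSum (projCoeff ν f)) disk := by
  intro z hz
  rw [mem_disk] at hz
  refine Eq.trans ?_ (integral_mul_conj_kernelSeries hν hf hz).2.tsum_eq.symm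
  refine integral_congr_ae ?_
  filter_upwards [ae_weight_mem_disk] with ξ hξ
  rw [bergmanKernel_eqOn hν hz (mem_disk.2 hξ)]

lemma isHol_bergmanProj (hν : IsRadialWeight ν) {f : ℂ → ℂ}
    (hf : Integrable f (weightMeasure ν)) : IsHol (bergmanProj ν f) :=
  (diskSummable_projCoeff hν hf).isHol.congr (bergmanProj_eqOn hν hf).symm

lemma coeff_bergmanProj (hν : IsRadialWeight ν) {f : ℂ → ℂ}
    (hf : Integrable f (weightMeasure ν)) : coeff (bergmanProj ν f) = projCoeff ν f := by
  rw [coeff_congr (bergmanProj_eqOn hν hf), (diskSummable_projCoeff hν hf).coeff_powerSum]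

end Kernel

/-! ### Coefficient multipliers and the fractional derivative -/

lemma diskSummable_of_summable {a : ℕ → ℂ} (h : ∀ z : ℂ, ‖z‖ < 1 → Summable fun n => a n * z ^ n) :
    DiskSummable a := fun r h0 h1 => by
  have := (h r (by simpa [abs_of_nonneg h0] using h1)).norm
  simpa [abs_of_nonneg h0] using this

/-- Uniqueness of power series expansions in the disk. -/
lemma coeff_eq_of_hasSum {f : ℂ → ℂ} {a : ℕ → ℂ}
    (h : ∀ z : ℂ, ‖z‖ < 1 → HasSum (fun n => a n * z ^ n) (f z)) : coeff f = a := by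
  have ha := diskSummable_of_summable fun z hz => (h z hz).summable
  rw [← ha.coeff_powerSum]
  exact coeff_congr fun z hz => (h z (mem_disk.1 hz)).unique (ha.hasSum (mem_disk.1 hz))

lemma coeff_add {f g : ℂ → ℂ} (hf : IsHol f) (hg : IsHol g) (n : ℕ) :
    coeff (f + g) n = coeff f n + coeff g n := by
  have := coeff_eq_of_hasSum (f := f + g) (a := fun n => coeff f n + coeff g n) fun z hz => by
    simpa [add_mul] using (hf.hasSum hz).add (hg.hasSum hz)
  rw [this]

lemma coeff_smul {f : ℂ → ℂ} (hf : IsHol f) (c : ℂ) (n : ℕ) :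
    coeff (c • f) n = c * coeff f n := by
  have := coeff_eq_of_hasSum (f := c • f) (a := fun n => c * coeff f n) fun z hz => by
    simpa [mul_assoc] using (hf.hasSum hz).mul_left c
  rw [this]

lemma coeff_sub {f g : ℂ → ℂ} (hf : IsHol f) (hg : IsHol g) (n : ℕ) :
    coeff (fun z => f z - g z) n = coeff f n - coeff g n := by
  have := coeff_eq_of_hasSum (f := fun z => f z - g z) (a := fun n => coeff f n - coeff g n)
    fun z hz => by simpa [sub_mul] using (hf.hasSum hz).sub (hg.hasSum hz)
  rw [this]

lemma coeff_dilation {f : ℂ → ℂ} (hf : IsHol f) {r : ℝ} (hr : r ∈ Ioo (0 : ℝ) 1) (n : ℕ) :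
    coeff (fun z => f (r * z)) n = r ^ n * coeff f n := by
  have := coeff_eq_of_hasSum (f := fun z => f (r * z)) (a := fun n => r ^ n * coeff f n)
    fun z hz => by
      have hrz : ‖(r : ℂ) * z‖ < 1 := by
        rw [norm_mul, Complex.norm_real, Real.norm_of_nonneg hr.1.le]
        nlinarith [hr.1, hr.2, norm_nonneg z]
      refine (hf.hasSum hrz).congr_fun ?_ |> fun h => h
      intro n
      ring
  rw [this]

lemma isHol_pow (n : ℕ) : IsHol fun z => z ^ n := fun z _ => by fun_prop

/-- Split r^n as √r^n · √r^n; one of the two resulting factors is bounded by its sum. -/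
lemma DiskSummable.mul {a b : ℕ → ℂ} (ha : DiskSummable a) (hb : DiskSummable b) :
    DiskSummable fun n => a n * b n := by
  intro r h0 h1
  have hs0 := Real.sqrt_nonneg r
  have hs1 : √r < 1 := by rw [Real.sqrt_lt' one_pos]; simpa using h1
  have hA := ha _ hs0 hs1
  refine Summable.of_nonneg_of_le (fun n => by positivity) (fun n => ?_)
    ((hb _ hs0 hs1).mul_left (∑' n, ‖a n‖ * √r ^ n))
  have h2 : ‖a n * b n‖ * r ^ n = (‖a n‖ * √r ^ n) * (‖b n‖ * √r ^ n) := by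
    rw [norm_mul]
    nth_rw 1 [← Real.sq_sqrt h0]
    ring
  rw [h2]
  gcongr
  exact hA.le_tsum n fun _ _ => by positivity

/-- The operator multiplying the Taylor coefficients by `c`. -/
noncomputable def coeffMul (c : ℕ → ℂ) (f : ℂ → ℂ) : ℂ → ℂ := powerSum fun n => c n * coeff f n

variable {c : ℕ → ℂ}

lemma isHol_coeffMul (hc : DiskSummable c) {f : ℂ → ℂ} (hf : IsHol f) : IsHol (coeffMul c f) :=
  (hc.mul hf.diskSummable_coeff).isHol

lemma hasSum_coeffMul (hc : DiskSummable c) {f : ℂ → ℂ} (hf : IsHol f) {z : ℂ} (hz : ‖z‖ < 1) :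
    HasSum (fun n => c n * coeff f n * z ^ n) (coeffMul c f z) :=
  (hc.mul hf.diskSummable_coeff).hasSum hz

lemma coeff_coeffMul (hc : DiskSummable c) {f : ℂ → ℂ} (hf : IsHol f) (n : ℕ) :
    coeff (coeffMul c f) n = c n * coeff f n := by
  rw [coeffMul, (hc.mul hf.diskSummable_coeff).coeff_powerSum]

/-- If the compact set lies in |z| < r and r < ρ < 1, Cauchy's estimate on |w| = ρ bounds the k-th
coefficient of f - F n by a small multiple of ρ^(-k), and the multiplier series converges at r / ρ <
1. -/
lemma tendsto_coeffMul (hc : DiskSummable c) {F : ℕ → ℂ → ℂ} {f : ℂ → ℂ} (hF : ∀ n, IsHol (F n))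
    (hf : IsHol f) (h : TendstoLocallyUniformlyOn F f atTop disk) :
    TendstoLocallyUniformlyOn (fun n => coeffMul c (F n)) (coeffMul c f) atTop disk := by
  rw [tendstoLocallyUniformlyOn_iff_forall_isCompact Metric.isOpen_ball] at h ⊢
  intro K hK hKc
  obtain ⟨r, ⟨hr0, hr1⟩, hKr⟩ := exists_pos_lt_subset_ball one_pos hKc.isClosed hK
  obtain ⟨ρ, hrρ, hρ1⟩ := exists_between hr1
  have hρ0 := hr0.trans hrρ
  have hu := h (Metric.closedBall 0 ρ) (Metric.closedBall_subset_ball hρ1)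
    (isCompact_closedBall 0 ρ)
  rw [Metric.tendstoUniformlyOn_iff] at hu ⊢
  have hS := hc (r / ρ) (by positivity) (by rwa [div_lt_one hρ0])
  set S := ∑' n, ‖c n‖ * (r / ρ) ^ n with hSdef
  have hS0 : 0 ≤ S := tsum_nonneg fun n => by positivity
  intro ε hε
  filter_upwards [hu (ε / (S + 1)) (by positivity)] with n hn z hz
  have hz' : ‖z‖ < r := by simpa using hKr hz
  have hz1 := hz'.trans hr1
  have hco : ∀ k, ‖coeff f k - coeff (F n) k‖ ≤ ε / (S + 1) * (ρ⁻¹) ^ k := by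
    intro k
    rw [← coeff_sub hf (hF n)]
    refine IsHol.norm_coeff_mul_le (fun w hw => (hf w hw).sub (hF n w hw)) hρ0 hρ1
      (fun w hw => ?_) k
    have := hn w (by simp [hw])
    rw [dist_eq_norm] at this
    exact this.le
  have h1 := (hasSum_coeffMul hc hf hz1).sub (hasSum_coeffMul hc (hF n) hz1)
  have h2 : ‖coeffMul c f z - coeffMul c (F n) z‖ ≤ ε / (S + 1) * S := by
    refine h1.norm_le_of_bounded (hS.hasSum.mul_left (ε / (S + 1))) fun k => ?_
    calc ‖c k * coeff f k * z ^ k - c k * coeff (F n) k * z ^ k‖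
        = ‖c k‖ * ‖coeff f k - coeff (F n) k‖ * ‖z‖ ^ k := by
          rw [← sub_mul, ← mul_sub, norm_mul, norm_mul, norm_pow]
      _ ≤ ‖c k‖ * (ε / (S + 1) * (ρ⁻¹) ^ k) * r ^ k := by
          have := hco k
          gcongr
      _ = _ := by rw [div_pow, inv_pow]; ring
  rw [dist_eq_norm]
  refine h2.trans_lt ?_
  rw [div_mul_eq_mul_div, div_lt_iff₀ (by positivity)]
  nlinarith

section FracDeriv

variable {ω ν : ℝ → ℝ}

/-- The multiplier sequence of the fractional derivative. -/
noncomputable def momentRatio (ω ν : ℝ → ℝ) (n : ℕ) : ℂ := ((moment ω n / moment ν n : ℝ) : ℂ)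

lemma moment_le_moment_zero (hω : IsRadialWeight ω) (n : ℕ) : moment ω n ≤ moment ω 0 := by
  refine setIntegral_mono_on (integrableOn_pow_mul_profile hω _)
    (integrableOn_pow_mul_profile hω _) measurableSet_Ioo fun r hr => ?_
  have := hω.nonneg r ⟨hr.1.le, hr.2⟩
  gcongr ?_ * _
  exact pow_le_pow_of_le_one hr.1.le hr.2.le (by omega)

lemma diskSummable_momentRatio (hω : IsRadialWeight ω) (hν : IsRadialWeight ν) :
    DiskSummable (momentRatio ω ν) := by
  refine (diskSummable_inv_moment hν).of_norm_le (2 * moment ω 0) fun n => ?_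
  have h1 := moment_pos hω n
  have h2 := moment_pos hν n
  have h3 := moment_le_moment_zero hω n
  rw [momentRatio, norm_inv, Complex.norm_real, Complex.norm_real,
    Real.norm_of_nonneg (by positivity), Real.norm_of_nonneg (by positivity), ← div_eq_mul_inv,
    mul_div_mul_left _ _ two_ne_zero]
  gcongr

lemma coeff_bergmanKernel (hν : IsRadialWeight ν) {z : ℂ} (hz : ‖z‖ < 1) (n : ℕ) :
    coeff (bergmanKernel ν z) n = conj z ^ n * ((2 * moment ν n : ℝ) : ℂ)⁻¹ := by
  have h : EqOn (bergmanKernel ν z)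
      (powerSum fun n => conj z ^ n * ((2 * moment ν n : ℝ) : ℂ)⁻¹) disk := fun ξ hξ => by
    rw [bergmanKernel_eqOn hν hz hξ, powerSum_kernel]
  rw [coeff_congr h, (diskSummable_kernel hν hz).coeff_powerSum]

lemma isHol_bergmanKernel (hν : IsRadialWeight ν) {z : ℂ} (hz : ‖z‖ < 1) :
    IsHol (bergmanKernel ν z) := by
  refine (diskSummable_kernel hν hz).isHol.congr fun ξ hξ => ?_
  rw [bergmanKernel_eqOn hν hz hξ, powerSum_kernel]

lemma eqOn_of_coeff_eq {f g : ℂ → ℂ} (hf : IsHol f) (hg : IsHol g)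
    (h : ∀ n, coeff f n = coeff g n) : EqOn f g disk := fun z hz => by
  rw [← hf.eqOn_powerSum hz, ← hg.eqOn_powerSum hz, funext h]

lemma isFracDeriv_coeffMul (hω : IsRadialWeight ω) (hν : IsRadialWeight ν) :
    IsFracDeriv ω ν (coeffMul (momentRatio ω ν)) := by
  have hc := diskSummable_momentRatio hω hν
  refine ⟨fun f hf => isHol_coeffMul hc hf, ?_, ?_, fun F f hF hf h => tendsto_coeffMul hc hF hf h,
    ?_, ?_⟩
  · intro f g hf hg
    have hfg : IsHol (f + g) := fun z hz => (hf z hz).add (hg z hz)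
    refine eqOn_of_coeff_eq (isHol_coeffMul hc hfg)
      (fun z hz => (isHol_coeffMul hc hf z hz).add (isHol_coeffMul hc hg z hz)) fun n => ?_
    rw [coeff_add (isHol_coeffMul hc hf) (isHol_coeffMul hc hg), coeff_coeffMul hc hfg,
      coeff_coeffMul hc hf, coeff_coeffMul hc hg, coeff_add hf hg, mul_add]
  · intro a f hf
    have haf : IsHol (a • f) := fun z hz => (hf z hz).const_smul
    refine eqOn_of_coeff_eq (isHol_coeffMul hc haf)
      (fun z hz => (isHol_coeffMul hc hf z hz).const_smul) fun n => ?_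
    rw [coeff_smul (isHol_coeffMul hc hf), coeff_coeffMul hc haf, coeff_coeffMul hc hf,
      coeff_smul hf, mul_left_comm]
  · intro r hr f hf
    have hdil : ∀ g : ℂ → ℂ, IsHol g → IsHol fun z => g (r * z) := fun g hg z hz => by
      have hrz : (r : ℂ) * z ∈ disk := by
        rw [mem_disk] at hz ⊢
        rw [norm_mul, Complex.norm_real, Real.norm_of_nonneg hr.1.le]
        nlinarith [hr.1, hr.2, norm_nonneg z]
      exact (hg _ hrz).comp (f := fun z => (r : ℂ) * z) (by fun_prop)
    refine eqOn_of_coeff_eq (hdil _ (isHol_coeffMul hc hf)) (isHol_coeffMul hc (hdil _ hf))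
      fun n => ?_
    rw [coeff_dilation (isHol_coeffMul hc hf) hr, coeff_coeffMul hc hf,
      coeff_coeffMul hc (hdil _ hf), coeff_dilation hf hr, mul_left_comm]
  · intro z hz
    rw [mem_disk] at hz
    refine eqOn_of_coeff_eq (isHol_coeffMul hc (isHol_bergmanKernel hω hz))
      (isHol_bergmanKernel hν hz) fun n => ?_
    have h1 : (moment ω n : ℂ) ≠ 0 := by exact_mod_cast (moment_pos hω n).ne'
    have h2 : (moment ν n : ℂ) ≠ 0 := by exact_mod_cast (moment_pos hν n).ne'
    rw [coeff_coeffMul hc (isHol_bergmanKernel hω hz), coeff_bergmanKernel hω hz,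
      coeff_bergmanKernel hν hz, momentRatio]
    push_cast
    field_simp

lemma IsHol.tendsto_partialSum {f : ℂ → ℂ} (hf : IsHol f) :
    TendstoLocallyUniformlyOn (fun N z => ∑ n ∈ Finset.range N, coeff f n * z ^ n) f atTop disk := by
  rw [tendstoLocallyUniformlyOn_iff_forall_isCompact Metric.isOpen_ball]
  intro K hK hKc
  obtain ⟨r, ⟨hr0, hr1⟩, hKr⟩ := exists_pos_lt_subset_ball one_pos hKc.isClosed hK
  refine (tendstoUniformlyOn_tsum_nat (hf.diskSummable_coeff r hr0.le hr1)
    (s := K) (f := fun n z => coeff f n * z ^ n) fun n z hz => ?_).congr_right fun z hz =>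
      hf.eqOn_powerSum (hK hz)
  have : ‖z‖ < r := by simpa using hKr hz
  rw [norm_mul, norm_pow]
  gcongr

namespace IsFracDeriv

variable {R : (ℂ → ℂ) → ℂ → ℂ}

/-- Commuting with the dilation by 1/2 gives g(z/2) = 2^(-n) g(z) for g = R(z^n), and this kills
every coefficient of g except the n-th. -/
lemma eqOn_pow (hR : IsFracDeriv ω ν R) (n : ℕ) :
    EqOn (R fun z => z ^ n) (fun z => coeff (R fun z => z ^ n) n * z ^ n) disk := by
  have hh := hR.hol _ (isHol_pow n)
  have hr : (1 / 2 : ℝ) ∈ Ioo (0 : ℝ) 1 := by norm_num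
  have hzero : ∀ k, k ≠ n → coeff (R fun z => z ^ n) k = 0 := by
    intro k hk
    have h1 : EqOn (fun z => (R fun z => z ^ n) ((1 / 2 : ℝ) * z))
        (((1 / 2 : ℂ) ^ n) • (R fun z => z ^ n)) disk := by
      intro z hz
      have e1 := hR.dilation _ hr _ (isHol_pow n) hz
      have e2 := hR.map_smul ((1 / 2 : ℂ) ^ n) _ (isHol_pow n) hz
      rw [← e2]
      refine e1.trans ?_
      congr 1
      funext w
      simp [mul_pow]
    have h2 := congrFun (coeff_congr h1) k
    rw [coeff_dilation hh hr, coeff_smul hh] at h2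
    by_contra hne
    have h3 : ((1 / 2 : ℝ) : ℂ) ^ k = (1 / 2 : ℂ) ^ n := mul_right_cancel₀ hne h2
    have h4 : (1 / 2 : ℝ) ^ k = (1 / 2 : ℝ) ^ n := by
      have h5 : (((1 / 2 : ℝ) ^ k : ℝ) : ℂ) = (((1 / 2 : ℝ) ^ n : ℝ) : ℂ) := by
        push_cast
        push_cast at h3
        exact h3
      exact_mod_cast h5
    exact hk (pow_right_injective₀ (by norm_num) (by norm_num) h4)
  intro z hz
  refine (hh.hasSum (mem_disk.1 hz)).unique ?_
  have := hasSum_single (f := fun k => coeff (R fun z => z ^ n) k * z ^ k) n fun k hk => by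
    simp [hzero k hk]
  exact this

lemma eq_partialSum (hR : IsFracDeriv ω ν R) (a : ℕ → ℂ) (N : ℕ) :
    EqOn (R fun z => ∑ n ∈ Finset.range N, a n * z ^ n)
      (fun z => ∑ n ∈ Finset.range N, a n * (coeff (R fun z => z ^ n) n * z ^ n)) disk := by
  induction N with
  | zero =>
    intro z hz
    have := hR.map_smul 0 _ (isHol_pow 0) hz
    simp only [Finset.range_zero, Finset.sum_empty]
    simpa [Pi.zero_def] using this
  | succ N ih =>
    intro z hz
    have h1 : IsHol fun z => ∑ n ∈ Finset.range N, a n * z ^ n := fun z _ => by fun_prop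
    have h2 : IsHol (a N • fun z : ℂ => z ^ N) := fun z hz => (isHol_pow N z hz).const_smul
    have h3 := hR.map_add _ _ h1 h2 hz
    have h4 := hR.map_smul (a N) _ (isHol_pow N) hz
    have h5 : (fun z => ∑ n ∈ Finset.range (N + 1), a n * z ^ n) =
        (fun z => ∑ n ∈ Finset.range N, a n * z ^ n) + (a N • fun z : ℂ => z ^ N) := by
      funext w
      simp [Finset.sum_range_succ]
    rw [h5, h3, Pi.add_apply, ih hz, h4, Pi.smul_apply, hR.eqOn_pow N hz]
    simp [Finset.sum_range_succ]

lemma hasSum (hR : IsFracDeriv ω ν R) {f : ℂ → ℂ} (hf : IsHol f) {z : ℂ} (hz : ‖z‖ < 1) :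
    HasSum (fun n => coeff f n * coeff (R fun z => z ^ n) n * z ^ n) (R f z) := by
  have htend : ∀ w : ℂ, ‖w‖ < 1 → Tendsto (fun N => ∑ n ∈ Finset.range N,
      coeff f n * coeff (R fun z => z ^ n) n * w ^ n) atTop (𝓝 (R f w)) := by
    intro w hw
    have := (hR.continuous _ _ (fun N => fun z _ => by fun_prop) hf
      hf.tendsto_partialSum).tendsto_at (mem_disk.2 hw)
    refine this.congr fun N => ?_
    rw [hR.eq_partialSum _ _ (mem_disk.2 hw)]
    exact Finset.sum_congr rfl fun n _ => by ring
  -- Continuity gives only convergence of the ordered partial sums. As in Abel's lemma, convergence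
  -- at a radius ρ > |z| bounds the terms there and yields absolute convergence at z.
  obtain ⟨ρ, hzρ, hρ1⟩ := exists_between hz
  have hρ0 : 0 < ρ := (norm_nonneg z).trans_lt hzρ
  have h0 :
      Tendsto (fun n => coeff f n * coeff (R fun z => z ^ n) n * (ρ : ℂ) ^ n) atTop (𝓝 0) := by
    have h1 := htend ρ (by simpa [abs_of_pos hρ0] using hρ1)
    have h2 := (h1.comp (tendsto_add_atTop_nat 1)).sub h1
    rw [sub_self] at h2
    refine h2.congr fun N => ?_
    simp [Finset.sum_range_succ]
  obtain ⟨C, hC⟩ := h0.norm.bddAbove_range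
  have hsum : Summable fun n => coeff f n * coeff (R fun z => z ^ n) n * z ^ n := by
    refine Summable.of_norm_bounded ((summable_geometric_of_lt_one
      (div_nonneg (norm_nonneg z) hρ0.le) (by rwa [div_lt_one hρ0])).mul_left C) fun n => ?_
    have := hC ⟨n, rfl⟩
    simp only [norm_mul, norm_pow, Complex.norm_real, Real.norm_of_nonneg hρ0.le] at this ⊢
    calc ‖coeff f n‖ * ‖coeff (R fun z => z ^ n) n‖ * ‖z‖ ^ n
        = (‖coeff f n‖ * ‖coeff (R fun z => z ^ n) n‖ * ρ ^ n) * (‖z‖ / ρ) ^ n := by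
          rw [div_pow]; field_simp
      _ ≤ _ := by gcongr
  exact (hsum.hasSum_iff_tendsto_nat).2 (htend z hz)

/-- All Taylor coefficients of the kernel at the point 1/2 are nonzero, so this one kernel
determines every eigenvalue of R. -/
lemma coeff_apply_pow (hR : IsFracDeriv ω ν R) (hω : IsRadialWeight ω) (hν : IsRadialWeight ν)
    (n : ℕ) : coeff (R fun z => z ^ n) n = momentRatio ω ν n := by
  have hz : ‖(1 / 2 : ℂ)‖ < 1 := by norm_num
  have hk := congrFun (coeff_congr (hR.kernel _ (mem_disk.2 hz))) n
  rw [coeff_bergmanKernel hν hz] at hk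
  have h1 := congrFun (coeff_eq_of_hasSum fun w hw =>
    hR.hasSum (isHol_bergmanKernel hω hz) (z := w) hw) n
  rw [hk, coeff_bergmanKernel hω hz] at h1
  have e1 : (moment ω n : ℂ) ≠ 0 := by exact_mod_cast (moment_pos hω n).ne'
  have e2 : (moment ν n : ℂ) ≠ 0 := by exact_mod_cast (moment_pos hν n).ne'
  have e3 : conj (1 / 2 : ℂ) ^ n ≠ 0 := by simp
  rw [mul_assoc] at h1
  have h2 := mul_left_cancel₀ e3 h1
  rw [momentRatio]
  push_cast at h2 ⊢
  field_simp at h2 ⊢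
  exact h2.symm

lemma eqOn_coeffMul (hR : IsFracDeriv ω ν R) (hω : IsRadialWeight ω) (hν : IsRadialWeight ν)
    {f : ℂ → ℂ} (hf : IsHol f) : EqOn (R f) (coeffMul (momentRatio ω ν) f) disk := by
  intro z hz
  have h := hR.hasSum hf (mem_disk.1 hz)
  simp only [hR.coeff_apply_pow hω hν] at h
  refine h.unique ?_
  simpa only [mul_comm (coeff f _)] using
    hasSum_coeffMul (diskSummable_momentRatio hω hν) hf (mem_disk.1 hz)

end IsFracDeriv

lemma fracDeriv_eqOn (hω : IsRadialWeight ω) (hν : IsRadialWeight ν) {f : ℂ → ℂ} (hf : IsHol f) :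
    EqOn (fracDeriv ω ν f) (coeffMul (momentRatio ω ν) f) disk := by
  have hex : ∃ R, IsFracDeriv ω ν R := ⟨_, isFracDeriv_coeffMul hω hν⟩
  rw [fracDeriv, dif_pos hex]
  exact hex.choose_spec.eqOn_coeffMul hω hν hf

end FracDeriv

/-! ### Doubling weights -/

section Doubling

variable {ω : ℝ → ℝ}

lemma wHat_anti (ω : ℝ → ℝ) {r t : ℝ} (h : r ≤ t) : wHat ω t ≤ wHat ω r :=
  lintegral_mono_set (Ioo_subset_Ioo_left h)

namespace IsDoubling

/-- A radial weight is integrable away from the origin; upper doubling at r = 0 bounds ω̂(0) by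
ω̂(1/2). -/
lemma wHat_ne_top (hω : IsDoubling ω) {r : ℝ} (h0 : 0 ≤ r) : wHat ω r ≠ ∞ := by
  obtain ⟨C, hC⟩ := hω.upper
  have h1 := hC 0 ⟨le_rfl, one_pos⟩
  have h2 : wHat ω ((1 + 0) / 2) ≠ ∞ := wHat_ne_top_of_pos hω.weight (by norm_num)
  exact ((wHat_anti ω h0).trans h1).trans_lt (ENNReal.mul_lt_top (by simp) h2.lt_top) |>.ne

lemma tail_pos (hω : IsDoubling ω) {r : ℝ} (h0 : 0 ≤ r) (h1 : r < 1) : 0 < tail ω r :=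
  ENNReal.toReal_pos (hω.weight.wHat_ne_zero r ⟨h0, h1⟩) (hω.wHat_ne_top h0)

lemma ofReal_tail (hω : IsDoubling ω) {r : ℝ} (h0 : 0 ≤ r) : ENNReal.ofReal (tail ω r) = wHat ω r :=
  ENNReal.ofReal_toReal (hω.wHat_ne_top h0)

lemma tail_anti (hω : IsDoubling ω) {r t : ℝ} (h0 : 0 ≤ r) (h : r ≤ t) : tail ω t ≤ tail ω r :=
  ENNReal.toReal_mono (hω.wHat_ne_top h0) (wHat_anti ω h)

lemma integrableOn (hω : IsDoubling ω) : IntegrableOn ω (Ioo 0 1) := by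
  refine ⟨(aemeasurable_profile hω.weight.integrable).aestronglyMeasurable, ?_⟩
  refine lt_of_le_of_lt (le_of_eq ?_) (hω.wHat_ne_top le_rfl).lt_top
  refine setLIntegral_congr_fun measurableSet_Ioo fun r hr => ?_
  exact Real.enorm_of_nonneg (hω.weight.nonneg r ⟨hr.1.le, hr.2⟩)

lemma tail_doubling (hω : IsDoubling ω) :
    ∃ C : ℝ, 1 ≤ C ∧ ∀ r, 0 ≤ r → r < 1 → tail ω r ≤ C * tail ω ((1 + r) / 2) := by
  obtain ⟨C, hC⟩ := hω.upper
  refine ⟨max C 1, le_max_right _ _, fun r h0 h1 => ?_⟩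
  have h := ENNReal.toReal_mono (ENNReal.mul_ne_top (by simp)
    (hω.wHat_ne_top (by linarith : (0 : ℝ) ≤ (1 + r) / 2))) (hC r ⟨h0, h1⟩)
  rw [ENNReal.toReal_mul] at h
  refine h.trans ?_
  have := (hω.tail_pos (by linarith : (0 : ℝ) ≤ (1 + r) / 2) (by linarith)).le
  exact mul_le_mul_of_nonneg_right (le_max_left _ _) this

/-- Polynomial comparison of the tails of a doubling weight. -/
lemma tail_le (hω : IsDoubling ω) : ∃ C : ℝ, 1 ≤ C ∧ ∃ k : ℕ, ∀ r t, 0 ≤ r → r < 1 → 0 ≤ t → t < 1 →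
    tail ω r ≤ C * (1 + (1 - r) / (1 - t)) ^ k * tail ω t := by
  obtain ⟨C, hC1, hC⟩ := hω.tail_doubling
  have hC0 : 0 < C := by linarith
  -- With C < 2^k, a loss of C at each halving of the distance to the boundary becomes a k-th power
  -- of the ratio of distances.
  obtain ⟨k, hk⟩ := pow_unbounded_of_one_lt C (one_lt_two : (1 : ℝ) < 2)
  have hstep : ∀ j : ℕ, ∀ r t, 0 ≤ r → r < 1 → 0 ≤ t → t < 1 → 1 - r ≤ 2 ^ j * (1 - t) →
      tail ω r ≤ C ^ j * tail ω t := by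
    intro j
    induction j with
    | zero =>
      intro r t h0 h1 h2 h3 h
      simpa using hω.tail_anti h2 (by linarith : t ≤ r)
    | succ j ih =>
      intro r t h0 h1 h2 h3 h
      have h4 := ih ((1 + r) / 2) t (by linarith) (by linarith) h2 h3
        (by rw [pow_succ] at h; linarith)
      calc tail ω r ≤ C * tail ω ((1 + r) / 2) := hC r h0 h1
        _ ≤ C * (C ^ j * tail ω t) := by gcongr
        _ = _ := by ring
  refine ⟨C, hC1, k, fun r t h0 h1 h2 h3 => ?_⟩
  have ht := hω.tail_pos h2 h3
  have hd : 0 < 1 - t := by linarith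
  have hq : 0 < (1 - r) / (1 - t) := div_pos (by linarith) hd
  -- The dyadic scale of the ratio: j + 1 halvings lead from r past t. The summand 1 keeps the ratio
  -- at least 1, which also covers r > t.
  obtain ⟨j, hj1, hj2⟩ := exists_nat_pow_near (x := 1 + (1 - r) / (1 - t)) (y := 2) (by linarith)
    one_lt_two
  refine (hstep (j + 1) r t h0 h1 h2 h3 ?_).trans ?_
  · rw [← div_le_iff₀ hd]
    linarith
  · have : C ^ j ≤ (1 + (1 - r) / (1 - t)) ^ k := by
      calc C ^ j ≤ (2 ^ k) ^ j := by gcongr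
        _ = (2 ^ j) ^ k := by rw [← pow_mul, ← pow_mul, mul_comm]
        _ ≤ _ := by gcongr
    rw [pow_succ, mul_comm (C ^ j)]
    gcongr

end IsDoubling

/-- The tail of the weight at distance comparable to `1 / n` from the boundary. -/
noncomputable def tailSeq (ω : ℝ → ℝ) (n : ℕ) : ℝ := tail ω (1 - 1 / (n + 2))

lemma nodes_mem (n : ℕ) : (0 : ℝ) ≤ 1 - 1 / (n + 2) ∧ (1 - 1 / (n + 2) : ℝ) < 1 := by
  have h : (0 : ℝ) < n + 2 := by positivity
  constructor
  · rw [sub_nonneg, div_le_one h]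
    have : (0 : ℝ) ≤ n := by positivity
    linarith
  · have : (0 : ℝ) < 1 / (n + 2) := by positivity
    linarith

/-- Moments with arbitrary exponents. -/
noncomputable def fullMoment (ω : ℝ → ℝ) (n : ℕ) : ℝ := ∫ r in Ioo (0 : ℝ) 1, r ^ n * ω r

namespace IsDoubling

lemma tailSeq_pos (hω : IsDoubling ω) (n : ℕ) : 0 < tailSeq ω n :=
  hω.tail_pos (nodes_mem n).1 (nodes_mem n).2

lemma integrableOn_pow_mul (hω : IsDoubling ω) (n : ℕ) :
    IntegrableOn (fun r => r ^ n * ω r) (Ioo 0 1) := by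
  refine hω.integrableOn.bdd_mul (c := 1) (by fun_prop) ?_
  filter_upwards [ae_restrict_mem measurableSet_Ioo] with r hr
  rw [norm_pow, Real.norm_of_nonneg hr.1.le]
  exact pow_le_one₀ hr.1.le hr.2.le

/-- Beyond t the power is at most 1; below t, all but h of its N factors r are replaced by t. -/
lemma fullMoment_split (hω : IsDoubling ω) {N h : ℕ} (hN : h ≤ N) {t : ℝ} (h0 : 0 ≤ t) :
    fullMoment ω N ≤ tail ω t + t ^ (N - h) * fullMoment ω h := by
  have e1 : tail ω t = ∫ r in Ioo (0 : ℝ) 1, (Ioi t).indicator ω r := by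
    rw [tail_eq_integral hω.weight h0, setIntegral_indicator measurableSet_Ioi, inter_comm,
      Ioi_inter_Ioo, max_eq_left h0]
  have i1 : IntegrableOn ((Ioi t).indicator ω) (Ioo 0 1) :=
    hω.integrableOn.indicator measurableSet_Ioi
  rw [e1, fullMoment, fullMoment, ← integral_const_mul, ← integral_add i1
    ((hω.integrableOn_pow_mul h).const_mul _)]
  refine setIntegral_mono_on (hω.integrableOn_pow_mul N)
    (i1.add ((hω.integrableOn_pow_mul h).const_mul _)) measurableSet_Ioo fun r hr => ?_
  have hw := hω.weight.nonneg r ⟨hr.1.le, hr.2⟩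
  have hr0 := hr.1.le
  by_cases hrt : t < r
  · rw [indicator_of_mem (by exact hrt)]
    have : r ^ N * ω r ≤ 1 * ω r := by
      gcongr
      exact pow_le_one₀ hr.1.le hr.2.le
    have : 0 ≤ t ^ (N - h) * (r ^ h * ω r) := by positivity
    linarith
  · rw [indicator_of_notMem (by simpa using hrt), zero_add, ← mul_assoc]
    push Not at hrt
    gcongr
    calc r ^ N = r ^ (N - h) * r ^ h := by rw [← pow_add]; congr 1; omega
      _ ≤ _ := by gcongr

/-- Strong induction, passing from N to about N / 2. Splitting at distance L / (N + 2) from the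
boundary leaves a tail comparable with `tailSeq ω N` and a multiple of the smaller moment; for large
L the exponential decay of the multiplier beats the doubling loss, so the constant does not grow. -/
lemma fullMoment_le (hω : IsDoubling ω) :
    ∃ A : ℝ, 0 < A ∧ ∀ n, fullMoment ω n ≤ A * tailSeq ω n := by
  obtain ⟨D, hD1, k, hD⟩ := hω.tail_le
  have hD0 : 0 < D := by linarith
  have h3k : (1 : ℝ) ≤ 3 ^ k := one_le_pow₀ (by norm_num)
  have hE : (1 : ℝ) < 2 * (D * 3 ^ k) := by nlinarith
  -- L makes the contraction e^(-L/4) times the doubling loss D·3^k equal to 1/2.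
  set L := 4 * Real.log (2 * (D * 3 ^ k)) with hL
  have hL0 : 0 < L := mul_pos (by norm_num) (Real.log_pos hE)
  have hexp : Real.exp (-(L / 4)) * (D * 3 ^ k) = 1 / 2 := by
    rw [hL, mul_div_cancel_left₀ _ (by norm_num : (4 : ℝ) ≠ 0), Real.exp_neg,
      Real.exp_log (by positivity)]
    field_simp
  -- The first summand is twice the tail term, so that tail term plus A / 2 is at most A; the second
  -- covers N = 0, where the tails at 0 and 1/2 are compared.
  set A := 2 * (D * (1 + L) ^ k) + D * 3 ^ k with hA
  have hA0 : 0 < A := by positivity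
  refine ⟨A, hA0, fun n => ?_⟩
  induction n using Nat.strong_induction_on with
  | _ N ih =>
  have hvN := hω.tailSeq_pos N
  rcases Nat.eq_zero_or_pos N with rfl | hNpos
  · have h1 := hω.fullMoment_split (le_refl 0) (t := 0) le_rfl
    have h2 := hD 0 (1 - 1 / ((0 : ℕ) + 2)) le_rfl one_pos (nodes_mem 0).1 (nodes_mem 0).2
    have h3 : fullMoment ω 0 = tail ω 0 := by
      rw [tail_eq_integral hω.weight le_rfl]
      simp [fullMoment]
    rw [h3]
    refine h2.trans ?_
    norm_num at h2 ⊢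
    simp only [tailSeq] at hvN ⊢
    norm_num at hvN ⊢
    gcongr
    rw [hA]
    have : 0 ≤ 2 * (D * (1 + L) ^ k) := by positivity
    linarith
  -- The rounding is such that the distances 1/(h+2) and 1/(N+2) have ratio at most 2, while (N -
  -- h)/(N + 2) ≥ 1/4, which is the 1/4 in the exponential.
  · set h := (N - 1) / 2 with hh
    have hlt : h < N := by omega
    have hb : N ≤ 2 * h + 2 := by omega
    have hb' : 2 * h + 1 ≤ N := by omega
    have hNh : h + 1 ≤ N - h := by omega
    have hvh : tailSeq ω h ≤ D * 3 ^ k * tailSeq ω N := by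
      refine (hD _ _ (nodes_mem h).1 (nodes_mem h).2 (nodes_mem N).1 (nodes_mem N).2).trans ?_
      have h1 : (1 - (1 - 1 / ((h : ℝ) + 2))) / (1 - (1 - 1 / ((N : ℝ) + 2))) ≤ 2 := by
        rw [sub_sub_cancel, sub_sub_cancel, div_div_div_eq, one_mul, mul_one,
          div_le_iff₀ (by positivity)]
        have : (N : ℝ) ≤ 2 * h + 2 := by exact_mod_cast hb
        linarith
      have h2 : 0 ≤ (1 - (1 - 1 / ((h : ℝ) + 2))) / (1 - (1 - 1 / ((N : ℝ) + 2))) := by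
        rw [sub_sub_cancel, sub_sub_cancel]
        positivity
      have h3 := hvN.le
      rw [tailSeq] at h3 ⊢
      gcongr
      linarith
    set t := max 0 (1 - L / (N + 2)) with ht
    have ht0 : 0 ≤ t := le_max_left _ _
    have ht1 : t < 1 := by
      refine max_lt one_pos ?_
      have : 0 < L / (N + 2) := by positivity
      linarith
    have htail : tail ω t ≤ D * (1 + L) ^ k * tailSeq ω N := by
      refine (hD _ _ ht0 ht1 (nodes_mem N).1 (nodes_mem N).2).trans ?_
      have h3 := hvN.le
      rw [tailSeq] at h3 ⊢
      have h4 : 0 ≤ 1 - t := by linarith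
      have h5 : 1 - t ≤ L / (N + 2) := by
        have := le_max_right 0 (1 - L / ((N : ℝ) + 2))
        rw [← ht] at this
        linarith
      rw [sub_sub_cancel]
      have h6 : (1 - t) / (1 / ((N : ℝ) + 2)) ≤ L := by
        rw [div_le_iff₀ (by positivity)]
        simpa [div_eq_mul_inv] using h5
      have h7 : 0 ≤ (1 - t) / (1 / ((N : ℝ) + 2)) := by positivity
      gcongr
    have hpow : t ^ (N - h) ≤ Real.exp (-(L / 4)) := by
      rcases le_total (1 - L / ((N : ℝ) + 2)) 0 with hle | hle
      · rw [ht, max_eq_left hle, zero_pow (by omega)]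
        positivity
      · rw [ht, max_eq_right hle]
        calc (1 - L / ((N : ℝ) + 2)) ^ (N - h) ≤ (Real.exp (-(L / (N + 2)))) ^ (N - h) := by
              gcongr
              have := Real.add_one_le_exp (-(L / ((N : ℝ) + 2)))
              linarith
          _ = Real.exp (-(((N - h : ℕ) : ℝ) * (L / (N + 2)))) := by
              rw [← Real.exp_nat_mul]; congr 1; ring
          _ ≤ _ := by
              gcongr
              rw [← mul_div_assoc, div_le_div_iff₀ (by norm_num) (by positivity)]
              have e1 : (h : ℝ) + 1 ≤ ((N - h : ℕ) : ℝ) := by exact_mod_cast hNh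
              have e2 : (N : ℝ) ≤ 2 * h + 2 := by exact_mod_cast hb
              nlinarith
    have h1 := hω.fullMoment_split hlt.le ht0
    have h2 := ih h hlt
    calc fullMoment ω N ≤ tail ω t + t ^ (N - h) * fullMoment ω h := h1
      _ ≤ D * (1 + L) ^ k * tailSeq ω N + Real.exp (-(L / 4)) * (A * (D * 3 ^ k * tailSeq ω N)) := by
          have : t ^ (N - h) * fullMoment ω h ≤
              Real.exp (-(L / 4)) * (A * (D * 3 ^ k * tailSeq ω N)) := by
            calc t ^ (N - h) * fullMoment ω h ≤ t ^ (N - h) * (A * (D * 3 ^ k * tailSeq ω N)) := by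
                  gcongr
                  exact h2.trans (by gcongr)
              _ ≤ _ := by gcongr
          linarith
      _ = (D * (1 + L) ^ k + A * (Real.exp (-(L / 4)) * (D * 3 ^ k))) * tailSeq ω N := by ring
      _ ≤ A * tailSeq ω N := by
          rw [hexp]
          gcongr
          have : 0 ≤ D * 3 ^ k := by positivity
          rw [hA]
          linarith

end IsDoubling

end Doubling

/-! ### Moments of the weights `(1 - r)^x ω` -/

section PowWeight

variable {ω : ℝ → ℝ}

lemma powWeight_zero (ω : ℝ → ℝ) : powWeight ω 0 = ω := by
  funext r
  simp [powWeight]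

lemma aemeasurable_one_sub_rpow (x : ℝ) (μ : Measure ℝ) :
    AEMeasurable (fun r : ℝ => (1 - r) ^ x) μ := by
  have : Measurable fun r : ℝ => (1 - r) ^ x := by fun_prop
  exact this.aemeasurable

lemma isRadialWeight_powWeight (hω : IsRadialWeight ω) {x : ℝ} (hx : 0 ≤ x) :
    IsRadialWeight (powWeight ω x) := by
  refine ⟨fun r hr => ?_, ?_, fun r hr h0 => hω.wHat_ne_zero r hr ?_⟩
  · have := hω.nonneg r hr
    have : 0 ≤ 1 - r := by linarith [hr.2]
    simp only [powWeight]
    positivity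
  · have hm : Measurable fun z : ℂ => (1 - ‖z‖) ^ x := by fun_prop
    refine hω.integrable.bdd_mul (c := 1) hm.aestronglyMeasurable ?_
    filter_upwards [ae_restrict_mem measurableSet_ball] with z hz
    have h1 : 0 ≤ 1 - ‖z‖ := by linarith [mem_disk.1 hz]
    rw [Real.norm_of_nonneg (by positivity)]
    exact Real.rpow_le_one h1 (by linarith [norm_nonneg z]) hx
  · have hmw := (aemeasurable_profile hω.integrable).mono_measure
      (Measure.restrict_mono_set volume (Ioo_subset_Ioo_left hr.1))
    have hm : AEMeasurable (fun s => ENNReal.ofReal (powWeight ω x s))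
        (volume.restrict (Ioo r 1)) :=
      ((aemeasurable_one_sub_rpow x _).mul hmw).ennreal_ofReal
    rw [wHat, lintegral_eq_zero_iff' hm] at h0
    rw [wHat, lintegral_eq_zero_iff' hmw.ennreal_ofReal]
    filter_upwards [h0, ae_restrict_mem measurableSet_Ioo] with s hs hs1
    simp only [Pi.zero_apply, ENNReal.ofReal_eq_zero, powWeight] at hs ⊢
    have : 0 < (1 - s) ^ x := Real.rpow_pos_of_pos (by linarith [hs1.2]) x
    by_contra hne
    push Not at hne
    linarith [mul_pos this hne]

/-- With y = (n + 1)(1 - r), the power y^x is at most a constant times e^(1+y), and r^n ≤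
e^(-n(1-r)) absorbs this exponential up to e². -/
lemma exists_pow_mul_rpow_le {x : ℝ} (hx : 0 ≤ x) :
    ∃ C : ℝ, 0 < C ∧ ∀ n : ℕ, ∀ r : ℝ, 0 ≤ r → r ≤ 1 →
      r ^ n * (1 - r) ^ x ≤ C * ((n : ℝ) + 1) ^ (-x) := by
  obtain ⟨k, hk⟩ := exists_nat_ge x
  refine ⟨k.factorial * Real.exp 2, by positivity, fun n r h0 h1 => ?_⟩
  set y := ((n : ℝ) + 1) * (1 - r) with hy
  have h1r : 0 ≤ 1 - r := by linarith
  have hy0 : 0 ≤ y := by positivity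
  have e1 : y ^ x ≤ k.factorial * Real.exp (1 + y) := by
    calc y ^ x ≤ (1 + y) ^ x := by gcongr; linarith
      _ ≤ (1 + y) ^ (k : ℝ) := Real.rpow_le_rpow_of_exponent_le (by linarith) hk
      _ = (1 + y) ^ k := Real.rpow_natCast _ _
      _ ≤ _ := by
        have := Real.pow_div_factorial_le_exp (x := 1 + y) (by linarith) k
        rw [div_le_iff₀ (by positivity)] at this
        linarith
  have e2 : r ^ n * Real.exp (1 + y) ≤ Real.exp 2 := by
    calc r ^ n * Real.exp (1 + y) ≤ (Real.exp (-(1 - r))) ^ n * Real.exp (1 + y) := by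
          gcongr
          have := Real.add_one_le_exp (-(1 - r))
          linarith
      _ = Real.exp (1 + (1 - r)) := by
          rw [← Real.exp_nat_mul, ← Real.exp_add]
          congr 1
          rw [hy]
          ring
      _ ≤ _ := by gcongr; linarith
  have hn : (0 : ℝ) < n + 1 := by positivity
  have e3 : (1 - r) ^ x = y ^ x * ((n : ℝ) + 1) ^ (-x) := by
    rw [hy, Real.mul_rpow hn.le h1r, Real.rpow_neg hn.le]
    have : ((n : ℝ) + 1) ^ x ≠ 0 := (Real.rpow_pos_of_pos hn x).ne'
    field_simp
  have hp : 0 ≤ ((n : ℝ) + 1) ^ (-x) := by positivity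
  calc r ^ n * (1 - r) ^ x = r ^ n * y ^ x * ((n : ℝ) + 1) ^ (-x) := by rw [e3]; ring
    _ ≤ r ^ n * (k.factorial * Real.exp (1 + y)) * ((n : ℝ) + 1) ^ (-x) := by gcongr
    _ = k.factorial * (r ^ n * Real.exp (1 + y)) * ((n : ℝ) + 1) ^ (-x) := by ring
    _ ≤ _ := by gcongr

namespace IsDoubling

lemma integrableOn_pow_mul_powWeight (hω : IsDoubling ω) {x : ℝ} (hx : 0 ≤ x) (n : ℕ) :
    IntegrableOn (fun r => r ^ n * powWeight ω x r) (Ioo 0 1) := by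
  have hm : Measurable fun r : ℝ => r ^ n * (1 - r) ^ x := by fun_prop
  have : IntegrableOn (fun r => (r ^ n * (1 - r) ^ x) * ω r) (Ioo 0 1) := by
    refine hω.integrableOn.bdd_mul (c := 1) hm.aestronglyMeasurable ?_
    filter_upwards [ae_restrict_mem measurableSet_Ioo] with r hr
    have h1 : 0 ≤ 1 - r := by linarith [hr.2]
    have h2 := hr.1.le
    rw [Real.norm_of_nonneg (by positivity)]
    exact mul_le_one₀ (pow_le_one₀ h2 hr.2.le) (by positivity)
      (Real.rpow_le_one h1 (by linarith) hx)
  refine this.congr_fun (fun r _ => ?_) measurableSet_Ioo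
  simp only [powWeight]
  ring

/-- Half of the power r^(2n+1) pays for (1 - r)^x, and the other half still gives the moment of ω of
order n. -/
lemma moment_powWeight_le (hω : IsDoubling ω) {x : ℝ} (hx : 0 ≤ x) :
    ∃ C : ℝ, 0 < C ∧ ∀ n : ℕ,
      moment (powWeight ω x) n ≤ C * (((n : ℝ) + 1) ^ (-x) * tailSeq ω n) := by
  obtain ⟨C, hC, h⟩ := exists_pow_mul_rpow_le hx
  obtain ⟨A, hA, hm⟩ := hω.fullMoment_le
  refine ⟨C * A, by positivity, fun n => ?_⟩
  have h1 : moment (powWeight ω x) n ≤ C * ((n : ℝ) + 1) ^ (-x) * fullMoment ω n := by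
    rw [moment, fullMoment, ← integral_const_mul]
    refine setIntegral_mono_on (hω.integrableOn_pow_mul_powWeight hx _)
      ((hω.integrableOn_pow_mul n).const_mul _) measurableSet_Ioo fun r hr => ?_
    have hw := hω.weight.nonneg r ⟨hr.1.le, hr.2⟩
    have hr0 := hr.1.le
    have h1r : 0 ≤ 1 - r := by linarith [hr.2]
    have := h n r hr0 hr.2.le
    calc r ^ (2 * n + 1) * powWeight ω x r = r ^ (n + 1) * (r ^ n * (1 - r) ^ x) * ω r := by
          simp only [powWeight]; ring
      _ ≤ r ^ (n + 1) * (C * ((n : ℝ) + 1) ^ (-x)) * ω r := by gcongr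
      _ ≤ r ^ n * (C * ((n : ℝ) + 1) ^ (-x)) * ω r := by
          gcongr ?_ * _ * _
          exact pow_le_pow_of_le_one hr0 hr.2.le (by omega)
      _ = _ := by ring
  refine h1.trans ?_
  calc C * ((n : ℝ) + 1) ^ (-x) * fullMoment ω n
      ≤ C * ((n : ℝ) + 1) ^ (-x) * (A * tailSeq ω n) := by
        gcongr
        exact hm n
    _ = _ := by ring

/-- The difference carries a factor 1 - r² ≤ 2(1 - r), which raises the exponent x by one and so
gains 1 / (n + 1). -/
lemma moment_powWeight_sub (hω : IsDoubling ω) {x : ℝ} (hx : 0 ≤ x) :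
    ∃ C : ℝ, 0 < C ∧ ∀ n : ℕ, |moment (powWeight ω x) (n + 1) - moment (powWeight ω x) n| ≤
      C * (((n : ℝ) + 1) ^ (-x) * tailSeq ω n) / (n + 1) := by
  obtain ⟨C, hC, h⟩ := hω.moment_powWeight_le (x := x + 1) (by linarith)
  refine ⟨2 * C, by positivity, fun n => ?_⟩
  have h1 : moment (powWeight ω x) n - moment (powWeight ω x) (n + 1) =
      ∫ r in Ioo (0 : ℝ) 1, r ^ (2 * n + 1) * (1 - r ^ 2) * powWeight ω x r := by
    rw [moment, moment, ← integral_sub (hω.integrableOn_pow_mul_powWeight hx _)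
      (hω.integrableOn_pow_mul_powWeight hx _)]
    congr 1
    funext r
    ring
  have hrw := (isRadialWeight_powWeight hω.weight hx).nonneg
  have h2 : 0 ≤ moment (powWeight ω x) n - moment (powWeight ω x) (n + 1) := by
    rw [h1]
    refine setIntegral_nonneg measurableSet_Ioo fun r hr => ?_
    have hw := hrw r ⟨hr.1.le, hr.2⟩
    have hr0 := hr.1.le
    have : 0 ≤ 1 - r ^ 2 := by nlinarith [hr.2]
    positivity
  have h3 : moment (powWeight ω x) n - moment (powWeight ω x) (n + 1) ≤
      2 * moment (powWeight ω (x + 1)) n := by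
    rw [h1, moment, ← integral_const_mul]
    have i1 : IntegrableOn (fun r => r ^ (2 * n + 1) * (1 - r ^ 2) * powWeight ω x r)
        (Ioo 0 1) := by
      refine ((hω.integrableOn_pow_mul_powWeight hx (2 * n + 1)).sub
        (hω.integrableOn_pow_mul_powWeight hx (2 * n + 3))).congr_fun (fun r _ => ?_)
        measurableSet_Ioo
      simp only [Pi.sub_apply]
      ring
    refine setIntegral_mono_on i1
      ((hω.integrableOn_pow_mul_powWeight (by linarith) _).const_mul _) measurableSet_Ioo
      fun r hr => ?_
    have hw := hω.weight.nonneg r ⟨hr.1.le, hr.2⟩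
    have hr0 := hr.1.le
    have h1r : 0 < 1 - r := by linarith [hr.2]
    have e : powWeight ω (x + 1) r = (1 - r) * powWeight ω x r := by
      simp only [powWeight, Real.rpow_add_one h1r.ne']
      ring
    have hpw := hrw r ⟨hr.1.le, hr.2⟩
    rw [e]
    calc r ^ (2 * n + 1) * (1 - r ^ 2) * powWeight ω x r
        = r ^ (2 * n + 1) * ((1 + r) * (1 - r)) * powWeight ω x r := by ring
      _ ≤ r ^ (2 * n + 1) * (2 * (1 - r)) * powWeight ω x r := by
          gcongr
          linarith [hr.2]
      _ = _ := by ring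
  rw [abs_sub_comm, abs_of_nonneg h2]
  have hn : (0 : ℝ) < n + 1 := by positivity
  refine h3.trans ?_
  have e : ((n : ℝ) + 1) ^ (-(x + 1)) = ((n : ℝ) + 1) ^ (-x) / (n + 1) := by
    rw [neg_add, ← sub_eq_add_neg, Real.rpow_sub_one hn.ne']
  have := h n
  rw [e] at this
  calc 2 * moment (powWeight ω (x + 1)) n
      ≤ 2 * (C * (((n : ℝ) + 1) ^ (-x) / (n + 1) * tailSeq ω n)) := by gcongr
    _ = _ := by ring

/-- The only use of lower doubling: a proportion 1 - 1/C of the tail at r = 1 - 1/(n+2) lies in (r,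
t], that is, at distance comparable with 1/(n+1) from the boundary. There s^(2n+1) stays above
e^(-2) and (1 - s)^x is of order (n + 1)^(-x). -/
lemma le_moment_powWeight (hω : IsDoubling ω) {x : ℝ} (hx : 0 ≤ x) :
    ∃ c : ℝ, 0 < c ∧ ∀ n : ℕ,
      c * (((n : ℝ) + 1) ^ (-x) * tailSeq ω n) ≤ moment (powWeight ω x) n := by
  obtain ⟨K, hK1, C, hC1, hC⟩ := hω.lower
  have hK0 : 0 < K := by linarith
  have hC1' : (1 : ℝ) < C := by exact_mod_cast hC1
  have hC0 : (0 : ℝ) < C := by linarith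
  have hq : 0 < 1 - (C : ℝ)⁻¹ := sub_pos.2 (inv_lt_one_of_one_lt₀ hC1')
  refine ⟨Real.exp (-2) * ((2 * K) ^ (-x)) * (1 - (C : ℝ)⁻¹), by positivity, fun n => ?_⟩
  set r := (1 : ℝ) - 1 / (n + 2) with hr
  obtain ⟨hr0, hr1⟩ := nodes_mem n
  rw [← hr] at hr0 hr1
  have hn : (0 : ℝ) < n + 1 := by positivity
  have hn2 : (0 : ℝ) < n + 2 := by positivity
  have hrpos : 0 < r := by
    rw [hr, sub_pos, div_lt_one hn2]
    linarith
  set t := 1 - (1 - r) / K with ht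
  have hrt : r ≤ t := by
    have : (1 - r) / K ≤ 1 - r := div_le_self (by linarith) hK1.le
    linarith
  have ht1 : t < 1 := by
    have : 0 < (1 - r) / K := div_pos (by linarith) hK0
    linarith
  have htail : (C : ℝ) * tail ω t ≤ tail ω r := by
    have := ENNReal.toReal_mono (hω.wHat_ne_top hr0) (hC r ⟨hr0, hr1⟩)
    rwa [ENNReal.toReal_mul] at this
  have hdiff : ∫ s in Ioc r t, ω s = tail ω r - tail ω t := by
    rw [tail_eq_integral hω.weight hr0, tail_eq_integral hω.weight (hr0.trans hrt)]
    have hi := hω.integrableOn.mono_set (Ioo_subset_Ioo_left hr0)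
    rw [← Ioc_union_Ioo_eq_Ioo hrt ht1, setIntegral_union _ measurableSet_Ioo]
    · ring
    · exact hi.mono_set (fun s hs => ⟨hs.1, hs.2.trans_lt ht1⟩)
    · exact hi.mono_set (Ioo_subset_Ioo_left hrt)
    · exact Set.disjoint_left.2 fun s hs hs' => (not_lt.2 hs.2) hs'.1
  have hsub : Ioc r t ⊆ Ioo 0 1 := fun s hs => ⟨hr0.trans_lt hs.1, hs.2.trans_lt ht1⟩
  have h1t : 0 ≤ 1 - t := by linarith
  have h1 : r ^ (2 * n + 1) * (1 - t) ^ x * (tail ω r - tail ω t) ≤ moment (powWeight ω x) n := by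
    rw [← hdiff, ← integral_const_mul, moment]
    calc ∫ s in Ioc r t, r ^ (2 * n + 1) * (1 - t) ^ x * ω s
        ≤ ∫ s in Ioc r t, s ^ (2 * n + 1) * powWeight ω x s := by
          refine setIntegral_mono_on ((hω.integrableOn.mono_set hsub).const_mul _)
            ((hω.integrableOn_pow_mul_powWeight hx _).mono_set hsub) measurableSet_Ioc
            fun s hs => ?_
          have hw := hω.weight.nonneg s ⟨(hsub hs).1.le, (hsub hs).2⟩
          have hs0 := (hsub hs).1.le
          have hs1 := hs.1.le
          have hs2 := hs.2
          simp only [powWeight]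
          rw [mul_assoc]
          gcongr
      _ ≤ _ := by
          refine setIntegral_mono_set (hω.integrableOn_pow_mul_powWeight hx _) ?_
            hsub.eventuallyLE
          filter_upwards [ae_restrict_mem measurableSet_Ioo] with s hs
          exact mul_nonneg (pow_nonneg hs.1.le _)
            ((isRadialWeight_powWeight hω.weight hx).nonneg s ⟨hs.1.le, hs.2⟩)
  have e1 : (2 * K) ^ (-x) * ((n : ℝ) + 1) ^ (-x) ≤ (1 - t) ^ x := by
    have e : 1 - t = (K * (n + 2))⁻¹ := by
      rw [ht, hr]
      field_simp
      ring
    rw [e, Real.inv_rpow (by positivity), ← Real.rpow_neg (by positivity),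
      ← Real.mul_rpow (by positivity) hn.le]
    refine Real.rpow_le_rpow_of_nonpos (by positivity) ?_ (by linarith)
    nlinarith
  -- Since r = (n+1)/(n+2), one has r ≥ e^(-1/(n+1)), and (2n+1)/(n+1) ≤ 2. The shift by 2 in the
  -- nodes keeps r positive at n = 0.
  have e2 : Real.exp (-2) ≤ r ^ (2 * n + 1) := by
    have hinv : r⁻¹ = 1 + 1 / (n + 1) := by
      have : r = (n + 1) / (n + 2) := by
        rw [hr]
        field_simp
        ring
      rw [this, inv_div]
      field_simp
      ring
    have h2 : r⁻¹ ≤ Real.exp (1 / (n + 1)) := by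
      rw [hinv]
      linarith [Real.add_one_le_exp (1 / ((n : ℝ) + 1))]
    have h3 : Real.exp (-(1 / (n + 1))) ≤ r := by
      rw [Real.exp_neg]
      exact inv_le_of_inv_le₀ hrpos h2
    calc Real.exp (-2) ≤ (Real.exp (-(1 / ((n : ℝ) + 1)))) ^ (2 * n + 1) := by
          rw [← Real.exp_nat_mul]
          gcongr
          push_cast
          rw [mul_neg, neg_le_neg_iff, mul_one_div, div_le_iff₀ hn]
          linarith
      _ ≤ _ := by gcongr
  have e3 : (1 - (C : ℝ)⁻¹) * tail ω r ≤ tail ω r - tail ω t := by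
    have : tail ω t ≤ (C : ℝ)⁻¹ * tail ω r := by
      rw [inv_mul_eq_div, le_div_iff₀ hC0]
      linarith
    linarith
  have hT := hω.tail_pos hr0 hr1
  refine le_trans ?_ h1
  have : tailSeq ω n = tail ω r := rfl
  rw [this]
  calc Real.exp (-2) * ((2 * K) ^ (-x)) * (1 - (C : ℝ)⁻¹) * (((n : ℝ) + 1) ^ (-x) * tail ω r)
      = Real.exp (-2) * ((2 * K) ^ (-x) * ((n : ℝ) + 1) ^ (-x)) *
        ((1 - (C : ℝ)⁻¹) * tail ω r) := by ring
    _ ≤ _ := by gcongr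

lemma tailSeq_le_succ (hω : IsDoubling ω) :
    ∃ D : ℝ, 0 < D ∧ ∀ n, tailSeq ω n ≤ D * tailSeq ω (n + 1) := by
  obtain ⟨D, hD1, k, hD⟩ := hω.tail_le
  refine ⟨D * 3 ^ k, by positivity, fun n => ?_⟩
  refine (hD _ _ (nodes_mem n).1 (nodes_mem n).2 (nodes_mem (n + 1)).1 (nodes_mem (n + 1)).2).trans ?_
  have hv := (hω.tailSeq_pos (n + 1)).le
  have h1 : (1 - (1 - 1 / ((n : ℝ) + 2))) / (1 - (1 - 1 / (((n + 1 : ℕ) : ℝ) + 2))) ≤ 2 := by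
    rw [sub_sub_cancel, sub_sub_cancel, div_div_div_eq, one_mul, mul_one,
      div_le_iff₀ (by positivity)]
    push_cast
    have : (0 : ℝ) ≤ n := by positivity
    linarith
  have h2 : 0 ≤ (1 - (1 - 1 / ((n : ℝ) + 2))) / (1 - (1 - 1 / (((n + 1 : ℕ) : ℝ) + 2))) := by
    rw [sub_sub_cancel, sub_sub_cancel]
    positivity
  rw [tailSeq] at hv ⊢
  gcongr
  linarith

end IsDoubling

end PowWeight

/-! ### Sequences with symbol bounds -/

section Symbol

/-- The bounds `a n = O(v n)` and `a (n + 1) - a n = O(v n / (n + 1))`. -/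
def SymbolBound (v a : ℕ → ℝ) : Prop :=
  ∃ C : ℝ, 0 ≤ C ∧ ∀ n : ℕ, |a n| ≤ C * v n ∧ |a (n + 1) - a n| ≤ C * v n / (n + 1)

variable {v w a b : ℕ → ℝ}

/-- Leibniz rule for differences. The value b(n+1) is controlled by w(n) through the difference
bound, so no regularity of w is required. -/
lemma SymbolBound.mul (ha : SymbolBound v a) (hb : SymbolBound w b) :
    SymbolBound (fun n => v n * w n) fun n => a n * b n := by
  obtain ⟨C, hC, ha⟩ := ha
  obtain ⟨D, hD, hb⟩ := hb
  refine ⟨3 * (C * D), by positivity, fun n => ?_⟩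
  obtain ⟨a1, a2⟩ := ha n
  obtain ⟨b1, b2⟩ := hb n
  have p1 : 0 ≤ C * v n := (abs_nonneg _).trans a1
  have p2 : 0 ≤ D * w n := (abs_nonneg _).trans b1
  have hn : (1 : ℝ) ≤ n + 1 := by simp
  have hn0 : (0 : ℝ) < n + 1 := by positivity
  constructor
  · rw [abs_mul]
    calc |a n| * |b n| ≤ (C * v n) * (D * w n) := by gcongr
      _ ≤ _ := by nlinarith [mul_nonneg p1 p2]
  · have b3 : |b (n + 1)| ≤ 2 * (D * w n) := by
      have h1 : |b (n + 1)| ≤ |b (n + 1) - b n| + |b n| := by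
        have := abs_add_le (b (n + 1) - b n) (b n)
        rwa [sub_add_cancel] at this
      have h2 : D * w n / (n + 1) ≤ D * w n := div_le_self p2 hn
      linarith
    calc |a (n + 1) * b (n + 1) - a n * b n|
        = |(a (n + 1) - a n) * b (n + 1) + a n * (b (n + 1) - b n)| := by congr 1; ring
      _ ≤ |a (n + 1) - a n| * |b (n + 1)| + |a n| * |b (n + 1) - b n| := by
          refine (abs_add_le _ _).trans ?_
          rw [abs_mul, abs_mul]
      _ ≤ (C * v n / (n + 1)) * (2 * (D * w n)) + (C * v n) * (D * w n / (n + 1)) := by gcongr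
      _ = _ := by ring

lemma SymbolBound.shift (ha : SymbolBound v a) {D : ℝ} (hD0 : 0 ≤ D)
    (hD : ∀ n, v (n + 1) ≤ D * v n) : SymbolBound v fun n => a (n + 1) := by
  obtain ⟨C, hC, ha⟩ := ha
  refine ⟨C * D, by positivity, fun n => ?_⟩
  obtain ⟨a1, a2⟩ := ha (n + 1)
  have h1 : C * v (n + 1) ≤ C * D * v n := by
    rw [mul_assoc]
    gcongr
    exact hD n
  refine ⟨a1.trans h1, a2.trans ?_⟩
  have p1 : 0 ≤ C * v (n + 1) := (abs_nonneg _).trans a1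
  push_cast
  calc C * v (n + 1) / ((n : ℝ) + 1 + 1) ≤ C * v (n + 1) / (n + 1) := by
        gcongr
        linarith
    _ ≤ _ := by gcongr

lemma SymbolBound.shift_add (ha : SymbolBound v a) {D : ℝ} (hD0 : 0 ≤ D)
    (hD : ∀ n, v (n + 1) ≤ D * v n) (N : ℕ) : SymbolBound v fun n => a (n + N) := by
  induction N with
  | zero => simpa using ha
  | succ N ih =>
    have := ih.shift hD0 hD
    refine (congrArg (SymbolBound v) ?_).mp this
    funext n
    congr 1
    ring

lemma SymbolBound.const_mul (ha : SymbolBound v a) (c : ℝ) : SymbolBound v fun n => c * a n := by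
  obtain ⟨C, hC, ha⟩ := ha
  refine ⟨|c| * C, by positivity, fun n => ?_⟩
  obtain ⟨a1, a2⟩ := ha n
  rw [← mul_sub, abs_mul, abs_mul, mul_assoc, mul_div_assoc]
  exact ⟨by gcongr, by gcongr⟩

/-- The difference of inverses has denominator a(n+1) a(n); the lower bound on a, together with slow
decay of v, brings this back to v(n)². -/
lemma SymbolBound.inv {c C D : ℝ} (hv : ∀ n, 0 < v n) (hc : 0 < c) (hl : ∀ n, c * v n ≤ a n)
    (hC : 0 ≤ C) (hd : ∀ n : ℕ, |a (n + 1) - a n| ≤ C * v n / (n + 1)) (hD : 0 < D)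
    (hvD : ∀ n, v n ≤ D * v (n + 1)) : SymbolBound (fun n => (v n)⁻¹) fun n => (a n)⁻¹ := by
  refine ⟨max c⁻¹ (C * D / c ^ 2), by positivity, fun n => ?_⟩
  have hpos : ∀ n, 0 < a n := fun n => lt_of_lt_of_le (mul_pos hc (hv n)) (hl n)
  have h0 := hv n
  have h1 := hv (n + 1)
  constructor
  · rw [abs_of_pos (inv_pos.2 (hpos n))]
    calc (a n)⁻¹ ≤ (c * v n)⁻¹ := inv_anti₀ (by positivity) (hl n)
      _ = c⁻¹ * (v n)⁻¹ := mul_inv _ _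
      _ ≤ _ := by gcongr; exact le_max_left _ _
  · have e : (a (n + 1))⁻¹ - (a n)⁻¹ = -(a (n + 1) - a n) / (a (n + 1) * a n) := by
      have := (hpos n).ne'
      have := (hpos (n + 1)).ne'
      field_simp
      ring
    have hp : 0 < a (n + 1) * a n := mul_pos (hpos _) (hpos _)
    rw [e, abs_div, abs_neg, abs_of_pos hp]
    calc |a (n + 1) - a n| / (a (n + 1) * a n)
        ≤ (C * v n / (n + 1)) / ((c * v (n + 1)) * (c * v n)) := by
          have := hd n
          have := hl n
          have := hl (n + 1)
          have := (hpos (n + 1)).le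
          gcongr
      _ ≤ (C * v n / (n + 1)) / ((c * (v n / D)) * (c * v n)) := by
          have : v n / D ≤ v (n + 1) := by
            rw [div_le_iff₀ hD]
            linarith [hvD n]
          gcongr
      _ = (C * D / c ^ 2) * (v n)⁻¹ / (n + 1) := by field_simp
      _ ≤ _ := by gcongr; exact le_max_right _ _

lemma symbolBound_add_const (j : ℕ) :
    SymbolBound (fun n => (n : ℝ) + 1) fun n => (n : ℝ) + (j + 1) := by
  refine ⟨j + 1, by positivity, fun n => ?_⟩
  have hn : (0 : ℝ) ≤ n := by positivity
  have hj : (0 : ℝ) ≤ j := by positivity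
  constructor
  · rw [abs_of_nonneg (by positivity)]
    nlinarith
  · have : (((n + 1 : ℕ) : ℝ) + (j + 1)) - (n + (j + 1)) = 1 := by push_cast; ring
    rw [this, abs_one, mul_div_assoc, div_self (by positivity)]
    linarith

lemma symbolBound_factorial_ratio (N : ℕ) : SymbolBound (fun n => ((n : ℝ) + 1) ^ N)
    fun n => ((n + N).factorial : ℝ) / n.factorial := by
  induction N with
  | zero =>
    refine ⟨1, zero_le_one, fun n => ?_⟩
    have h1 : (n.factorial : ℝ) ≠ 0 := by positivity
    have h2 : ((n + 1).factorial : ℝ) ≠ 0 := by positivity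
    simp only [add_zero, div_self h1, div_self h2, sub_self, abs_zero, pow_zero, abs_one, mul_one,
      le_refl, true_and]
    positivity
  | succ N ih =>
    have := ih.mul (symbolBound_add_const N)
    refine (congrArg₂ SymbolBound ?_ ?_).mp this
    · funext n
      rw [pow_succ]
    · funext n
      rw [← add_assoc n N 1, Nat.factorial_succ]
      push_cast
      ring

variable {ω : ℝ → ℝ}

lemma IsDoubling.symbolBound_moment (hω : IsDoubling ω) : SymbolBound (tailSeq ω) (moment ω) := by
  obtain ⟨C, hC, h⟩ := hω.moment_powWeight_le le_rfl
  obtain ⟨D, hD, h'⟩ := hω.moment_powWeight_sub le_rfl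
  simp only [powWeight_zero, neg_zero, Real.rpow_zero, one_mul] at h h'
  refine ⟨max C D, by positivity, fun n => ?_⟩
  have := (hω.tailSeq_pos n).le
  rw [abs_of_pos (moment_pos hω.weight n)]
  refine ⟨(h n).trans (by gcongr; exact le_max_left _ _), (h' n).trans ?_⟩
  gcongr
  exact le_max_right _ _

lemma IsDoubling.symbolBound_inv_moment (hω : IsDoubling ω) {x : ℝ} (hx : 0 ≤ x) :
    SymbolBound (fun n => (((n : ℝ) + 1) ^ (-x) * tailSeq ω n)⁻¹)
      fun n => (moment (powWeight ω x) n)⁻¹ := by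
  obtain ⟨c, hc, hl⟩ := hω.le_moment_powWeight hx
  obtain ⟨C, hC, hd⟩ := hω.moment_powWeight_sub hx
  obtain ⟨D, hD, hvD⟩ := hω.tailSeq_le_succ
  refine SymbolBound.inv (D := 2 ^ x * D) (fun n => ?_) hc hl hC.le hd (by positivity) fun n => ?_
  · exact mul_pos (by positivity) (hω.tailSeq_pos n)
  · have h1 : ((n : ℝ) + 1) ^ (-x) ≤ 2 ^ x * (((n + 1 : ℕ) : ℝ) + 1) ^ (-x) := by
      rw [Real.rpow_neg (by positivity), Real.rpow_neg (by positivity), ← div_eq_mul_inv,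
        le_div_iff₀ (by positivity), inv_mul_le_iff₀ (by positivity),
        ← Real.mul_rpow (by positivity) (by positivity)]
      refine Real.rpow_le_rpow (by positivity) ?_ hx
      push_cast
      have : (0 : ℝ) ≤ n := by positivity
      linarith
    have := hω.tailSeq_pos n
    calc ((n : ℝ) + 1) ^ (-x) * tailSeq ω n
        ≤ (2 ^ x * (((n + 1 : ℕ) : ℝ) + 1) ^ (-x)) * (D * tailSeq ω (n + 1)) := by
          gcongr
          exact hvD n
      _ = _ := by ring

/-- Symbol bounds for the coefficients of the derivatives of the kernel series. -/
lemma IsDoubling.symbolBound_kernel (hω : IsDoubling ω) (N : ℕ) :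
    SymbolBound (fun n => ((n : ℝ) + 1) ^ N * (tailSeq ω n)⁻¹)
      fun n => ((n + N).factorial : ℝ) / n.factorial * (moment ω (n + N))⁻¹ := by
  obtain ⟨D, hD, hvD⟩ := hω.tailSeq_le_succ
  have h1 := hω.symbolBound_inv_moment le_rfl
  simp only [powWeight_zero, neg_zero, Real.rpow_zero, one_mul] at h1
  refine (symbolBound_factorial_ratio N).mul (h1.shift_add hD.le (fun n => ?_) N)
  rw [← div_eq_mul_inv, le_div_iff₀ (hω.tailSeq_pos n), inv_mul_le_iff₀ (hω.tailSeq_pos _),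
    mul_comm]
  exact hvD n

/-- Symbol bounds for the multipliers of the fractional derivative. -/
lemma IsDoubling.symbolBound_momentRatio (hω : IsDoubling ω) {x : ℝ} (hx : 0 ≤ x) (N : ℕ) :
    SymbolBound (fun n => ((n : ℝ) + 1) ^ (x + 1)) fun n =>
      moment ω (n + N) / moment (powWeight ω x) (n + N) * (n + (N + 1)) := by
  have h1 := hω.symbolBound_moment.mul (hω.symbolBound_inv_moment hx)
  have h2 : SymbolBound (fun n => ((n : ℝ) + 1) ^ x)
      fun n => moment ω n / moment (powWeight ω x) n := by
    refine (congrArg₂ SymbolBound ?_ ?_).mp h1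
    · funext n
      have := (hω.tailSeq_pos n).ne'
      rw [Real.rpow_neg (by positivity)]
      field_simp
    · funext n
      rw [div_eq_mul_inv]
  have h3 := (h2.shift_add (D := 2 ^ x) (by positivity) (fun n => ?_) N).mul
    (symbolBound_add_const N)
  · refine (congrArg (fun v => SymbolBound v _) ?_).mp h3
    funext n
    rw [Real.rpow_add_one (by positivity)]
  · rw [← Real.mul_rpow (by positivity) (by positivity)]
    refine Real.rpow_le_rpow (by positivity) ?_ hx
    push_cast
    have : (0 : ℝ) ≤ n := by positivity
    linarith

end Symbol

/-! ### Integral means of power series -/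

section Means

/-- The bounds (1 + y)^k ≤ 2^(k-1)(1 + y^k) and n^k ≤ k!·C(n+k, k) reduce the sum to the series for
(1 - ρ)^(-1) and (1 - ρ)^(-k-1). -/
lemma hasSum_one_add_mul_pow_le (k : ℕ) : ∃ C : ℝ, 0 < C ∧ ∀ ρ : ℝ, 0 ≤ ρ → ρ < 1 →
    Summable (fun n : ℕ => (1 + n * (1 - ρ)) ^ k * ρ ^ n) ∧
    ∑' n : ℕ, (1 + n * (1 - ρ)) ^ k * ρ ^ n ≤ C / (1 - ρ) := by
  refine ⟨2 ^ (k - 1) * (1 + k.factorial), by positivity, fun ρ h0 h1 => ?_⟩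
  have hd : 0 < 1 - ρ := by linarith
  have s1 := hasSum_geometric_of_lt_one h0 h1
  have s2 := hasSum_choose_mul_geometric_of_norm_lt_one k (r := ρ)
    (by rwa [Real.norm_of_nonneg h0])
  have s3 := (s1.add (s2.mul_left (k.factorial * (1 - ρ) ^ k))).mul_left (2 ^ (k - 1))
  have hle : ∀ n : ℕ, (1 + n * (1 - ρ)) ^ k * ρ ^ n ≤ 2 ^ (k - 1) *
      (ρ ^ n + k.factorial * (1 - ρ) ^ k * (((n + k).choose k : ℝ) * ρ ^ n)) := by
    intro n
    have hn : (0 : ℝ) ≤ n * (1 - ρ) := by positivity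
    have e1 := add_pow_le zero_le_one hn k
    have e2 : (n : ℝ) ^ k ≤ k.factorial * (n + k).choose k := by
      have h' : n ^ k ≤ k.factorial * (n + k).choose k := by
        refine (Nat.pow_le_pow_left (Nat.le_succ n) k).trans ?_
        have := Nat.pow_succ_le_ascFactorial (n + 1) k
        have h2 := Nat.ascFactorial_eq_factorial_mul_choose n k
        rw [← h2]
        exact this
      exact_mod_cast h'
    rw [one_pow, mul_pow] at e1
    calc (1 + n * (1 - ρ)) ^ k * ρ ^ n ≤
          (2 ^ (k - 1) * (1 + (n : ℝ) ^ k * (1 - ρ) ^ k)) * ρ ^ n := by gcongr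
      _ ≤ (2 ^ (k - 1) * (1 + (k.factorial * (n + k).choose k) * (1 - ρ) ^ k)) * ρ ^ n := by
          gcongr
      _ = _ := by ring
  have hs : Summable (fun n : ℕ => (1 + n * (1 - ρ)) ^ k * ρ ^ n) :=
    Summable.of_nonneg_of_le (fun n => by positivity) hle s3.summable
  refine ⟨hs, (hs.tsum_le_tsum hle s3.summable).trans (le_of_eq ?_)⟩
  rw [s3.tsum_eq]
  field_simp
  ring

lemma circleMap_mem_disk {ρ : ℝ} (h0 : 0 ≤ ρ) (h1 : ρ < 1) (θ : ℝ) : ‖circleMap 0 ρ θ‖ < 1 := by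
  rwa [norm_circleMap_zero, abs_of_nonneg h0]

lemma IsHol.continuous_circle {f : ℂ → ℂ} (hf : IsHol f) {ρ : ℝ} (h0 : 0 ≤ ρ) (h1 : ρ < 1) :
    Continuous fun θ => f (circleMap 0 ρ θ) :=
  hf.continuousOn.comp_continuous (continuous_circleMap 0 ρ)
    fun θ => mem_disk.2 (circleMap_mem_disk h0 h1 θ)

lemma circleMass_congr {Φ Ψ : ℂ → ℝ≥0∞} {ρ : ℝ} (h0 : 0 ≤ ρ) (h1 : ρ < 1)
    (h : EqOn Φ Ψ disk) : circleMass Φ ρ = circleMass Ψ ρ :=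
  lintegral_congr fun θ => h (mem_disk.2 (circleMap_mem_disk h0 h1 θ))

/-- Parseval's formula on circles. -/
lemma circleMass_sq {b : ℕ → ℂ} (hb : DiskSummable b) {ρ : ℝ} (h0 : 0 ≤ ρ) (h1 : ρ < 1) :
    circleMass (fun w => ‖powerSum b w‖ₑ ^ 2) ρ =
      ENNReal.ofReal (2 * Real.pi * ∑' n, ‖b n‖ ^ 2 * ρ ^ (2 * n)) := by
  have hf := hb.isHol
  have hcont := hf.continuous_circle h0 h1
  have hpi := Real.pi_pos
  set μ := volume.restrict (Ioc (-Real.pi) Real.pi) with hμ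
  set M := ∑' n, ‖b n‖ * ρ ^ n with hM
  have hMb : ∀ θ, ‖powerSum b (circleMap 0 ρ θ)‖ ≤ M := by
    intro θ
    have hw := circleMap_mem_disk h0 h1 θ
    refine (norm_tsum_le_tsum_norm (hb.summable_norm hw)).trans (le_of_eq ?_)
    refine tsum_congr fun n => ?_
    rw [norm_mul, norm_pow, norm_circleMap_zero, abs_of_nonneg h0]
  have hFc : ∀ k, Continuous fun θ => powerSum b (circleMap 0 ρ θ) *
      conj (circleMap 0 ρ θ) ^ k * conj (b k) := fun k =>
    (hcont.mul ((Complex.continuous_conj.comp (continuous_circleMap 0 ρ)).pow k)).mul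
      continuous_const
  have hFi : ∀ k, Integrable (fun θ => powerSum b (circleMap 0 ρ θ) *
      conj (circleMap 0 ρ θ) ^ k * conj (b k)) μ := fun k =>
    ((hFc k).integrableOn_Icc).mono_set Ioc_subset_Icc_self
  have hFn : Summable fun k => ∫ θ, ‖powerSum b (circleMap 0 ρ θ) *
      conj (circleMap 0 ρ θ) ^ k * conj (b k)‖ ∂μ := by
    refine Summable.of_nonneg_of_le (fun n => integral_nonneg fun _ => norm_nonneg _)
      (fun n => ?_) ((hb ρ h0 h1).mul_left (2 * Real.pi * M))
    have : ∫ θ, ‖powerSum b (circleMap 0 ρ θ) * conj (circleMap 0 ρ θ) ^ n * conj (b n)‖ ∂μ ≤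
        ∫ _, M * ρ ^ n * ‖b n‖ ∂μ := by
      refine integral_mono (hFi n).norm (integrable_const _) fun θ => ?_
      simp only [norm_mul, norm_pow, RCLike.norm_conj, norm_circleMap_zero, abs_of_nonneg h0]
      have := hMb θ
      gcongr
    refine this.trans (le_of_eq ?_)
    rw [integral_const, hμ]
    simp only [measureReal_restrict_apply_univ, Real.volume_real_Ioc_of_le (by linarith :
      -Real.pi ≤ Real.pi), smul_eq_mul]
    ring
  -- Only the conjugate factor of |f|² is expanded; the integrals of f against conj(w)^k are then
  -- Taylor coefficients of f.
  have key := hasSum_integral_of_summable_integral_norm hFi hFn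
  have hk : ∀ k, ∫ θ, powerSum b (circleMap 0 ρ θ) * conj (circleMap 0 ρ θ) ^ k * conj (b k) ∂μ =
      ((2 * Real.pi * (‖b k‖ ^ 2 * ρ ^ (2 * k)) : ℝ) : ℂ) := by
    intro k
    have := hf.integral_circle h0 h1 k
    rw [intervalIntegral.integral_of_le (by linarith), hb.coeff_powerSum] at this
    rw [integral_mul_const, this, mul_assoc, Complex.mul_conj, Complex.normSq_eq_norm_sq]
    push_cast
    ring
  have hs : ∫ θ, ∑' k, powerSum b (circleMap 0 ρ θ) * conj (circleMap 0 ρ θ) ^ k * conj (b k) ∂μ =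
      ((∫ θ, ‖powerSum b (circleMap 0 ρ θ)‖ ^ 2 ∂μ : ℝ) : ℂ) := by
    rw [← integral_complex_ofReal]
    refine integral_congr_ae (Eventually.of_forall fun θ => ?_)
    have e : ((‖powerSum b (circleMap 0 ρ θ)‖ ^ 2 : ℝ) : ℂ) =
        powerSum b (circleMap 0 ρ θ) * conj (powerSum b (circleMap 0 ρ θ)) := by
      rw [Complex.mul_conj, Complex.normSq_eq_norm_sq]
    have e' : conj (powerSum b (circleMap 0 ρ θ)) = ∑' k, conj (b k * circleMap 0 ρ θ ^ k) :=
      Complex.conj_tsum _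
    simp only [e]
    rw [e', ← tsum_mul_left]
    refine tsum_congr fun k => ?_
    rw [map_mul, map_pow]
    ring
  rw [hs] at key
  simp only [hk] at key
  have key2 : HasSum (fun k => 2 * Real.pi * (‖b k‖ ^ 2 * ρ ^ (2 * k)))
      (∫ θ, ‖powerSum b (circleMap 0 ρ θ)‖ ^ 2 ∂μ) := by exact_mod_cast key
  have hsq : Continuous fun θ => ‖powerSum b (circleMap 0 ρ θ)‖ ^ 2 := hcont.norm.pow 2
  rw [← tsum_mul_left, key2.tsum_eq, ofReal_integral_eq_lintegral_ofReal
    ((hsq.integrableOn_Icc).mono_set Ioc_subset_Icc_self)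
    (Eventually.of_forall fun θ => by positivity), circleMass,
    ← restrict_Ioo_eq_restrict_Ioc]
  refine lintegral_congr fun θ => ?_
  rw [ENNReal.ofReal_pow (norm_nonneg _), ofReal_norm]

lemma hasSum_sub_shift {a b : ℕ → ℂ} (ha : DiskSummable a) (hb0 : b 0 = a 0)
    (hb : ∀ n, b (n + 1) = a (n + 1) - a n) {w : ℂ} (hw : ‖w‖ < 1) :
    HasSum (fun n => b n * w ^ n) ((1 - w) * powerSum a w) := by
  have h1 := ha.hasSum hw
  have h2 := (hasSum_nat_add_iff' 1).2 h1
  have h3 := h2.sub (h1.mul_left w)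
  rw [← hasSum_nat_add_iff' 1]
  refine (congrArg₂ HasSum ?_ ?_).mp h3
  · funext n
    rw [hb]
    ring
  · simp [hb0]
    ring

/-- An estimate for the integral mean of a power series in terms of the differences of its
coefficients. -/
lemma circleMass_powerSum_le (k : ℕ) : ∃ C : ℝ, 0 < C ∧ ∀ a : ℕ → ℂ, DiskSummable a →
    ∀ ρ A : ℝ, 0 ≤ ρ → ρ < 1 → 0 ≤ A → ‖a 0‖ ≤ A * (1 - ρ) →
    (∀ n : ℕ, ‖a (n + 1) - a n‖ ≤ A * (1 - ρ) * (1 + n * (1 - ρ)) ^ k) →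
    circleMass (fun w => ‖powerSum a w‖ₑ) ρ ≤ ENNReal.ofReal (C * A) := by
  obtain ⟨C, hC, hCs⟩ := hasSum_one_add_mul_pow_le (2 * k)
  refine ⟨2 * Real.pi * √C, by positivity, fun a ha ρ A h0 h1 hA ha0 hd => ?_⟩
  have hδ : 0 < 1 - ρ := by linarith
  have hpi := Real.pi_pos
  -- These are the coefficients of (1 - w) Σ a_n w^n. In Cauchy–Schwarz against (1 - w)^(-1) the two
  -- squared norms are O(A²(1 - ρ)) and O(1/(1 - ρ)), so the powers of 1 - ρ cancel.
  let b : ℕ → ℂ := fun n => Nat.casesOn n (a 0) fun m => a (m + 1) - a m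
  have hbsum : ∀ w : ℂ, ‖w‖ < 1 → HasSum (fun n => b n * w ^ n) ((1 - w) * powerSum a w) :=
    fun w hw => hasSum_sub_shift (b := b) ha rfl (fun _ => rfl) hw
  have hb : DiskSummable b := diskSummable_of_summable fun w hw => (hbsum w hw).summable
  have hone : DiskSummable fun _ => 1 := fun r hr0 hr1 => by
    simpa using summable_geometric_of_lt_one hr0 hr1
  have hbn : ∀ n : ℕ, ‖b n‖ ≤ A * (1 - ρ) * (1 + n * (1 - ρ)) ^ k := by
    intro n
    rcases n with _ | n
    · simpa [b] using ha0
    · refine (hd n).trans ?_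
      push_cast
      gcongr
      linarith
  have hfact : EqOn (fun w => ‖powerSum a w‖ₑ)
      (fun w => ‖powerSum b w‖ₑ * ‖powerSum (fun _ => 1) w‖ₑ) disk := by
    intro w hw
    rw [mem_disk] at hw
    have e1 : powerSum b w = (1 - w) * powerSum a w := (hbsum w hw).tsum_eq
    have e2 : powerSum (fun _ => 1) w = (1 - w)⁻¹ := by
      simp only [powerSum, one_mul]
      exact tsum_geometric_of_norm_lt_one hw
    have hne : 1 - w ≠ 0 := by
      intro h
      rw [sub_eq_zero] at h
      rw [← h] at hw
      simp at hw
    simp only [e1, e2, ← enorm_mul]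
    congr 1
    field_simp
  rw [circleMass_congr h0 h1 hfact]
  have hmeas : ∀ c : ℕ → ℂ, DiskSummable c → AEMeasurable
      (fun θ => ‖powerSum c (circleMap 0 ρ θ)‖ₑ) (volume.restrict (Ioo (-Real.pi) Real.pi)) :=
    fun c hc => (hc.isHol.continuous_circle h0 h1).enorm.measurable.aemeasurable
  have hCS := ENNReal.lintegral_mul_le_Lp_mul_Lq (volume.restrict (Ioo (-Real.pi) Real.pi))
    Real.HolderConjugate.two_two (hmeas b hb) (hmeas _ hone)
  refine hCS.trans ?_
  simp only [ENNReal.rpow_ofNat]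
  have p1 := circleMass_sq hb h0 h1
  have p2 := circleMass_sq hone h0 h1
  simp only [circleMass] at p1 p2
  rw [p1, p2]
  obtain ⟨hs, hle⟩ := hCs ρ h0 h1
  have hpow : ∀ n : ℕ, ρ ^ (2 * n) ≤ ρ ^ n := fun n =>
    pow_le_pow_of_le_one h0 h1.le (by omega)
  have hterm : ∀ n : ℕ, ‖b n‖ ^ 2 * ρ ^ (2 * n) ≤
      (A * (1 - ρ)) ^ 2 * ((1 + n * (1 - ρ)) ^ (2 * k) * ρ ^ n) := by
    intro n
    calc ‖b n‖ ^ 2 * ρ ^ (2 * n) ≤ (A * (1 - ρ) * (1 + n * (1 - ρ)) ^ k) ^ 2 * ρ ^ n := by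
          have := hbn n
          have := hpow n
          gcongr
      _ = _ := by ring
  have g1 : ∑' n, ‖b n‖ ^ 2 * ρ ^ (2 * n) ≤ A ^ 2 * C * (1 - ρ) := by
    have hsum : Summable fun n => ‖b n‖ ^ 2 * ρ ^ (2 * n) :=
      Summable.of_nonneg_of_le (fun n => by positivity) hterm (hs.mul_left _)
    refine (hsum.tsum_le_tsum hterm (hs.mul_left _)).trans ?_
    rw [tsum_mul_left]
    calc (A * (1 - ρ)) ^ 2 * ∑' n : ℕ, (1 + n * (1 - ρ)) ^ (2 * k) * ρ ^ n
        ≤ (A * (1 - ρ)) ^ 2 * (C / (1 - ρ)) := by gcongr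
      _ = _ := by field_simp
  have g2 : ∑' n : ℕ, ‖(1 : ℂ)‖ ^ 2 * ρ ^ (2 * n) ≤ 1 / (1 - ρ) := by
    have hg := hasSum_geometric_of_lt_one h0 h1
    have hle : ∀ n : ℕ, ‖(1 : ℂ)‖ ^ 2 * ρ ^ (2 * n) ≤ ρ ^ n := fun n => by simpa using hpow n
    have hsum : Summable fun n : ℕ => ‖(1 : ℂ)‖ ^ 2 * ρ ^ (2 * n) :=
      Summable.of_nonneg_of_le (fun n => by positivity) hle hg.summable
    refine (hsum.tsum_le_tsum hle hg.summable).trans (le_of_eq ?_)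
    rw [hg.tsum_eq, one_div]
  rw [← ENNReal.mul_rpow_of_nonneg _ _ (by norm_num), ← ENNReal.ofReal_mul
    (mul_nonneg (by positivity) (tsum_nonneg fun n => by positivity)),
    ENNReal.ofReal_rpow_of_nonneg (mul_nonneg (mul_nonneg (by positivity)
      (tsum_nonneg fun n => by positivity)) (mul_nonneg (by positivity)
      (tsum_nonneg fun n => by positivity))) (by norm_num), ← Real.sqrt_eq_rpow]
  refine ENNReal.ofReal_le_ofReal (Real.sqrt_le_iff.2 ⟨by positivity, ?_⟩)
  calc 2 * Real.pi * (∑' n, ‖b n‖ ^ 2 * ρ ^ (2 * n)) *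
        (2 * Real.pi * ∑' n : ℕ, ‖(1 : ℂ)‖ ^ 2 * ρ ^ (2 * n))
      ≤ 2 * Real.pi * (A ^ 2 * C * (1 - ρ)) * (2 * Real.pi * (1 / (1 - ρ))) := by
        have : 0 ≤ ∑' n : ℕ, ‖(1 : ℂ)‖ ^ 2 * ρ ^ (2 * n) := tsum_nonneg fun n => by positivity
        gcongr
    _ = (2 * Real.pi * √C * A) ^ 2 := by
        rw [mul_pow, mul_pow _ (√C), Real.sq_sqrt hC.le]
        field_simp

/-- One growth condition on v(n)/(n+1) suffices: at n = 0 it controls a(0), and at general n the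
differences. -/
lemma SymbolBound.circleMass_le {v a : ℕ → ℝ} (h : SymbolBound v a) (k : ℕ) :
    ∃ C : ℝ, 0 < C ∧ (DiskSummable (fun n => (a n : ℂ)) → ∀ ρ A : ℝ, 0 ≤ ρ → ρ < 1 → 0 ≤ A →
      (∀ n : ℕ, v n / (n + 1) ≤ A * (1 - ρ) * (1 + n * (1 - ρ)) ^ k) →
      circleMass (fun w => ‖powerSum (fun n => (a n : ℂ)) w‖ₑ) ρ ≤ ENNReal.ofReal (C * A)) := by
  obtain ⟨D, hD, h⟩ := h
  obtain ⟨C, hC, hC'⟩ := circleMass_powerSum_le k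
  refine ⟨C * (D + 1), by positivity, fun ha ρ A h0 h1 hA hv => ?_⟩
  have hδ : 0 < 1 - ρ := by linarith
  rw [mul_assoc]
  have hbd : ∀ n : ℕ, D * v n / (n + 1) ≤
      (D + 1) * A * (1 - ρ) * (1 + n * (1 - ρ)) ^ k := fun n => by
    have h2 : 0 ≤ A * (1 - ρ) * (1 + n * (1 - ρ)) ^ k := by positivity
    calc D * v n / (n + 1) = D * (v n / (n + 1)) := mul_div_assoc _ _ _
      _ ≤ D * (A * (1 - ρ) * (1 + n * (1 - ρ)) ^ k) := by gcongr; exact hv n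
      _ ≤ _ := by nlinarith
  refine hC' _ ha ρ _ h0 h1 (by positivity) ?_ fun n => ?_
  · have h2 := (h 0).1
    have h3 := hbd 0
    simp only [Nat.cast_zero, zero_add, div_one, zero_mul, add_zero, one_pow, mul_one] at h3
    rw [Complex.norm_real, Real.norm_eq_abs]
    exact h2.trans h3
  · rw [← Complex.ofReal_sub, Complex.norm_real, Real.norm_eq_abs]
    exact (h n).2.trans (hbd n)

end Means

/-! ### Integral means of the Bergman kernel and of the kernel of the fractional derivative. -/

section KernelMeans

variable {ω : ℝ → ℝ}

lemma isHol_kernelSeries (hω : IsRadialWeight ω) : IsHol (kernelSeries ω) :=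
  (diskSummable_inv_moment hω).isHol

/-- The integral means of the derivatives of the kernel. -/
lemma IsDoubling.circleMass_kernel_le (hω : IsDoubling ω) {N : ℕ} (hN : 1 ≤ N) :
    ∃ C : ℝ, 0 < C ∧ ∀ ρ : ℝ, 0 ≤ ρ → ρ < 1 →
      circleMass (fun w => ‖iteratedDeriv N (kernelSeries ω) w‖ₑ) ρ ≤
        ENNReal.ofReal (C / (tail ω ρ * (1 - ρ) ^ N)) := by
  obtain ⟨D, hD1, k, hD⟩ := hω.tail_le
  have hD0 : 0 < D := by linarith
  obtain ⟨C, hC, hmain⟩ := ((hω.symbolBound_kernel N).const_mul (1 / 2)).circleMass_le (k + (N - 1))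
  have hhol := (isHol_kernelSeries hω.weight).isHol_iteratedDeriv N
  have hco : coeff (iteratedDeriv N (kernelSeries ω)) = fun n : ℕ => ((1 / 2 *
      (((n + N).factorial : ℝ) / n.factorial * (moment ω (n + N))⁻¹) : ℝ) : ℂ) := by
    funext n
    rw [coeff_iteratedDeriv, kernelSeries, (diskSummable_inv_moment hω.weight).coeff_powerSum]
    push_cast
    rw [mul_inv]
    ring
  have hsum := hhol.diskSummable_coeff
  rw [hco] at hsum
  refine ⟨C * (D * 3 ^ k), by positivity, fun ρ h0 h1 => ?_⟩
  have hδ : 0 < 1 - ρ := by linarith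
  have hT := hω.tail_pos h0 h1
  rw [circleMass_congr h0 h1 (Ψ := fun w => ‖powerSum (fun n : ℕ => ((1 / 2 *
      (((n + N).factorial : ℝ) / n.factorial * (moment ω (n + N))⁻¹) : ℝ) : ℂ)) w‖ₑ)
      fun w hw => by simp only [← hhol.eqOn_powerSum hw, hco]]
  refine (hmain hsum ρ (D * 3 ^ k / (tail ω ρ * (1 - ρ) ^ N)) h0 h1 (by positivity)
    fun n => ?_).trans (le_of_eq (by congr 1; ring))
  -- Here N ≥ 1 matters: after division by n + 1 the remaining power N - 1 is non-negative, hence at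
  -- most ((1 + n(1 - ρ))/(1 - ρ))^(N-1). The tail comparison supplies the other k powers of 1 + n(1
  -- - ρ).
  obtain ⟨M, rfl⟩ : ∃ M, N = M + 1 := ⟨N - 1, by omega⟩
  have hv := hω.tailSeq_pos n
  have hn : (0 : ℝ) < n + 1 := by positivity
  have e1 : (tailSeq ω n)⁻¹ ≤ D * 3 ^ k * (1 + n * (1 - ρ)) ^ k / tail ω ρ := by
    have h2 := hD ρ _ h0 h1 (nodes_mem n).1 (nodes_mem n).2
    rw [sub_sub_cancel, div_div_eq_mul_div, div_one] at h2
    rw [inv_le_iff_one_le_mul₀ hv, div_mul_eq_mul_div, le_div_iff₀ hT, one_mul]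
    refine h2.trans ?_
    rw [tailSeq] at hv ⊢
    rw [mul_assoc D ((3 : ℝ) ^ k), ← mul_pow]
    gcongr
    have : (0 : ℝ) ≤ n * (1 - ρ) := by positivity
    nlinarith
  have e2 : ((n : ℝ) + 1) ^ M ≤ (1 + n * (1 - ρ)) ^ M / (1 - ρ) ^ M := by
    rw [le_div_iff₀ (by positivity), ← mul_pow]
    gcongr
    nlinarith
  calc ((n : ℝ) + 1) ^ (M + 1) * (tailSeq ω n)⁻¹ / (n + 1)
      = ((n : ℝ) + 1) ^ M * (tailSeq ω n)⁻¹ := by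
        rw [pow_succ]
        field_simp
    _ ≤ (1 + n * (1 - ρ)) ^ M / (1 - ρ) ^ M *
        (D * 3 ^ k * (1 + n * (1 - ρ)) ^ k / tail ω ρ) := by gcongr
    _ = _ := by
        rw [add_tsub_cancel_right, pow_add, pow_succ]
        field_simp
        ring

/-- The coefficients of the kernel that represents the fractional derivative of a function in terms
of its `N`-th derivative. -/
noncomputable def fracKernelCoeff (ω : ℝ → ℝ) (x : ℝ) (N n : ℕ) : ℝ :=
  moment ω (n + N) / moment (powWeight ω x) (n + N) * (n + (N + 1))

lemma diskSummable_fracKernelCoeff (hω : IsDoubling ω) {x : ℝ} (hx : 0 ≤ x) (N : ℕ) :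
    DiskSummable fun n => (fracKernelCoeff ω x N n : ℂ) := by
  obtain ⟨C, hC, hs⟩ := hω.symbolBound_momentRatio hx N
  obtain ⟨m, hm⟩ := exists_nat_ge (x + 1)
  intro r h0 h1
  obtain ⟨D, hD, hs'⟩ := hasSum_one_add_mul_pow_le m
  have hδ : 0 < 1 - r := by linarith
  refine Summable.of_nonneg_of_le (fun n => by positivity) (fun n => ?_)
    ((hs' r h0 h1).1.mul_left (C * ((1 - r) ^ m)⁻¹))
  have hn : (1 : ℝ) ≤ n + 1 := by simp
  have e1 : ((n : ℝ) + 1) ^ (x + 1) ≤ ((1 - r) ^ m)⁻¹ * (1 + n * (1 - r)) ^ m := by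
    calc ((n : ℝ) + 1) ^ (x + 1) ≤ ((n : ℝ) + 1) ^ (m : ℝ) :=
          Real.rpow_le_rpow_of_exponent_le hn hm
      _ = ((n : ℝ) + 1) ^ m := Real.rpow_natCast _ _
      _ ≤ _ := by
          rw [inv_mul_eq_div, le_div_iff₀ (by positivity), ← mul_pow]
          gcongr
          nlinarith
  rw [Complex.norm_real, Real.norm_eq_abs]
  calc |fracKernelCoeff ω x N n| * r ^ n ≤ C * ((n : ℝ) + 1) ^ (x + 1) * r ^ n := by
        gcongr
        exact (hs n).1
    _ ≤ C * (((1 - r) ^ m)⁻¹ * (1 + n * (1 - r)) ^ m) * r ^ n := by gcongr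
    _ = _ := by ring

/-- The tails of ω cancel in the moment ratio, so the coefficients behave like those of (1 -
w)^(-x-2); an integral mean gains one power of 1 - ρ over the maximum. -/
lemma IsDoubling.circleMass_fracKernel_le (hω : IsDoubling ω) {x : ℝ} (hx : 0 ≤ x) (N : ℕ) :
    ∃ C : ℝ, 0 < C ∧ ∀ ρ : ℝ, 0 ≤ ρ → ρ < 1 →
      circleMass (fun w => ‖powerSum (fun n => (fracKernelCoeff ω x N n : ℂ)) w‖ₑ) ρ ≤
        ENNReal.ofReal (C * (1 - ρ) ^ (-(x + 1))) := by
  obtain ⟨k, hk⟩ := exists_nat_ge x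
  obtain ⟨C, hC, hmain⟩ := (hω.symbolBound_momentRatio hx N).circleMass_le k
  refine ⟨C, hC, fun ρ h0 h1 => hmain (diskSummable_fracKernelCoeff hω hx N) ρ _ h0 h1 ?_ ?_⟩
  · have : 0 ≤ 1 - ρ := by linarith
    positivity
  intro n
  have hδ : 0 < 1 - ρ := by linarith
  have hn : (0 : ℝ) < n + 1 := by positivity
  have h2 : (0 : ℝ) ≤ n * (1 - ρ) := by positivity
  rw [Real.rpow_add_one hn.ne', mul_div_assoc, div_self hn.ne', mul_one]
  have e1 : (1 - ρ) ^ (-(x + 1)) * (1 - ρ) = ((1 - ρ) ^ x)⁻¹ := by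
    rw [← Real.rpow_add_one hδ.ne', ← Real.rpow_neg hδ.le]
    congr 1
    ring
  rw [e1, inv_mul_eq_div, le_div_iff₀ (by positivity), ← Real.mul_rpow hn.le hδ.le]
  calc (((n : ℝ) + 1) * (1 - ρ)) ^ x ≤ (1 + n * (1 - ρ)) ^ x := by
        gcongr
        nlinarith
    _ ≤ (1 + n * (1 - ρ)) ^ (k : ℝ) := Real.rpow_le_rpow_of_exponent_le (by linarith) hk
    _ = _ := Real.rpow_natCast _ _

end KernelMeans

/-! ### The Schur test -/

section Schur

variable {α β : Type*} [MeasurableSpace α] [MeasurableSpace β]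

/-- Hölder's inequality for the pair f, 1 in the measure k dν; the case p = 1, which has no finite
conjugate exponent, is an equality. -/
lemma lintegral_mul_rpow_le {ν : Measure β} {k f : β → ℝ≥0∞} (hk : Measurable k)
    (hf : AEMeasurable f ν) {p : ℝ} (hp : 1 ≤ p) :
    (∫⁻ ξ, k ξ * f ξ ∂ν) ^ p ≤ (∫⁻ ξ, k ξ ∂ν) ^ (p - 1) * ∫⁻ ξ, k ξ * f ξ ^ p ∂ν := by
  rcases hp.eq_or_lt with rfl | hp
  · simp
  have hp0 : 0 < p := by linarith
  have hpq := Real.HolderConjugate.conjExponent hp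
  set q := p.conjExponent with hq
  have hfκ : AEMeasurable f (ν.withDensity k) := hf.mono_ac (withDensity_absolutelyContinuous _ _)
  have h := ENNReal.lintegral_mul_le_Lp_mul_Lq (ν.withDensity k) hpq hfκ
    (g := fun _ => (1 : ℝ≥0∞)) aemeasurable_const
  have e1 : ∫⁻ ξ, (f * fun _ => 1 : β → ℝ≥0∞) ξ ∂(ν.withDensity k) = ∫⁻ ξ, k ξ * f ξ ∂ν := by
    rw [lintegral_withDensity_eq_lintegral_mul₀ hk.aemeasurable (hf.mul aemeasurable_const)]
    simp
  have e2 : ∫⁻ ξ, f ξ ^ p ∂(ν.withDensity k) = ∫⁻ ξ, k ξ * f ξ ^ p ∂ν := by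
    rw [lintegral_withDensity_eq_lintegral_mul₀ hk.aemeasurable (hf.pow_const p)]
    simp
  have e3 : ∫⁻ _, (1 : ℝ≥0∞) ^ q ∂(ν.withDensity k) = ∫⁻ ξ, k ξ ∂ν := by
    simp [withDensity_apply]
  rw [e1, e2, e3] at h
  calc (∫⁻ ξ, k ξ * f ξ ∂ν) ^ p
      ≤ ((∫⁻ ξ, k ξ * f ξ ^ p ∂ν) ^ (1 / p) * (∫⁻ ξ, k ξ ∂ν) ^ (1 / q)) ^ p := by gcongr
    _ = (∫⁻ ξ, k ξ ∂ν) ^ (p - 1) * ∫⁻ ξ, k ξ * f ξ ^ p ∂ν := by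
        have hpq' : 1 / q * p = p - 1 := by
          rw [hq, Real.conjExponent]
          have : p - 1 ≠ 0 := by linarith
          field_simp
        rw [ENNReal.mul_rpow_of_nonneg _ _ hp0.le, ← ENNReal.rpow_mul, ← ENNReal.rpow_mul,
          one_div_mul_cancel hp0.ne', ENNReal.rpow_one, hpq', mul_comm]

/-- The Schur test with constant weights. -/
lemma lintegral_schur_le {μ : Measure α} {ν : Measure β} [SFinite μ] [SFinite ν]
    {k : α → β → ℝ≥0∞} (hk : Measurable (Function.uncurry k)) {f : β → ℝ≥0∞}
    (hf : AEMeasurable f ν) {p : ℝ} (hp : 1 ≤ p) {A B : ℝ≥0∞}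
    (hA : ∀ᵐ z ∂μ, ∫⁻ ξ, k z ξ ∂ν ≤ A) (hB : ∀ᵐ ξ ∂ν, ∫⁻ z, k z ξ ∂μ ≤ B) :
    ∫⁻ z, (∫⁻ ξ, k z ξ * f ξ ∂ν) ^ p ∂μ ≤ A ^ (p - 1) * B * ∫⁻ ξ, f ξ ^ p ∂ν := by
  have hkz : ∀ z, Measurable (k z) := fun z => hk.comp measurable_prodMk_left
  have hkξ : ∀ ξ, Measurable fun z => k z ξ := fun ξ => hk.comp measurable_prodMk_right
  have hprod : AEMeasurable (fun q : α × β => k q.1 q.2 * f q.2 ^ p) (μ.prod ν) :=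
    hk.aemeasurable.mul (hf.pow_const p).comp_snd
  calc ∫⁻ z, (∫⁻ ξ, k z ξ * f ξ ∂ν) ^ p ∂μ
      ≤ ∫⁻ z, A ^ (p - 1) * ∫⁻ ξ, k z ξ * f ξ ^ p ∂ν ∂μ := by
        refine lintegral_mono_ae ?_
        filter_upwards [hA] with z hz
        refine (lintegral_mul_rpow_le (hkz z) hf hp).trans ?_
        gcongr
    _ = A ^ (p - 1) * ∫⁻ ξ, ∫⁻ z, k z ξ * f ξ ^ p ∂μ ∂ν := by
        rw [lintegral_const_mul'' _ hprod.lintegral_prod_right', lintegral_lintegral_swap hprod]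
    _ ≤ A ^ (p - 1) * ∫⁻ ξ, B * f ξ ^ p ∂ν := by
        refine mul_le_mul_right (lintegral_mono_ae ?_) _
        filter_upwards [hB] with ξ hξ
        rw [lintegral_mul_const _ (hkξ ξ)]
        gcongr
    _ = _ := by rw [lintegral_const_mul'' _ (hf.pow_const p), mul_assoc]

lemma lintegral_mul_le_of_le {ν : Measure β} {k f : β → ℝ≥0∞} (hk : Measurable k) {D : ℝ≥0∞}
    (hf : ∀ᵐ ξ ∂ν, f ξ ≤ D) : ∫⁻ ξ, k ξ * f ξ ∂ν ≤ (∫⁻ ξ, k ξ ∂ν) * D := by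
  rw [← lintegral_mul_const _ hk]
  refine lintegral_mono_ae ?_
  filter_upwards [hf] with ξ hξ
  gcongr

end Schur

/-! ### One-dimensional integrals -/

section OneDim

lemma lintegral_comp_one_sub (g : ℝ → ℝ≥0∞) (s : Set ℝ) :
    ∫⁻ r in (fun r => 1 - r) ⁻¹' s, g (1 - r) = ∫⁻ x in s, g x :=
  (Measure.measurePreserving_sub_left volume (1 : ℝ)).setLIntegral_comp_preimage_emb
    (Homeomorph.subLeft (1 : ℝ)).measurableEmbedding g s

/-- Since 1 - sr is at least 1 - r and at least 1 - s, splitting at 1 - r = 1 - s leaves two pure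
powers. Convergence at the boundary needs a > -1, decay away from it a + 1 < M. -/
lemma lintegral_one_sub_rpow_mul_le {a M : ℝ} (ha : -1 < a) (hM : a + 1 < M) :
    ∃ C : ℝ, 0 < C ∧ ∀ s : ℝ, 0 ≤ s → s < 1 →
      ∫⁻ r in Ioo (0 : ℝ) 1, ENNReal.ofReal ((1 - r) ^ a * (1 - s * r) ^ (-M)) ≤
        ENNReal.ofReal (C * (1 - s) ^ (a + 1 - M)) := by
  have ha1 : 0 < a + 1 := by linarith
  have hM1 : 0 < M - a - 1 := by linarith
  refine ⟨1 / (M - a - 1) + 1 / (a + 1), by positivity, fun s h0 h1 => ?_⟩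
  set d := 1 - s with hd
  have hd0 : 0 < d := by linarith
  have hd1 : d ≤ 1 := by linarith
  have hbound : ∀ r ∈ Ioo (0 : ℝ) 1, ENNReal.ofReal ((1 - r) ^ a * (1 - s * r) ^ (-M)) ≤
      (Ioi d).indicator (fun x => ENNReal.ofReal (x ^ (a - M))) (1 - r) +
        (Ioc 0 d).indicator (fun x => ENNReal.ofReal (x ^ a * d ^ (-M))) (1 - r) := by
    intro r hr
    have hr0 : 0 < 1 - r := by linarith [hr.2]
    by_cases h : d < 1 - r
    · rw [indicator_of_mem (show (1 - r) ∈ Ioi d from h)]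
      refine le_add_right (ENNReal.ofReal_le_ofReal ?_)
      rw [sub_eq_add_neg a M, Real.rpow_add hr0]
      refine mul_le_mul_of_nonneg_left (Real.rpow_le_rpow_of_nonpos hr0 ?_ (by linarith))
        (by positivity)
      nlinarith [hr.1]
    · rw [indicator_of_mem (show (1 - r) ∈ Ioc 0 d from ⟨hr0, not_lt.1 h⟩)]
      refine le_add_left (ENNReal.ofReal_le_ofReal ?_)
      refine mul_le_mul_of_nonneg_left (Real.rpow_le_rpow_of_nonpos hd0 ?_ (by linarith))
        (by positivity)
      rw [hd]
      nlinarith [hr.1, hr.2]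
  have m1 : Measurable ((Ioi d).indicator fun x : ℝ => ENNReal.ofReal (x ^ (a - M))) :=
    Measurable.indicator (by fun_prop) measurableSet_Ioi
  have e1 : ∫⁻ x, (Ioi d).indicator (fun x => ENNReal.ofReal (x ^ (a - M))) x =
      ENNReal.ofReal (d ^ (a + 1 - M) / (M - a - 1)) := by
    rw [lintegral_indicator measurableSet_Ioi, ← ofReal_integral_eq_lintegral_ofReal
      (integrableOn_Ioi_rpow_of_lt (by linarith) hd0), integral_Ioi_rpow_of_lt (by linarith) hd0]
    · congr 1
      rw [show a - M + 1 = a + 1 - M by ring, show M - a - 1 = -(a + 1 - M) by ring, div_neg,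
        neg_div]
    · filter_upwards [ae_restrict_mem measurableSet_Ioi] with x hx
      exact Real.rpow_nonneg (hd0.trans hx).le _
  have e2 : ∫⁻ x, (Ioc 0 d).indicator (fun x => ENNReal.ofReal (x ^ a * d ^ (-M))) x =
      ENNReal.ofReal (d ^ (a + 1 - M) / (a + 1)) := by
    have hi : IntervalIntegrable (fun x : ℝ => x ^ a) volume 0 d :=
      intervalIntegral.intervalIntegrable_rpow' ha
    have hi' := (intervalIntegrable_iff_integrableOn_Ioc_of_le hd0.le).1 hi
    rw [lintegral_indicator measurableSet_Ioc, ← ofReal_integral_eq_lintegral_ofReal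
      (hi'.mul_const _), integral_mul_const, ← intervalIntegral.integral_of_le hd0.le,
      integral_rpow (Or.inl ha), Real.zero_rpow ha1.ne', sub_zero]
    · congr 1
      rw [sub_eq_add_neg (a + 1) M, Real.rpow_add hd0 (a + 1)]
      ring
    · filter_upwards [ae_restrict_mem measurableSet_Ioc] with x hx
      have := hx.1.le
      exact mul_nonneg (Real.rpow_nonneg this _) (Real.rpow_nonneg hd0.le _)
  calc ∫⁻ r in Ioo (0 : ℝ) 1, ENNReal.ofReal ((1 - r) ^ a * (1 - s * r) ^ (-M))
      ≤ ∫⁻ r in Ioo (0 : ℝ) 1,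
        ((Ioi d).indicator (fun x => ENNReal.ofReal (x ^ (a - M))) (1 - r) +
        (Ioc 0 d).indicator (fun x => ENNReal.ofReal (x ^ a * d ^ (-M))) (1 - r)) :=
        setLIntegral_mono' measurableSet_Ioo hbound
    _ ≤ ∫⁻ r, ((Ioi d).indicator (fun x => ENNReal.ofReal (x ^ (a - M))) (1 - r) +
        (Ioc 0 d).indicator (fun x => ENNReal.ofReal (x ^ a * d ^ (-M))) (1 - r)) :=
        setLIntegral_le_lintegral _ _
    _ = ENNReal.ofReal (d ^ (a + 1 - M) / (M - a - 1)) +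
        ENNReal.ofReal (d ^ (a + 1 - M) / (a + 1)) := by
        rw [lintegral_add_left (f := fun r => (Ioi d).indicator (fun x => ENNReal.ofReal (x ^ (a - M)))
          (1 - r)) (m1.comp (by fun_prop)), ← e1, ← e2]
        have h3 := lintegral_comp_one_sub
          ((Ioi d).indicator (fun x => ENNReal.ofReal (x ^ (a - M)))) univ
        have h4 := lintegral_comp_one_sub
          ((Ioc 0 d).indicator (fun x => ENNReal.ofReal (x ^ a * d ^ (-M)))) univ
        simp only [preimage_univ, setLIntegral_univ] at h3 h4
        rw [h3, h4]
    _ = _ := by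
        rw [← ENNReal.ofReal_add (by positivity) (by positivity)]
        congr 1
        ring

variable {ω : ℝ → ℝ}

lemma measurable_wHat (ω : ℝ → ℝ) : Measurable (wHat ω) :=
  Antitone.measurable fun _ _ h => wHat_anti ω h

/-- Integrals against `ω / ω̂` are controlled by integrals against `1 / (1 - t)`. -/
lemma IsDoubling.lintegral_div_wHat_le (hω : IsDoubling ω) : ∃ C : ℝ≥0,
    ∀ (φ : ℝ → ℝ≥0∞), Measurable φ → ∀ D : ℝ≥0∞,
    (∀ r t : ℝ, 0 < r → r ≤ t → t ≤ (1 + r) / 2 → t < 1 → φ r ≤ D * φ t) →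
    ∫⁻ r in Ioo (0 : ℝ) 1, ENNReal.ofReal (ω r) * (wHat ω r)⁻¹ * φ r ≤
      C * D * ∫⁻ t in Ioo (0 : ℝ) 1, φ t * ENNReal.ofReal (1 - t)⁻¹ := by
  obtain ⟨C, hC⟩ := hω.upper
  refine ⟨2 * C, fun φ hφ D hD => ?_⟩
  have hwm := measurable_wHat ω
  have haem := aemeasurable_profile hω.weight.integrable
  let μ := (volume : Measure ℝ).restrict (Ioo 0 1)
  -- The mass at r is spread uniformly over (r, (1+r)/2), an interval of length (1 - r)/2 on which φ
  -- and ω̂⁻¹ can be moved from r to t. After Tonelli, t receives mass from r in (2t - 1, t), at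
  -- most ω̂(2t - 1) ≤ C ω̂(t), and this cancels ω̂(t)⁻¹.
  let S : ℝ → ℝ → ℝ≥0∞ := fun r t => if r < t ∧ t < (1 + r) / 2 then 1 else 0
  have hS : Measurable (Function.uncurry S) := by
    refine Measurable.ite ?_ measurable_const measurable_const
    exact (measurableSet_lt measurable_fst measurable_snd).inter
      (measurableSet_lt measurable_snd (by fun_prop))
  have hSl : ∀ r, Measurable (S r) := fun r => hS.comp measurable_prodMk_left
  have hlen : ∀ r ∈ Ioo (0 : ℝ) 1, ∫⁻ t, S r t ∂μ = ENNReal.ofReal ((1 - r) / 2) := by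
    intro r hr
    have e : S r = (Ioo r ((1 + r) / 2)).indicator 1 := by
      funext t
      simp [S, indicator, mem_Ioo]
    rw [e, lintegral_indicator_one measurableSet_Ioo, Measure.restrict_apply measurableSet_Ioo,
      inter_eq_left.2, Real.volume_Ioo]
    · congr 1
      ring
    · exact fun t ht => ⟨hr.1.trans ht.1, by linarith [ht.2, hr.2]⟩
  let g : ℝ → ℝ≥0∞ := fun t => D * φ t * (2 * ENNReal.ofReal (1 - t)⁻¹) * (wHat ω t)⁻¹
  have hg : Measurable g := by
    refine Measurable.mul (Measurable.mul (hφ.const_mul D) (Measurable.const_mul ?_ _)) hwm.inv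
    fun_prop
  have h1 : ∫⁻ r, ENNReal.ofReal (ω r) * (wHat ω r)⁻¹ * φ r ∂μ ≤
      ∫⁻ r, ∫⁻ t, g t * (ENNReal.ofReal (ω r) * S r t) ∂μ ∂μ := by
    refine setLIntegral_mono' measurableSet_Ioo fun r hr => ?_
    have hr1 : 0 < 1 - r := by linarith [hr.2]
    have e1 : ENNReal.ofReal (ω r) * (wHat ω r)⁻¹ * φ r =
        ∫⁻ t, ENNReal.ofReal (ω r) * (wHat ω r)⁻¹ * φ r * ENNReal.ofReal (2 / (1 - r)) * S r t ∂μ := by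
      rw [lintegral_const_mul _ (hSl r), hlen r hr, mul_assoc _ (ENNReal.ofReal _)
        (ENNReal.ofReal _), ← ENNReal.ofReal_mul (by positivity)]
      have : 2 / (1 - r) * ((1 - r) / 2) = 1 := by field_simp
      rw [this, ENNReal.ofReal_one, mul_one]
    rw [e1]
    refine setLIntegral_mono' measurableSet_Ioo fun t ht => ?_
    by_cases h : r < t ∧ t < (1 + r) / 2
    · have ht1 : 0 < 1 - t := by linarith [ht.2]
      have e2 := hD r t hr.1 h.1.le h.2.le ht.2
      have e3 : (wHat ω r)⁻¹ ≤ (wHat ω t)⁻¹ := ENNReal.inv_le_inv.2 (wHat_anti ω h.1.le)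
      have e4 : ENNReal.ofReal (2 / (1 - r)) ≤ 2 * ENNReal.ofReal (1 - t)⁻¹ := by
        rw [show (2 : ℝ≥0∞) = ENNReal.ofReal 2 by simp, ← ENNReal.ofReal_mul (by norm_num)]
        refine ENNReal.ofReal_le_ofReal ?_
        rw [div_eq_mul_inv]
        have := h.1
        gcongr
      calc ENNReal.ofReal (ω r) * (wHat ω r)⁻¹ * φ r * ENNReal.ofReal (2 / (1 - r)) * S r t
          ≤ ENNReal.ofReal (ω r) * (wHat ω t)⁻¹ * (D * φ t) * (2 * ENNReal.ofReal (1 - t)⁻¹) *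
            S r t := by gcongr
        _ = _ := by ring
    · simp [S, h]
  have h2 : ∫⁻ r, ∫⁻ t, g t * (ENNReal.ofReal (ω r) * S r t) ∂μ ∂μ =
      ∫⁻ t, ∫⁻ r, g t * (ENNReal.ofReal (ω r) * S r t) ∂μ ∂μ := by
    refine lintegral_lintegral_swap ?_
    refine AEMeasurable.mul (hg.comp measurable_snd).aemeasurable (AEMeasurable.mul ?_ ?_)
    · exact haem.ennreal_ofReal.comp_fst
    · exact hS.aemeasurable
  refine (h1.trans_eq h2).trans ?_
  rw [← lintegral_const_mul]
  swap
  · exact hφ.mul (by fun_prop)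
  refine setLIntegral_mono' measurableSet_Ioo fun t ht => ?_
  have hin : ∫⁻ r, ENNReal.ofReal (ω r) * S r t ∂μ ≤ C * wHat ω t := by
    -- For t < 1/2 the point 2t - 1 is negative and is replaced by 0; the midpoint between the
    -- truncated point and 1 is still at least t.
    have hm : 0 ≤ max 0 (2 * t - 1) := le_max_left _ _
    have hm1 : max 0 (2 * t - 1) < 1 := max_lt one_pos (by linarith [ht.2])
    calc ∫⁻ r, ENNReal.ofReal (ω r) * S r t ∂μ
        ≤ ∫⁻ r, (Ioo (max 0 (2 * t - 1)) 1).indicator (fun r => ENNReal.ofReal (ω r)) r ∂μ := by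
          refine setLIntegral_mono' measurableSet_Ioo fun r hr => ?_
          by_cases h : r < t ∧ t < (1 + r) / 2
          · rw [indicator_of_mem]
            · simp [S, h]
            · exact ⟨max_lt hr.1 (by linarith [h.2]), hr.2⟩
          · simp [S, h]
      _ ≤ ∫⁻ r, (Ioo (max 0 (2 * t - 1)) 1).indicator (fun r => ENNReal.ofReal (ω r)) r :=
          setLIntegral_le_lintegral _ _
      _ = wHat ω (max 0 (2 * t - 1)) := lintegral_indicator measurableSet_Ioo _
      _ ≤ C * wHat ω ((1 + max 0 (2 * t - 1)) / 2) := hC _ ⟨hm, hm1⟩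
      _ ≤ C * wHat ω t := by
          gcongr
          refine wHat_anti ω ?_
          have := le_max_right 0 (2 * t - 1)
          linarith
  have hmeas : AEMeasurable (fun r => ENNReal.ofReal (ω r) * S r t) μ :=
    haem.ennreal_ofReal.mul (hS.comp measurable_prodMk_right).aemeasurable
  rw [lintegral_const_mul'' _ hmeas]
  calc g t * ∫⁻ r, ENNReal.ofReal (ω r) * S r t ∂μ ≤ g t * (C * wHat ω t) := by gcongr
    _ = D * φ t * (2 * ENNReal.ofReal (1 - t)⁻¹) * C * ((wHat ω t)⁻¹ * wHat ω t) := by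
        simp only [g]
        ring
    _ = (2 * C : ℝ≥0) * D * (φ t * ENNReal.ofReal (1 - t)⁻¹) := by
        rw [ENNReal.inv_mul_cancel (hω.weight.wHat_ne_zero t ⟨ht.1.le, ht.2⟩)
          (hω.wHat_ne_top ht.1.le)]
        push_cast
        ring

end OneDim

/-! ### Boundedness of the projection -/

section Bounded

variable {ω : ℝ → ℝ}

lemma measurable_indicator_enorm {f : ℂ → ℂ} (hf : ContinuousOn f disk) :
    Measurable (disk.indicator fun w => ‖f w‖ₑ) := by
  classical
  rw [← piecewise_eq_indicator]
  exact ContinuousOn.measurable_piecewise hf.enorm continuousOn_const measurableSet_ball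

lemma circleMass_indicator (Φ : ℂ → ℝ≥0∞) {ρ : ℝ} (h0 : 0 ≤ ρ) (h1 : ρ < 1) :
    circleMass (disk.indicator Φ) ρ = circleMass Φ ρ :=
  circleMass_congr h0 h1 fun _ hw => indicator_of_mem hw Φ

lemma mul_mem_Ico {ρ r : ℝ} (h0 : 0 ≤ ρ) (h1 : ρ < 1) (hr : r ∈ Ioo (0 : ℝ) 1) :
    0 ≤ ρ * r ∧ ρ * r < 1 := by
  constructor
  · exact mul_nonneg h0 hr.1.le
  · nlinarith [hr.1, hr.2]

lemma ofReal_one_sub_rpow_le {a M ρ r t : ℝ} (ha : 0 ≤ a) (hM : 0 ≤ M) (h0 : 0 ≤ ρ) (h1 : ρ < 1)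
    (hr : 0 < r) (hrt : r ≤ t) (ht : t ≤ (1 + r) / 2) (ht1 : t < 1) :
    ENNReal.ofReal ((1 - r) ^ a * (1 - ρ * r) ^ (-M)) ≤
      ENNReal.ofReal (2 ^ a) * ENNReal.ofReal ((1 - t) ^ a * (1 - ρ * t) ^ (-M)) := by
  have h2 := (mul_mem_Ico h0 h1 ⟨hr.trans_le hrt, ht1⟩).2
  have h3 := (mul_mem_Ico h0 h1 ⟨hr, hrt.trans_lt ht1⟩).2
  rw [← ENNReal.ofReal_mul (by positivity), ← mul_assoc,
    ← Real.mul_rpow (by norm_num) (by linarith)]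
  refine ENNReal.ofReal_le_ofReal (mul_le_mul ?_ ?_ ?_ ?_)
  · exact Real.rpow_le_rpow (by linarith) (by linarith) ha
  · exact Real.rpow_le_rpow_of_nonpos (by linarith) (by nlinarith) (by linarith)
  · exact Real.rpow_nonneg (by linarith) _
  · exact Real.rpow_nonneg (by linarith) _

/-- After ω / ω̂ is replaced by 1/(1 - r), the exponent becomes a - 1; hence the condition a > 0. -/
lemma IsDoubling.lintegral_div_wHat_rpow_le (hω : IsDoubling ω) {a M : ℝ} (ha : 0 < a)
    (hM : a < M) : ∃ C : ℝ≥0, ∀ ρ : ℝ, 0 ≤ ρ → ρ < 1 →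
      ∫⁻ r in Ioo (0 : ℝ) 1, ENNReal.ofReal (ω r) * (wHat ω r)⁻¹ *
        ENNReal.ofReal ((1 - r) ^ a * (1 - ρ * r) ^ (-M)) ≤
        C * ENNReal.ofReal ((1 - ρ) ^ (a - M)) := by
  obtain ⟨C, hC⟩ := hω.lintegral_div_wHat_le
  obtain ⟨D, hD, hJ⟩ := lintegral_one_sub_rpow_mul_le (a := a - 1) (M := M) (by linarith)
    (by linarith)
  refine ⟨C * (2 ^ a : ℝ).toNNReal * D.toNNReal, fun ρ h0 h1 => ?_⟩
  have h := hC (fun r => ENNReal.ofReal ((1 - r) ^ a * (1 - ρ * r) ^ (-M))) (by fun_prop)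
    (ENNReal.ofReal (2 ^ a)) fun r t hr hrt ht ht1 =>
      ofReal_one_sub_rpow_le ha.le (ha.trans hM).le h0 h1 hr hrt ht ht1
  refine h.trans ?_
  have e : ∫⁻ t in Ioo (0 : ℝ) 1, ENNReal.ofReal ((1 - t) ^ a * (1 - ρ * t) ^ (-M)) *
      ENNReal.ofReal (1 - t)⁻¹ =
      ∫⁻ t in Ioo (0 : ℝ) 1, ENNReal.ofReal ((1 - t) ^ (a - 1) * (1 - ρ * t) ^ (-M)) := by
    refine setLIntegral_congr_fun measurableSet_Ioo fun t ht => ?_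
    have ht1 : 0 < 1 - t := by linarith [ht.2]
    have h2 := (mul_mem_Ico h0 h1 ht).2
    have h3 : 0 ≤ (1 - ρ * t) ^ (-M) := Real.rpow_nonneg (by linarith) _
    rw [← ENNReal.ofReal_mul (by positivity), Real.rpow_sub_one ht1.ne']
    congr 1
    ring
  rw [e]
  have hJ' := hJ ρ h0 h1
  rw [sub_add_cancel, ENNReal.ofReal_mul hD.le] at hJ'
  calc _ ≤ (C : ℝ≥0∞) * ENNReal.ofReal (2 ^ a) *
        (ENNReal.ofReal D * ENNReal.ofReal ((1 - ρ) ^ (a - M))) := by gcongr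
    _ = _ := by
        push_cast
        rw [ENNReal.ofReal, ENNReal.ofReal]
        ring

/-- The absolute value of a derivative of the kernel series, extended by zero. -/
noncomputable def kernelNorm (ω : ℝ → ℝ) (N : ℕ) : ℂ → ℝ≥0∞ :=
  disk.indicator fun w => ‖iteratedDeriv N (kernelSeries ω) w‖ₑ

lemma measurable_kernelNorm (hω : IsRadialWeight ω) (N : ℕ) : Measurable (kernelNorm ω N) :=
  measurable_indicator_enorm ((isHol_kernelSeries hω).isHol_iteratedDeriv N).continuousOn

lemma IsDoubling.circleMass_kernelNorm_le (hω : IsDoubling ω) {N : ℕ} (hN : 1 ≤ N) :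
    ∃ C : ℝ≥0, ∀ ρ : ℝ, 0 ≤ ρ → ρ < 1 → circleMass (kernelNorm ω N) ρ ≤
      C * ((wHat ω ρ)⁻¹ * ENNReal.ofReal ((1 - ρ) ^ (-(N : ℝ)))) := by
  obtain ⟨C, hC, h⟩ := hω.circleMass_kernel_le hN
  refine ⟨C.toNNReal, fun ρ h0 h1 => ?_⟩
  have hT := hω.tail_pos h0 h1
  have hd : 0 < 1 - ρ := by linarith
  rw [kernelNorm, circleMass_indicator _ h0 h1]
  refine (h ρ h0 h1).trans (le_of_eq ?_)
  rw [← hω.ofReal_tail h0, ← ENNReal.ofReal_inv_of_pos hT, ← ENNReal.ofReal_mul (by positivity),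
    ← ENNReal.ofReal, ← ENNReal.ofReal_mul hC.le, Real.rpow_neg hd.le, Real.rpow_natCast]
  congr 1
  field_simp

lemma lintegral_weight_mul_conj (hω : IsRadialWeight ω) {Φ : ℂ → ℝ≥0∞} (hΦ : Measurable Φ) (z : ℂ) :
    ∫⁻ ξ, Φ (z * conj ξ) ∂(weightMeasure ω) = (ENNReal.ofReal Real.pi)⁻¹ *
      ∫⁻ r in Ioo 0 1, ENNReal.ofReal r * ENNReal.ofReal (ω r) * circleMass Φ (‖z‖ * r) := by
  have hm : Measurable fun ξ => Φ (z * conj ξ) :=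
    hΦ.comp (Complex.continuous_conj.measurable.const_mul z)
  rw [weightMeasure, lintegral_withDensity_eq_lintegral_mul₀
    (aemeasurable_density hω.integrable) hm.aemeasurable,
    ← lintegral_radial_mul_conj (aemeasurable_profile hω.integrable).ennreal_ofReal hΦ z]
  rfl

lemma inv_ofReal_pi_le_one : (ENNReal.ofReal Real.pi)⁻¹ ≤ 1 := by
  rw [ENNReal.inv_le_one, ENNReal.one_le_ofReal]
  linarith [Real.pi_gt_three]

/-- Row bound for the kernel. -/
lemma IsDoubling.lintegral_kernelNorm_weight_le (hω : IsDoubling ω) {N : ℕ} (hN : 1 ≤ N) :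
    ∃ C : ℝ≥0, ∀ z : ℂ, ‖z‖ < 1 → ∫⁻ ξ, kernelNorm ω N (z * conj ξ) ∂(weightMeasure ω) ≤
      C * ENNReal.ofReal ((1 - ‖z‖) ^ (-(N : ℝ))) := by
  obtain ⟨C, hC⟩ := hω.circleMass_kernelNorm_le hN
  have hN' : (1 : ℝ) ≤ N := by exact_mod_cast hN
  -- For r ≤ ρ the factor ((1 - r)/(1 - ρ))^(1/2) ≥ 1 is inserted to create a positive exponent of 1
  -- - r; any exponent strictly between 0 and N would do.
  obtain ⟨D, hD⟩ := hω.lintegral_div_wHat_rpow_le (a := 1 / 2) (M := N) (by norm_num) (by linarith)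
  refine ⟨C * (D + 1), fun z hz => ?_⟩
  set ρ := ‖z‖ with hρ
  have h0 : 0 ≤ ρ := norm_nonneg z
  have hd : 0 < 1 - ρ := by linarith
  rw [lintegral_weight_mul_conj hω.weight (measurable_kernelNorm hω.weight N), ← hρ]
  have hsub : Ioo (0 : ℝ) 1 ⊆ (Ioo 0 1 ∩ Iic ρ) ∪ Ioo ρ 1 := fun r hr => by
    rcases le_or_gt r ρ with h | h
    · exact Or.inl ⟨hr, h⟩
    · exact Or.inr ⟨h, hr.2⟩
  set X := ENNReal.ofReal ((1 - ρ) ^ (-(N : ℝ))) with hX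
  have hfirst : ∫⁻ r in Ioo 0 1 ∩ Iic ρ, ENNReal.ofReal r * ENNReal.ofReal (ω r) *
      circleMass (kernelNorm ω N) (ρ * r) ≤ C * D * X := by
    set K := (C : ℝ≥0∞) * ENNReal.ofReal ((1 - ρ) ^ (-(1 / 2) : ℝ)) with hK
    have hKt : K ≠ ∞ := ENNReal.mul_ne_top (by simp) (by simp)
    calc ∫⁻ r in Ioo 0 1 ∩ Iic ρ, ENNReal.ofReal r * ENNReal.ofReal (ω r) *
          circleMass (kernelNorm ω N) (ρ * r)
        ≤ ∫⁻ r in Ioo 0 1 ∩ Iic ρ, K * (ENNReal.ofReal (ω r) * (wHat ω r)⁻¹ *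
            ENNReal.ofReal ((1 - r) ^ (1 / 2 : ℝ) * (1 - ρ * r) ^ (-(N : ℝ)))) := by
          refine setLIntegral_mono' (measurableSet_Ioo.inter measurableSet_Iic) fun r hr => ?_
          obtain ⟨hr, hrρ⟩ := hr
          have hrρ : r ≤ ρ := hrρ
          obtain ⟨g0, g1⟩ := mul_mem_Ico h0 hz hr
          have hr1 : 0 < 1 - r := by linarith [hr.2]
          have e1 : ENNReal.ofReal r ≤ 1 := by simpa using hr.2.le
          have e2 : (wHat ω (ρ * r))⁻¹ ≤ (wHat ω r)⁻¹ :=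
            ENNReal.inv_le_inv.2 (wHat_anti ω (by nlinarith [hr.1]))
          have e3 : ENNReal.ofReal ((1 - ρ * r) ^ (-(N : ℝ))) ≤
              ENNReal.ofReal ((1 - ρ) ^ (-(1 / 2) : ℝ)) *
                ENNReal.ofReal ((1 - r) ^ (1 / 2 : ℝ) * (1 - ρ * r) ^ (-(N : ℝ))) := by
            rw [← ENNReal.ofReal_mul (by positivity), ← mul_assoc]
            refine ENNReal.ofReal_le_ofReal (le_mul_of_one_le_left
              (Real.rpow_nonneg (by linarith) _) ?_)
            rw [Real.rpow_neg hd.le, inv_mul_eq_div, one_le_div (by positivity)]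
            exact Real.rpow_le_rpow hd.le (by linarith) (by norm_num)
          calc ENNReal.ofReal r * ENNReal.ofReal (ω r) * circleMass (kernelNorm ω N) (ρ * r)
              ≤ 1 * ENNReal.ofReal (ω r) * (C * ((wHat ω r)⁻¹ *
                (ENNReal.ofReal ((1 - ρ) ^ (-(1 / 2) : ℝ)) *
                ENNReal.ofReal ((1 - r) ^ (1 / 2 : ℝ) * (1 - ρ * r) ^ (-(N : ℝ)))))) := by
                gcongr
                refine (hC _ g0 g1).trans ?_
                gcongr
            _ = _ := by rw [hK]; ring
      _ ≤ ∫⁻ r in Ioo 0 1, K * (ENNReal.ofReal (ω r) * (wHat ω r)⁻¹ *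
            ENNReal.ofReal ((1 - r) ^ (1 / 2 : ℝ) * (1 - ρ * r) ^ (-(N : ℝ)))) :=
          lintegral_mono_set inter_subset_left
      _ ≤ K * (D * ENNReal.ofReal ((1 - ρ) ^ ((1 / 2 : ℝ) - N))) := by
          rw [lintegral_const_mul' _ _ hKt]
          gcongr
          exact hD ρ h0 hz
      _ = _ := by
          have : X = ENNReal.ofReal ((1 - ρ) ^ (-(1 / 2) : ℝ)) *
              ENNReal.ofReal ((1 - ρ) ^ ((1 / 2 : ℝ) - N)) := by
            rw [← ENNReal.ofReal_mul (by positivity), ← Real.rpow_add hd, hX]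
            congr 2
            ring
          rw [hK, this]
          ring
  -- For r > ρ the bound on the mean is frozen at ρ, and ω integrates to ω̂(ρ), which cancels
  -- ω̂(ρ)⁻¹.
  have hsecond : ∫⁻ r in Ioo ρ 1, ENNReal.ofReal r * ENNReal.ofReal (ω r) *
      circleMass (kernelNorm ω N) (ρ * r) ≤ C * X := by
    have hK : (C : ℝ≥0∞) * ((wHat ω ρ)⁻¹ * X) ≠ ∞ := ENNReal.mul_ne_top (by simp)
      (ENNReal.mul_ne_top (by simpa using hω.weight.wHat_ne_zero ρ ⟨h0, hz⟩) (by simp [hX]))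
    calc ∫⁻ r in Ioo ρ 1, ENNReal.ofReal r * ENNReal.ofReal (ω r) *
          circleMass (kernelNorm ω N) (ρ * r)
        ≤ ∫⁻ r in Ioo ρ 1, C * ((wHat ω ρ)⁻¹ * X) * ENNReal.ofReal (ω r) := by
          refine setLIntegral_mono' measurableSet_Ioo fun r hr => ?_
          have hr' : r ∈ Ioo (0 : ℝ) 1 := ⟨h0.trans_lt hr.1, hr.2⟩
          obtain ⟨g0, g1⟩ := mul_mem_Ico h0 hz hr'
          have e1 : ENNReal.ofReal r ≤ 1 := by simpa using hr.2.le
          have hle : ρ * r ≤ ρ := by nlinarith [hr'.2]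
          have e2 : (wHat ω (ρ * r))⁻¹ ≤ (wHat ω ρ)⁻¹ := ENNReal.inv_le_inv.2 (wHat_anti ω hle)
          have e3 : ENNReal.ofReal ((1 - ρ * r) ^ (-(N : ℝ))) ≤ X :=
            ENNReal.ofReal_le_ofReal
              (Real.rpow_le_rpow_of_nonpos hd (by linarith) (by linarith))
          calc ENNReal.ofReal r * ENNReal.ofReal (ω r) * circleMass (kernelNorm ω N) (ρ * r)
              ≤ 1 * ENNReal.ofReal (ω r) * (C * ((wHat ω ρ)⁻¹ * X)) := by
                gcongr
                refine (hC _ g0 g1).trans ?_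
                gcongr
            _ = _ := by ring
      _ = C * ((wHat ω ρ)⁻¹ * X) * wHat ω ρ := lintegral_const_mul' _ _ hK
      _ = C * X * ((wHat ω ρ)⁻¹ * wHat ω ρ) := by ring
      _ = C * X := by
          rw [ENNReal.inv_mul_cancel (hω.weight.wHat_ne_zero ρ ⟨h0, hz⟩) (hω.wHat_ne_top h0),
            mul_one]
  calc (ENNReal.ofReal Real.pi)⁻¹ * ∫⁻ r in Ioo 0 1, ENNReal.ofReal r * ENNReal.ofReal (ω r) *
        circleMass (kernelNorm ω N) (ρ * r)
      ≤ 1 * (C * D * X + C * X) := by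
        gcongr
        · exact inv_ofReal_pi_le_one
        · exact (lintegral_mono_set hsub).trans ((lintegral_union_le _ _ _).trans
            (add_le_add hfirst hsecond))
    _ = _ := by
        push_cast
        ring

lemma measurable_mobius_density :
    Measurable fun r : ℝ => ENNReal.ofReal (1 / (1 - r ^ 2) ^ 2) := by
  fun_prop

lemma lintegral_mobius (g : ℂ → ℝ≥0∞) : ∫⁻ z, g z ∂mobiusMeasure =
    ∫⁻ z, ENNReal.ofReal (1 / (1 - ‖z‖ ^ 2) ^ 2) * g z ∂areaMeasure := by
  have hm : AEMeasurable (fun z : ℂ => ENNReal.ofReal (1 / (1 - ‖z‖ ^ 2) ^ 2)) areaMeasure :=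
    (measurable_mobius_density.comp measurable_norm).aemeasurable
  rw [mobiusMeasure, lintegral_withDensity_eq_lintegral_mul_non_measurable₀ _ hm
    (Eventually.of_forall fun _ => ENNReal.ofReal_lt_top)]
  rfl

lemma ofReal_mobius_le {r : ℝ} (h0 : 0 ≤ r) (h1 : r < 1) :
    1 / (1 - r ^ 2) ^ 2 ≤ (1 - r) ^ (-2 : ℝ) := by
  have hd : 0 < 1 - r := by linarith
  rw [Real.rpow_neg hd.le, ← one_div, show (2 : ℝ) = ((2 : ℕ) : ℝ) by norm_num, Real.rpow_natCast]
  gcongr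
  nlinarith

/-- Column bound for the kernel. -/
lemma IsDoubling.lintegral_kernelNorm_mobius_le (hω : IsDoubling ω) {N : ℕ} (hN : 2 ≤ N) :
    ∃ C : ℝ≥0, ∀ ξ : ℂ, ‖ξ‖ < 1 →
      ∫⁻ z, ENNReal.ofReal (1 - ‖z‖) ^ N * kernelNorm ω N (z * conj ξ) ∂mobiusMeasure ≤
      C * ((wHat ω ‖ξ‖)⁻¹ * ENNReal.ofReal (1 - ‖ξ‖)⁻¹) := by
  obtain ⟨C, hC⟩ := hω.circleMass_kernelNorm_le (N := N) (by omega)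
  have hN' : (2 : ℝ) ≤ N := by exact_mod_cast hN
  -- The Möbius density costs (1 - r)^(-2), so N ≥ 2 is what keeps the exponent above -1.
  obtain ⟨D, hD, hJ⟩ := lintegral_one_sub_rpow_mul_le (a := (N : ℝ) - 2) (M := N) (by linarith)
    (by linarith)
  refine ⟨C * D.toNNReal, fun ξ hξ => ?_⟩
  set s := ‖ξ‖ with hs
  have h0 : 0 ≤ s := norm_nonneg ξ
  have hd : 0 < 1 - s := by linarith
  have hφ : Measurable fun r : ℝ => ENNReal.ofReal (1 / (1 - r ^ 2) ^ 2) *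
      ENNReal.ofReal (1 - r) ^ N := measurable_mobius_density.mul (by fun_prop)
  have e := lintegral_radial_mul_conj_left hφ.aemeasurable (measurable_kernelNorm hω.weight N) ξ
  rw [lintegral_mobius]
  simp only [mul_assoc] at e ⊢
  rw [e, ← hs]
  have hK : (C : ℝ≥0∞) * (wHat ω s)⁻¹ ≠ ∞ := ENNReal.mul_ne_top (by simp)
    (by simpa using hω.weight.wHat_ne_zero s ⟨h0, hξ⟩)
  calc (ENNReal.ofReal Real.pi)⁻¹ * ∫⁻ r in Ioo 0 1, ENNReal.ofReal r *
        (ENNReal.ofReal (1 / (1 - r ^ 2) ^ 2) * (ENNReal.ofReal (1 - r) ^ N *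
          circleMass (kernelNorm ω N) (s * r)))
      ≤ 1 * ∫⁻ r in Ioo (0 : ℝ) 1, (C * (wHat ω s)⁻¹) *
          ENNReal.ofReal ((1 - r) ^ ((N : ℝ) - 2) * (1 - s * r) ^ (-(N : ℝ))) := by
        gcongr ?_ * ?_
        · exact inv_ofReal_pi_le_one
        refine setLIntegral_mono' measurableSet_Ioo fun r hr => ?_
        obtain ⟨g0, g1⟩ := mul_mem_Ico h0 hξ hr
        have hr1 : 0 < 1 - r := by linarith [hr.2]
        have e1 : ENNReal.ofReal r ≤ 1 := by simpa using hr.2.le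
        have e2 : (wHat ω (s * r))⁻¹ ≤ (wHat ω s)⁻¹ :=
          ENNReal.inv_le_inv.2 (wHat_anti ω (by nlinarith [hr.2]))
        have e3 : ENNReal.ofReal (1 / (1 - r ^ 2) ^ 2) * ENNReal.ofReal (1 - r) ^ N ≤
            ENNReal.ofReal ((1 - r) ^ ((N : ℝ) - 2)) := by
          rw [← ENNReal.ofReal_pow hr1.le, ← ENNReal.ofReal_mul (by positivity)]
          refine ENNReal.ofReal_le_ofReal ?_
          rw [sub_eq_add_neg (N : ℝ) 2, Real.rpow_add hr1, Real.rpow_natCast, mul_comm]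
          gcongr
          exact ofReal_mobius_le hr.1.le hr.2
        calc ENNReal.ofReal r * (ENNReal.ofReal (1 / (1 - r ^ 2) ^ 2) *
              (ENNReal.ofReal (1 - r) ^ N * circleMass (kernelNorm ω N) (s * r)))
            = ENNReal.ofReal r * ((ENNReal.ofReal (1 / (1 - r ^ 2) ^ 2) *
              ENNReal.ofReal (1 - r) ^ N) * circleMass (kernelNorm ω N) (s * r)) := by ring
          _ ≤ 1 * (ENNReal.ofReal ((1 - r) ^ ((N : ℝ) - 2)) *
              (C * ((wHat ω s)⁻¹ * ENNReal.ofReal ((1 - s * r) ^ (-(N : ℝ)))))) := by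
              gcongr
              refine (hC _ g0 g1).trans ?_
              gcongr
          _ = _ := by
              rw [ENNReal.ofReal_mul (by positivity)]
              ring
    _ ≤ C * (wHat ω s)⁻¹ * ENNReal.ofReal (D * (1 - s)⁻¹) := by
        rw [one_mul, lintegral_const_mul' _ _ hK]
        gcongr
        refine (hJ s h0 hξ).trans (le_of_eq ?_)
        rw [show (N : ℝ) - 2 + 1 - N = -1 by ring, Real.rpow_neg_one]
    _ = _ := by
        rw [ENNReal.ofReal_mul hD.le, ENNReal.ofReal]
        push_cast
        ring

/-- The ratio of the measures `ω dA` and `dλ_ω`. -/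
noncomputable def lambdaRatio (ω : ℝ → ℝ) (ξ : ℂ) : ℝ≥0∞ :=
  wHat ω ‖ξ‖ * ENNReal.ofReal (1 - ‖ξ‖)

lemma measurable_lambdaRatio (ω : ℝ → ℝ) : Measurable (lambdaRatio ω) := by
  refine ((measurable_wHat ω).comp measurable_norm).mul ?_
  fun_prop

lemma IsDoubling.lambdaRatio_lt_top (hω : IsDoubling ω) (ξ : ℂ) : lambdaRatio ω ξ < ∞ :=
  ENNReal.mul_lt_top (hω.wHat_ne_top (norm_nonneg ξ)).lt_top (by simp)

lemma aemeasurable_lambda_density (hω : IsRadialWeight ω) :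
    AEMeasurable (fun z : ℂ => ENNReal.ofReal (ω ‖z‖) / lambdaRatio ω z) areaMeasure :=
  (aemeasurable_density hω.integrable).div (measurable_lambdaRatio ω).aemeasurable

lemma IsDoubling.lambdaRatio_ne_zero (hω : IsDoubling ω) {ξ : ℂ} (hξ : ‖ξ‖ < 1) :
    lambdaRatio ω ξ ≠ 0 := by
  refine mul_ne_zero (hω.weight.wHat_ne_zero _ ⟨norm_nonneg _, hξ⟩) ?_
  simpa using hξ

lemma IsDoubling.weightMeasure_eq (hω : IsDoubling ω) :
    weightMeasure ω = (lambdaMeasure ω).withDensity (lambdaRatio ω) := by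
  have : lambdaMeasure ω =
      areaMeasure.withDensity fun z : ℂ => ENNReal.ofReal (ω ‖z‖) / lambdaRatio ω z := rfl
  rw [this, ← withDensity_mul₀ (aemeasurable_lambda_density hω.weight)
    (measurable_lambdaRatio ω).aemeasurable, weightMeasure]
  refine withDensity_congr_ae ?_
  filter_upwards [ae_area_mem_disk] with z hz
  rw [Pi.mul_apply, ENNReal.div_mul_cancel (hω.lambdaRatio_ne_zero hz) (hω.lambdaRatio_lt_top z).ne]

lemma IsDoubling.lintegral_weight_eq (hω : IsDoubling ω) (g : ℂ → ℝ≥0∞) :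
    ∫⁻ ξ, g ξ ∂(weightMeasure ω) = ∫⁻ ξ, lambdaRatio ω ξ * g ξ ∂(lambdaMeasure ω) := by
  rw [hω.weightMeasure_eq, lintegral_withDensity_eq_lintegral_mul_non_measurable₀ _
    (measurable_lambdaRatio ω).aemeasurable
    (Eventually.of_forall fun ξ => hω.lambdaRatio_lt_top ξ)]
  rfl

lemma ae_lambda_mem_disk : ∀ᵐ z ∂(lambdaMeasure ω), ‖z‖ < 1 :=
  (withDensity_absolutelyContinuous _ _).ae_le ae_area_mem_disk

instance sFinite_mobiusMeasure : SFinite mobiusMeasure := by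
  rw [mobiusMeasure]
  infer_instance

instance sFinite_lambdaMeasure : SFinite (lambdaMeasure ω) := by
  rw [lambdaMeasure]
  infer_instance

lemma ae_mobius_mem_disk : ∀ᵐ z ∂mobiusMeasure, ‖z‖ < 1 :=
  (withDensity_absolutelyContinuous _ _).ae_le ae_area_mem_disk

/-- `L^p(λ_ω)` embeds into `L^1(ω dA)`. -/
lemma IsDoubling.eLpNorm_one_le (hω : IsDoubling ω) {p : ℝ≥0∞} (hp : 1 ≤ p) :
    ∃ C : ℝ≥0, ∀ f : ℂ → ℂ, MemLp f p (lambdaMeasure ω) →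
      Integrable f (weightMeasure ω) ∧
      ∫⁻ ξ, ‖f ξ‖ₑ ∂(weightMeasure ω) ≤ C * eLpNorm f p (lambdaMeasure ω) := by
  have hc0 : wHat ω 0 ≠ 0 := hω.weight.wHat_ne_zero 0 ⟨le_rfl, one_pos⟩
  have hct := hω.wHat_ne_top le_rfl
  -- The ratio ω̂(ξ)(1 - |ξ|) of the two measures never exceeds ω̂(0); finiteness of ω dA then
  -- lowers the exponent from p to 1.
  have hle : weightMeasure ω ≤ wHat ω 0 • lambdaMeasure ω := by
    rw [hω.weightMeasure_eq, ← withDensity_const]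
    refine withDensity_mono (Eventually.of_forall fun ξ => ?_)
    calc lambdaRatio ω ξ ≤ wHat ω 0 * 1 := by
          refine mul_le_mul' (wHat_anti ω (norm_nonneg ξ)) ?_
          simp
      _ = wHat ω 0 := mul_one _
  have hfin := isFiniteMeasure_weightMeasure hω.weight.integrable
  set K := wHat ω 0 ^ (1 / p).toReal * weightMeasure ω univ ^ (1 / (1 : ℝ≥0∞).toReal - 1 / p.toReal)
    with hK
  have hp1 : 0 ≤ 1 / (1 : ℝ≥0∞).toReal - 1 / p.toReal := by
    rcases eq_or_ne p ∞ with rfl | hpt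
    · simp
    · have : 1 ≤ p.toReal := by
        rw [← ENNReal.toReal_one]
        exact ENNReal.toReal_mono hpt hp
      rw [ENNReal.toReal_one, div_one, sub_nonneg, div_le_one (by linarith)]
      exact this
  have hKt : K ≠ ∞ := ENNReal.mul_ne_top (ENNReal.rpow_ne_top_of_nonneg (by positivity) hct)
    (ENNReal.rpow_ne_top_of_nonneg hp1 (measure_ne_top _ _))
  refine ⟨K.toNNReal, fun f hf => ?_⟩
  have hfm : AEStronglyMeasurable f (weightMeasure ω) :=
    hf.1.mono_ac (hω.weightMeasure_eq ▸ withDensity_absolutelyContinuous _ _)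
  have h : eLpNorm f 1 (weightMeasure ω) ≤ K * eLpNorm f p (lambdaMeasure ω) := by
    refine (eLpNorm_le_eLpNorm_mul_rpow_measure_univ hp hfm).trans ?_
    have h2 := (eLpNorm_mono_measure (p := p) f hle).trans_eq
      (eLpNorm_smul_measure_of_ne_zero hc0 f p _)
    rw [smul_eq_mul] at h2
    calc _ ≤ (wHat ω 0 ^ (1 / p).toReal * eLpNorm f p (lambdaMeasure ω)) *
          weightMeasure ω univ ^ (1 / (1 : ℝ≥0∞).toReal - 1 / p.toReal) := by gcongr
      _ = _ := by rw [hK]; ring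
  rw [ENNReal.coe_toNNReal hKt, ← eLpNorm_one_eq_lintegral_enorm]
  refine ⟨memLp_one_iff_integrable.1 ⟨hfm, h.trans_lt ?_⟩, h⟩
  exact ENNReal.mul_lt_top hKt.lt_top hf.2

/-- Pointwise bound for the derivatives of the Bergman projection. -/
lemma enorm_iteratedDeriv_bergmanProj_le (hω : IsRadialWeight ω) {f : ℂ → ℂ}
    (hf : Integrable f (weightMeasure ω)) (N : ℕ) {z : ℂ} (hz : ‖z‖ < 1) :
    ‖iteratedDeriv N (bergmanProj ω f) z‖ₑ ≤
      ∫⁻ ξ, kernelNorm ω N (z * conj ξ) * ‖f ξ‖ₑ ∂(weightMeasure ω) := by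
  have hP := (isHol_bergmanProj hω hf).isHol_iteratedDeriv N
  have hK := (isHol_kernelSeries hω).isHol_iteratedDeriv N
  have h1 := hasSum_integral_mul_powerSum hK.diskSummable_coeff (integrable_mul_conj_pow hf N) hz
  -- Comparison of coefficients replaces differentiation under the integral: N derivatives shift the
  -- index by N, and the surplus conj(ξ)^N is attached to f.
  have h2 : iteratedDeriv N (bergmanProj ω f) z = ∫ ξ, f ξ * conj ξ ^ N *
      powerSum (coeff (iteratedDeriv N (kernelSeries ω))) (z * conj ξ) ∂(weightMeasure ω) := by
    refine (hP.hasSum hz).unique ?_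
    refine h1.congr_fun ?_ |> fun h => h
    intro n
    rw [coeff_iteratedDeriv, coeff_iteratedDeriv, coeff_bergmanProj hω hf, projCoeff, kernelSeries,
      (diskSummable_inv_moment hω).coeff_powerSum]
    have : ∀ ξ : ℂ, f ξ * conj ξ ^ N * conj ξ ^ n = f ξ * conj ξ ^ (n + N) := fun ξ => by ring
    simp only [this]
    ring
  rw [h2]
  refine (enorm_integral_le_lintegral_enorm _).trans (lintegral_mono_ae ?_)
  filter_upwards [ae_weight_mem_disk] with ξ hξ
  have hm : z * conj ξ ∈ disk := by
    rw [mem_disk, norm_mul, RCLike.norm_conj]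
    nlinarith [norm_nonneg z, norm_nonneg ξ]
  rw [hK.eqOn_powerSum hm, kernelNorm, indicator_of_mem hm, enorm_mul, enorm_mul, mul_comm]
  refine mul_le_mul_right (mul_le_of_le_one_right' ?_) _
  rw [enorm_pow]
  refine pow_le_one₀ (by positivity) ?_
  rw [← ofReal_norm, RCLike.norm_conj]
  exact ENNReal.ofReal_le_one.2 hξ.le

/-- Uniform bound for the derivatives of the Bergman projection at the origin. -/
lemma enorm_iteratedDeriv_zero_bergmanProj_le (hω : IsRadialWeight ω) {f : ℂ → ℂ}
    (hf : Integrable f (weightMeasure ω)) (j : ℕ) :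
    ‖iteratedDeriv j (bergmanProj ω f) 0‖ₑ ≤
      ‖(j.factorial * ((2 * moment ω j : ℝ) : ℂ)⁻¹ : ℂ)‖ₑ * ∫⁻ ξ, ‖f ξ‖ₑ ∂(weightMeasure ω) := by
  rw [iteratedDeriv_zero_eq_coeff, coeff_bergmanProj hω hf, projCoeff, mul_comm (∫ ξ, _ ∂_),
    ← mul_assoc, enorm_mul]
  gcongr
  refine (enorm_integral_le_lintegral_enorm _).trans (lintegral_mono_ae ?_)
  filter_upwards [ae_weight_mem_disk] with ξ hξ
  rw [enorm_mul, enorm_pow]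
  refine mul_le_of_le_one_right' (pow_le_one₀ (by positivity) ?_)
  rw [← ofReal_norm, RCLike.norm_conj]
  exact ENNReal.ofReal_le_one.2 hξ.le

lemma ofReal_pow_mul_rpow_neg {d : ℝ} (hd : 0 < d) (N : ℕ) :
    ENNReal.ofReal d ^ N * ENNReal.ofReal (d ^ (-(N : ℝ))) = 1 := by
  rw [← ENNReal.ofReal_pow hd.le, ← ENNReal.ofReal_mul (by positivity), Real.rpow_neg hd.le,
    Real.rpow_natCast, mul_inv_cancel₀ (by positivity), ENNReal.ofReal_one]

/-- The kernel of the operator `f ↦ (1 - |z|)^N (P f)^(N)` with respect to `λ_ω`. -/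
noncomputable def schurKernel (ω : ℝ → ℝ) (N : ℕ) (z ξ : ℂ) : ℝ≥0∞ :=
  ENNReal.ofReal (1 - ‖z‖) ^ N * kernelNorm ω N (z * conj ξ) * lambdaRatio ω ξ

lemma measurable_schurKernel (hω : IsRadialWeight ω) (N : ℕ) :
    Measurable (Function.uncurry (schurKernel ω N)) := by
  have h1 : Measurable fun q : ℂ × ℂ => kernelNorm ω N (q.1 * conj q.2) :=
    (measurable_kernelNorm hω N).comp
      (measurable_fst.mul (Complex.continuous_conj.measurable.comp measurable_snd))
  have h2 : Measurable fun q : ℂ × ℂ => lambdaRatio ω q.2 :=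
    (measurable_lambdaRatio ω).comp measurable_snd
  have h3 : Measurable fun q : ℂ × ℂ => ENNReal.ofReal (1 - ‖q.1‖) ^ N := by fun_prop
  exact (h3.mul h1).mul h2

lemma IsDoubling.schurKernel_row (hω : IsDoubling ω) {N : ℕ} (hN : 1 ≤ N) : ∃ A : ℝ≥0,
    ∀ z : ℂ, ‖z‖ < 1 → ∫⁻ ξ, schurKernel ω N z ξ ∂(lambdaMeasure ω) ≤ A := by
  obtain ⟨C, hC⟩ := hω.lintegral_kernelNorm_weight_le hN
  refine ⟨C, fun z hz => ?_⟩
  have e : ∫⁻ ξ, schurKernel ω N z ξ ∂(lambdaMeasure ω) = ENNReal.ofReal (1 - ‖z‖) ^ N *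
      ∫⁻ ξ, kernelNorm ω N (z * conj ξ) ∂(weightMeasure ω) := by
    rw [hω.lintegral_weight_eq, ← lintegral_const_mul' _ _ (by simp)]
    refine lintegral_congr fun ξ => ?_
    rw [schurKernel]
    ring
  rw [e]
  calc ENNReal.ofReal (1 - ‖z‖) ^ N * ∫⁻ ξ, kernelNorm ω N (z * conj ξ) ∂(weightMeasure ω)
      ≤ ENNReal.ofReal (1 - ‖z‖) ^ N * (C * ENNReal.ofReal ((1 - ‖z‖) ^ (-(N : ℝ)))) := by
        gcongr
        exact hC z hz
    _ = C * (ENNReal.ofReal (1 - ‖z‖) ^ N * ENNReal.ofReal ((1 - ‖z‖) ^ (-(N : ℝ)))) := by ring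
    _ = C := by rw [ofReal_pow_mul_rpow_neg (by linarith), mul_one]

lemma IsDoubling.schurKernel_col (hω : IsDoubling ω) {N : ℕ} (hN : 2 ≤ N) : ∃ B : ℝ≥0,
    ∀ ξ : ℂ, ‖ξ‖ < 1 → ∫⁻ z, schurKernel ω N z ξ ∂mobiusMeasure ≤ B := by
  obtain ⟨C, hC⟩ := hω.lintegral_kernelNorm_mobius_le hN
  refine ⟨C, fun ξ hξ => ?_⟩
  have hd : 0 < 1 - ‖ξ‖ := by linarith
  have e : ∫⁻ z, schurKernel ω N z ξ ∂mobiusMeasure = (∫⁻ z, ENNReal.ofReal (1 - ‖z‖) ^ N *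
      kernelNorm ω N (z * conj ξ) ∂mobiusMeasure) * lambdaRatio ω ξ :=
    lintegral_mul_const' _ _ (hω.lambdaRatio_lt_top ξ).ne
  rw [e]
  calc _ ≤ C * ((wHat ω ‖ξ‖)⁻¹ * ENNReal.ofReal (1 - ‖ξ‖)⁻¹) * lambdaRatio ω ξ := by
        gcongr
        exact hC ξ hξ
    _ = C * ((wHat ω ‖ξ‖)⁻¹ * wHat ω ‖ξ‖) *
        (ENNReal.ofReal (1 - ‖ξ‖)⁻¹ * ENNReal.ofReal (1 - ‖ξ‖)) := by
        rw [lambdaRatio]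
        ring
    _ = C := by
        rw [ENNReal.inv_mul_cancel (hω.weight.wHat_ne_zero _ ⟨norm_nonneg _, hξ⟩)
          (hω.wHat_ne_top (norm_nonneg _)), ← ENNReal.ofReal_mul (by positivity),
          inv_mul_cancel₀ hd.ne', ENNReal.ofReal_one, mul_one, mul_one]

lemma IsDoubling.weighted_deriv_bergmanProj_le (hω : IsDoubling ω) {f : ℂ → ℂ}
    (hf : Integrable f (weightMeasure ω)) (N : ℕ) {z : ℂ} (hz : ‖z‖ < 1) :
    ‖iteratedDeriv N (bergmanProj ω f) z‖ₑ * ENNReal.ofReal (1 - ‖z‖) ^ N ≤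
      ∫⁻ ξ, schurKernel ω N z ξ * ‖f ξ‖ₑ ∂(lambdaMeasure ω) := by
  calc _ ≤ (∫⁻ ξ, kernelNorm ω N (z * conj ξ) * ‖f ξ‖ₑ ∂(weightMeasure ω)) *
        ENNReal.ofReal (1 - ‖z‖) ^ N := by
        gcongr
        exact enorm_iteratedDeriv_bergmanProj_le hω.weight hf N hz
    _ = _ := by
        rw [hω.lintegral_weight_eq, ← lintegral_mul_const' _ _ (by simp)]
        refine lintegral_congr fun ξ => ?_
        rw [schurKernel]
        ring

/-- The Bergman projection is bounded from `L^p(λ_ω)` to the Besov space. -/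
theorem IsDoubling.bergmanProj_bounded (hω : IsDoubling ω) {p : ℝ≥0∞} (hp : 1 ≤ p) {N : ℕ}
    (hN : 2 ≤ N) : ∃ C : ℝ≥0, ∀ f : ℂ → ℂ, MemLp f p (lambdaMeasure ω) →
      MemBesov N p (bergmanProj ω f) ∧
      besovNorm N p (bergmanProj ω f) ≤ C * eLpNorm f p (lambdaMeasure ω) := by
  suffices h : ∃ C : ℝ≥0, ∀ f : ℂ → ℂ, MemLp f p (lambdaMeasure ω) →
      besovNorm N p (bergmanProj ω f) ≤ C * eLpNorm f p (lambdaMeasure ω) by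
    obtain ⟨C, hC⟩ := h
    obtain ⟨D, hD⟩ := hω.eLpNorm_one_le hp
    exact ⟨C, fun f hf => ⟨⟨isHol_bergmanProj hω.weight (hD f hf).1,
      (hC f hf).trans_lt (ENNReal.mul_lt_top (by simp) hf.2)⟩, hC f hf⟩⟩
  obtain ⟨D, hD⟩ := hω.eLpNorm_one_le hp
  have hzero : ∀ j, ∃ c : ℝ≥0, ∀ f : ℂ → ℂ, MemLp f p (lambdaMeasure ω) →
      ‖iteratedDeriv j (bergmanProj ω f) 0‖ₑ ≤ c * eLpNorm f p (lambdaMeasure ω) := by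
    intro j
    refine ⟨‖(j.factorial * ((2 * moment ω j : ℝ) : ℂ)⁻¹ : ℂ)‖₊ * D, fun f hf => ?_⟩
    refine (enorm_iteratedDeriv_zero_bergmanProj_le hω.weight (hD f hf).1 j).trans ?_
    rw [ENNReal.coe_mul, mul_assoc]
    exact mul_le_mul_right (hD f hf).2 _
  choose c hc using hzero
  rcases eq_or_ne p ∞ with rfl | hpt
  -- The Bloch norm involves the first derivative, so the row bound is used with exponent 1 and no
  -- column bound is needed.
  · obtain ⟨A, hA⟩ := hω.schurKernel_row le_rfl
    refine ⟨2 * A + c 0, fun f hf => ?_⟩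
    rw [besovNorm, if_pos rfl, blochNorm, ENNReal.coe_add, add_mul]
    have h0 := hc 0 f hf
    rw [iteratedDeriv_zero] at h0
    refine add_le_add (iSup₂_le fun z hz => ?_) h0
    rw [mem_disk] at hz
    have h1 := hω.weighted_deriv_bergmanProj_le (hD f hf).1 1 hz
    have h2 := lintegral_mul_le_of_le (ν := lambdaMeasure ω) (k := schurKernel ω 1 z)
      (f := fun ξ => ‖f ξ‖ₑ) (measurable_schurKernel hω.weight 1).of_uncurry_left
      (D := eLpNorm f ∞ (lambdaMeasure ω)) (by
        rw [eLpNorm_exponent_top]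
        exact enorm_ae_le_eLpNormEssSup f _)
    rw [iteratedDeriv_one, pow_one] at h1
    calc ENNReal.ofReal ((1 - ‖z‖ ^ 2) * ‖deriv (bergmanProj ω f) z‖)
        ≤ ENNReal.ofReal (2 * (1 - ‖z‖) * ‖deriv (bergmanProj ω f) z‖) := by
          refine ENNReal.ofReal_le_ofReal ?_
          gcongr
          nlinarith [norm_nonneg z]
      _ = 2 * (‖deriv (bergmanProj ω f) z‖ₑ * ENNReal.ofReal (1 - ‖z‖)) := by
          rw [ENNReal.ofReal_mul (by linarith), ENNReal.ofReal_mul (by norm_num), ofReal_norm]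
          simp
          ring
      _ ≤ 2 * (A * eLpNorm f ∞ (lambdaMeasure ω)) := by
          refine mul_le_mul_right (h1.trans (h2.trans ?_)) _
          gcongr
          exact hA z hz
      _ = _ := by
          push_cast
          ring
  · obtain ⟨A, hA⟩ := hω.schurKernel_row (N := N) (by omega)
    obtain ⟨B, hB⟩ := hω.schurKernel_col hN
    have hp0 : p ≠ 0 := (zero_lt_one.trans_le hp).ne'
    set q := p.toReal with hq
    have hq1 : 1 ≤ q := by
      rw [← ENNReal.toReal_one]
      exact ENNReal.toReal_mono hpt hp
    have hq0 : 0 < q := by linarith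
    set K := ((A : ℝ≥0∞) ^ (q - 1) * B) ^ (1 / q) with hK
    have hKt : K ≠ ∞ := ENNReal.rpow_ne_top_of_nonneg (by positivity)
      (ENNReal.mul_ne_top (ENNReal.rpow_ne_top_of_nonneg (by linarith) (by simp)) (by simp))
    refine ⟨K.toNNReal + ∑ j ∈ Finset.range N, c j, fun f hf => ?_⟩
    rw [besovNorm, if_neg hpt, ← hq, ENNReal.coe_add, add_mul, ENNReal.ofNNReal_finsetSum,
      Finset.sum_mul]
    refine add_le_add ?_ (Finset.sum_le_sum fun j _ => hc j f hf)
    rw [ENNReal.coe_toNNReal hKt, eLpNorm_eq_lintegral_rpow_enorm_toReal hp0 hpt, ← hq, hK,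
      ← ENNReal.mul_rpow_of_nonneg _ _ (by positivity)]
    refine ENNReal.rpow_le_rpow ?_ (by positivity)
    have hs := lintegral_schur_le (μ := mobiusMeasure) (ν := lambdaMeasure ω)
      (measurable_schurKernel hω.weight N) hf.1.enorm hq1
      (ae_mobius_mem_disk.mono fun z hz => hA z hz)
      (ae_lambda_mem_disk.mono fun ξ hξ => hB ξ hξ)
    refine le_trans (lintegral_mono_ae ?_) hs
    filter_upwards [ae_mobius_mem_disk] with z hz
    have h1 := hω.weighted_deriv_bergmanProj_le (hD f hf).1 N hz
    rw [ENNReal.rpow_mul, ENNReal.rpow_natCast, ← ENNReal.mul_rpow_of_nonneg _ _ hq0.le]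
    exact ENNReal.rpow_le_rpow h1 hq0.le

end Bounded

/-! ### Functions in the range -/

section Range

variable {ω : ℝ → ℝ}

/-- The standard weight `(1 - r²)^N`. -/
def standardWeight (N : ℕ) (r : ℝ) : ℝ := (1 - r ^ 2) ^ N

lemma standardWeight_nonneg (N : ℕ) : ∀ r ∈ Ico (0 : ℝ) 1, 0 ≤ standardWeight N r := fun r hr =>
  pow_nonneg (by nlinarith [hr.1, hr.2]) N

lemma integrable_standardWeight (N : ℕ) :
    IntegrableOn (fun z : ℂ => standardWeight N ‖z‖) disk := by
  have : Continuous fun z : ℂ => standardWeight N ‖z‖ := by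
    unfold standardWeight
    fun_prop
  exact (this.continuousOn.integrableOn_compact (isCompact_closedBall (0 : ℂ) 1)).mono_set
    Metric.ball_subset_closedBall

lemma two_mul_moment_standardWeight (N n : ℕ) : 2 * moment (standardWeight N) n =
    (n.factorial * N.factorial / (n + N + 1).factorial : ℝ) := by
  induction N generalizing n with
  | zero =>
    simp only [moment, standardWeight, pow_zero, mul_one]
    rw [← integral_Ioc_eq_integral_Ioo, ← intervalIntegral.integral_of_le zero_le_one, integral_pow,
      add_zero, Nat.factorial_succ, Nat.factorial_zero]
    have := Nat.factorial_ne_zero n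
    push_cast
    field_simp
    simp
    ring
  | succ N ih =>
    have hi : ∀ k : ℕ, IntegrableOn (fun r : ℝ => r ^ (2 * k + 1) * standardWeight N r)
        (Ioo 0 1) := fun k => by
      have : Continuous fun r : ℝ => r ^ (2 * k + 1) * standardWeight N r := by
        unfold standardWeight
        fun_prop
      exact (this.continuousOn.integrableOn_compact isCompact_Icc).mono_set Ioo_subset_Icc_self
    -- Splitting off one factor 1 - r² gives the recursion of the Beta integrals.
    have e : moment (standardWeight (N + 1)) n =
        moment (standardWeight N) n - moment (standardWeight N) (n + 1) := by
      rw [moment, moment, moment, ← integral_sub (hi n) (hi (n + 1))]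
      refine integral_congr_ae (Eventually.of_forall fun r => ?_)
      simp only [standardWeight]
      ring
    rw [e, mul_sub, ih, ih, show n + 1 + N + 1 = (n + N + 1) + 1 by ring,
      show n + (N + 1) + 1 = (n + N + 1) + 1 by ring, Nat.factorial_succ (n + N + 1),
      Nat.factorial_succ n, Nat.factorial_succ N]
    have := Nat.factorial_ne_zero (n + N + 1)
    have h2 : ((n : ℝ) + N + 1 + 1) ≠ 0 := by positivity
    push_cast
    field_simp
    ring

/-- Reconstruction of the fractional derivative from the `N`-th derivative. -/
lemma coeffMul_momentRatio_eq (hω : IsDoubling ω) {α : ℝ} (hα : 0 ≤ α) {h : ℂ → ℂ} (hh : IsHol h)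
    (N : ℕ) (hi : Integrable (iteratedDeriv N h) (weightMeasure (standardWeight N))) {z : ℂ}
    (hz : ‖z‖ < 1) : coeffMul (momentRatio ω (powWeight ω α)) h z =
      ∑ n ∈ Finset.range N, momentRatio ω (powWeight ω α) n * coeff h n * z ^ n +
        z ^ N * ((N.factorial : ℂ)⁻¹ * ∫ ξ, iteratedDeriv N h ξ *
          powerSum (fun n => (fracKernelCoeff ω α N n : ℂ)) (z * conj ξ)
            ∂(weightMeasure (standardWeight N))) := by
  have hc := diskSummable_momentRatio hω.weight (isRadialWeight_powWeight hω.weight hα)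
  have h1 := hasSum_coeffMul hc hh hz
  have h2 := hasSum_integral_mul_powerSum (diskSummable_fracKernelCoeff hω hα N) hi hz
  have h3 := (h2.mul_left ((N.factorial : ℂ)⁻¹)).mul_left (z ^ N)
  rw [← h1.tsum_eq, ← h1.summable.sum_add_tsum_nat_add N, ← h3.tsum_eq]
  congr 1
  -- The factor (n+N)!/n! from differentiation, the moment n!N!/(n+N+1)!, the factor n+N+1 built
  -- into the kernel and 1/N! multiply to 1, leaving the moment ratio.
  refine tsum_congr fun n => ?_
  rw [integral_mul_conj_pow (integrable_standardWeight N) (standardWeight_nonneg N)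
    (hh.isHol_iteratedDeriv N) hi, coeff_iteratedDeriv, fracKernelCoeff, momentRatio, pow_add]
  have hm := congrArg Complex.ofReal (two_mul_moment_standardWeight N n)
  push_cast at hm
  rw [hm, Nat.factorial_succ (n + N)]
  have f1 : ((n + N).factorial : ℂ) ≠ 0 := by exact_mod_cast Nat.factorial_ne_zero _
  have f2 : (n.factorial : ℂ) ≠ 0 := by exact_mod_cast Nat.factorial_ne_zero _
  have f3 : (N.factorial : ℂ) ≠ 0 := by exact_mod_cast Nat.factorial_ne_zero _
  have f4 : ((n : ℂ) + N + 1) ≠ 0 := by exact_mod_cast Nat.succ_ne_zero (n + N)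
  have f5 : (moment (powWeight ω α) (n + N) : ℂ) ≠ 0 := by
    exact_mod_cast (moment_pos (isRadialWeight_powWeight hω.weight hα) (n + N)).ne'
  push_cast
  field_simp
  ring

/-- The absolute value of the kernel that represents the fractional derivative in terms of the
`N`-th derivative, extended by zero. -/
noncomputable def fracKernelNorm (ω : ℝ → ℝ) (α : ℝ) (N : ℕ) : ℂ → ℝ≥0∞ :=
  disk.indicator fun w => ‖powerSum (fun n => (fracKernelCoeff ω α N n : ℂ)) w‖ₑ

lemma measurable_fracKernelNorm (hω : IsDoubling ω) {α : ℝ} (hα : 0 ≤ α) (N : ℕ) :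
    Measurable (fracKernelNorm ω α N) :=
  measurable_indicator_enorm (diskSummable_fracKernelCoeff hω hα N).isHol.continuousOn

lemma lintegral_weightMeasure {ν : ℝ → ℝ} (hν : IntegrableOn (fun z : ℂ => ν ‖z‖) disk)
    (g : ℂ → ℝ≥0∞) : ∫⁻ z, g z ∂(weightMeasure ν) =
      ∫⁻ z, ENNReal.ofReal (ν ‖z‖) * g z ∂areaMeasure := by
  rw [weightMeasure, lintegral_withDensity_eq_lintegral_mul_non_measurable₀ _
    (aemeasurable_density hν) (Eventually.of_forall fun _ => ENNReal.ofReal_lt_top)]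
  rfl

/-- The weighted `N`-th derivative that appears in the Besov norm. -/
noncomputable def weightedDeriv (N : ℕ) (h : ℂ → ℂ) (ξ : ℂ) : ℝ≥0∞ :=
  ‖iteratedDeriv N h ξ‖ₑ * ENNReal.ofReal (1 - ‖ξ‖) ^ N

lemma ofReal_standardWeight_le (N : ℕ) {r : ℝ} (h0 : 0 ≤ r) (h1 : r < 1) :
    ENNReal.ofReal (standardWeight N r) ≤ 2 ^ N * ENNReal.ofReal (1 - r) ^ N := by
  have : (2 : ℝ≥0∞) = ENNReal.ofReal 2 := by simp
  rw [standardWeight, this, ← mul_pow, ← ENNReal.ofReal_mul (by norm_num),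
    ← ENNReal.ofReal_pow (by linarith)]
  exact ENNReal.ofReal_le_ofReal (pow_le_pow_left₀ (by nlinarith) (by nlinarith) N)

lemma integrable_iteratedDeriv {h : ℂ → ℂ} (hh : IsHol h) {N : ℕ}
    (hi : ∫⁻ ξ, weightedDeriv N h ξ ∂areaMeasure < ∞) :
    Integrable (iteratedDeriv N h) (weightMeasure (standardWeight N)) := by
  refine ⟨(aestronglyMeasurable_of_isHol (hh.isHol_iteratedDeriv N)).mono_ac
    (withDensity_absolutelyContinuous _ _), ?_⟩
  rw [HasFiniteIntegral, lintegral_weightMeasure (integrable_standardWeight N)]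
  calc _ ≤ ∫⁻ ξ, 2 ^ N * weightedDeriv N h ξ ∂areaMeasure := by
        refine lintegral_mono_ae ?_
        filter_upwards [ae_area_mem_disk] with ξ hξ
        rw [weightedDeriv, mul_comm ‖_‖ₑ, ← mul_assoc]
        exact mul_le_mul_left (ofReal_standardWeight_le N (norm_nonneg ξ) hξ) _
    _ = 2 ^ N * ∫⁻ ξ, weightedDeriv N h ξ ∂areaMeasure := lintegral_const_mul' _ _ (by simp)
    _ < ∞ := ENNReal.mul_lt_top (by simp) hi

/-- The kernel of the operator that reconstructs `(1 - |z|)^α R h` from the weighted `N`-th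
derivative of `h`, with respect to the Möbius invariant measure. -/
noncomputable def dualKernel (ω : ℝ → ℝ) (α : ℝ) (N : ℕ) (z ξ : ℂ) : ℝ≥0∞ :=
  ENNReal.ofReal ((1 - ‖z‖) ^ α) * fracKernelNorm ω α N (z * conj ξ) *
    ENNReal.ofReal ((1 - ‖ξ‖ ^ 2) ^ 2)

lemma measurable_dualKernel (hω : IsDoubling ω) {α : ℝ} (hα : 0 ≤ α) (N : ℕ) :
    Measurable (Function.uncurry (dualKernel ω α N)) := by
  have h1 : Measurable fun q : ℂ × ℂ => fracKernelNorm ω α N (q.1 * conj q.2) :=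
    (measurable_fracKernelNorm hω hα N).comp
      (measurable_fst.mul (Complex.continuous_conj.measurable.comp measurable_snd))
  have h2 : Measurable fun q : ℂ × ℂ => ENNReal.ofReal ((1 - ‖q.2‖ ^ 2) ^ 2) := by fun_prop
  have h3 : Measurable fun q : ℂ × ℂ => ENNReal.ofReal ((1 - ‖q.1‖) ^ α) := by fun_prop
  exact (h3.mul h1).mul h2

lemma mobius_mul_cancel {ξ : ℂ} (hξ : ‖ξ‖ < 1) :
    ENNReal.ofReal (1 / (1 - ‖ξ‖ ^ 2) ^ 2) * ENNReal.ofReal ((1 - ‖ξ‖ ^ 2) ^ 2) = 1 := by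
  have : 0 < 1 - ‖ξ‖ ^ 2 := by nlinarith [norm_nonneg ξ]
  rw [← ENNReal.ofReal_mul (by positivity), one_div_mul_cancel (by positivity), ENNReal.ofReal_one]

/-- The Möbius density cancels, and what is left is (1 - |z|)^α times the area integral of a kernel
with means (1 - ρ)^(-α-1); for α > 0 that integral is O((1 - |z|)^(-α)). -/
lemma dualKernel_row (hω : IsDoubling ω) {α : ℝ} (hα : 0 < α) (N : ℕ) : ∃ A : ℝ≥0,
    ∀ z : ℂ, ‖z‖ < 1 → ∫⁻ ξ, dualKernel ω α N z ξ ∂mobiusMeasure ≤ A := by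
  obtain ⟨C, hC, h⟩ := hω.circleMass_fracKernel_le hα.le N
  obtain ⟨D, hD, hJ⟩ := lintegral_one_sub_rpow_mul_le (a := 0) (M := α + 1) (by linarith)
    (by linarith)
  refine ⟨C.toNNReal * D.toNNReal, fun z hz => ?_⟩
  have h0 := norm_nonneg z
  have hd : 0 < 1 - ‖z‖ := by linarith
  have e : ∫⁻ ξ, dualKernel ω α N z ξ ∂mobiusMeasure = ENNReal.ofReal ((1 - ‖z‖) ^ α) *
      ∫⁻ ξ, 1 * fracKernelNorm ω α N (z * conj ξ) ∂areaMeasure := by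
    rw [lintegral_mobius, ← lintegral_const_mul' _ _ (by simp)]
    refine lintegral_congr_ae ?_
    filter_upwards [ae_area_mem_disk] with ξ hξ
    calc _ = (ENNReal.ofReal (1 / (1 - ‖ξ‖ ^ 2) ^ 2) * ENNReal.ofReal ((1 - ‖ξ‖ ^ 2) ^ 2)) *
          (ENNReal.ofReal ((1 - ‖z‖) ^ α) * fracKernelNorm ω α N (z * conj ξ)) := by
          rw [dualKernel]
          ring
      _ = _ := by rw [mobius_mul_cancel hξ, one_mul, one_mul]
  rw [e, lintegral_radial_mul_conj (φ := fun _ => 1) (by fun_prop)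
    (measurable_fracKernelNorm hω hα.le N)]
  calc _ ≤ ENNReal.ofReal ((1 - ‖z‖) ^ α) * (1 * ∫⁻ r in Ioo (0 : ℝ) 1, ENNReal.ofReal C *
        ENNReal.ofReal ((1 - r) ^ (0 : ℝ) * (1 - ‖z‖ * r) ^ (-(α + 1)))) := by
        refine mul_le_mul_right (mul_le_mul' inv_ofReal_pi_le_one ?_) _
        refine setLIntegral_mono' measurableSet_Ioo fun r hr => ?_
        obtain ⟨g0, g1⟩ := mul_mem_Ico h0 hz hr
        have e1 : ENNReal.ofReal r ≤ 1 := by simpa using hr.2.le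
        rw [fracKernelNorm, circleMass_indicator _ g0 g1, Real.rpow_zero, one_mul, mul_one,
          ← ENNReal.ofReal_mul hC.le, ← one_mul (ENNReal.ofReal (C * _))]
        exact mul_le_mul' e1 (h _ g0 g1)
    _ ≤ ENNReal.ofReal ((1 - ‖z‖) ^ α) *
        (1 * (ENNReal.ofReal C * ENNReal.ofReal (D * (1 - ‖z‖) ^ (-α)))) := by
        rw [lintegral_const_mul' _ _ (by simp)]
        gcongr
        refine (hJ _ h0 hz).trans (le_of_eq ?_)
        rw [show (0 : ℝ) + 1 - (α + 1) = -α by ring]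
    _ = ENNReal.ofReal C * ENNReal.ofReal D *
        (ENNReal.ofReal ((1 - ‖z‖) ^ α) * ENNReal.ofReal ((1 - ‖z‖) ^ (-α))) := by
        rw [ENNReal.ofReal_mul hD.le]
        ring
    _ = _ := by
        rw [← ENNReal.ofReal_mul (p := (1 - ‖z‖) ^ α) (by positivity), ← Real.rpow_add hd, add_neg_cancel,
          Real.rpow_zero, ENNReal.ofReal_one, mul_one, ENNReal.coe_mul]
        rfl

/-- The radial density of `(1 - |z|)^α dλ_ω`. -/
noncomputable def lambdaProfile (ω : ℝ → ℝ) (α : ℝ) (r : ℝ) : ℝ≥0∞ :=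
  ENNReal.ofReal (ω r) * (wHat ω r)⁻¹ * ENNReal.ofReal ((1 - r) ^ (α - 1))

lemma aemeasurable_lambdaProfile (hω : IsRadialWeight ω) (α : ℝ) :
    AEMeasurable (lambdaProfile ω α) (volume.restrict (Ioo 0 1)) :=
  ((aemeasurable_profile hω.integrable).ennreal_ofReal.mul
    (measurable_wHat ω).inv.aemeasurable).mul (by fun_prop)

lemma IsDoubling.lintegral_rpow_mul_lambda (hω : IsDoubling ω) (α : ℝ) (g : ℂ → ℝ≥0∞) :
    ∫⁻ z, ENNReal.ofReal ((1 - ‖z‖) ^ α) * g z ∂(lambdaMeasure ω) =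
      ∫⁻ z, lambdaProfile ω α ‖z‖ * g z ∂areaMeasure := by
  rw [show lambdaMeasure ω =
      areaMeasure.withDensity fun z : ℂ => ENNReal.ofReal (ω ‖z‖) / lambdaRatio ω z from rfl,
    lintegral_withDensity_eq_lintegral_mul_non_measurable₀ _ (aemeasurable_lambda_density hω.weight)
    (ae_area_mem_disk.mono fun z hz =>
      ENNReal.div_lt_top ENNReal.ofReal_ne_top (hω.lambdaRatio_ne_zero hz))]
  refine lintegral_congr_ae ?_
  filter_upwards [ae_area_mem_disk] with z hz
  have hd : 0 < 1 - ‖z‖ := by linarith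
  rw [Pi.mul_apply, lambdaProfile, lambdaRatio, ENNReal.div_eq_inv_mul,
    ENNReal.mul_inv (Or.inr ENNReal.ofReal_ne_top)
      (Or.inl (hω.wHat_ne_top (norm_nonneg z))), ← ENNReal.ofReal_inv_of_pos hd,
    Real.rpow_sub_one hd.ne', div_eq_mul_inv, ENNReal.ofReal_mul (by positivity)]
  ring

/-- Here α > 1 enters: one power of (1 - r)^α is spent on λ_ω, and the remaining exponent α - 1 must
be positive against ω / ω̂. The result (1 - |ξ|)^(-2) is cancelled by (1 - |ξ|²)². -/
lemma dualKernel_col (hω : IsDoubling ω) {α : ℝ} (hα : 1 < α) (N : ℕ) : ∃ B : ℝ≥0,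
    ∀ ξ : ℂ, ‖ξ‖ < 1 → ∫⁻ z, dualKernel ω α N z ξ ∂(lambdaMeasure ω) ≤ B := by
  obtain ⟨C, hC, h⟩ := hω.circleMass_fracKernel_le (x := α) (by linarith) N
  obtain ⟨D, hJ⟩ := hω.lintegral_div_wHat_rpow_le (a := α - 1) (M := α + 1) (by linarith)
    (by linarith)
  refine ⟨C.toNNReal * D * 4, fun ξ hξ => ?_⟩
  have h0 := norm_nonneg ξ
  have hd : 0 < 1 - ‖ξ‖ := by linarith
  have e : ∫⁻ z, dualKernel ω α N z ξ ∂(lambdaMeasure ω) =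
      (∫⁻ z, lambdaProfile ω α ‖z‖ * fracKernelNorm ω α N (z * conj ξ) ∂areaMeasure) *
        ENNReal.ofReal ((1 - ‖ξ‖ ^ 2) ^ 2) := by
    rw [← hω.lintegral_rpow_mul_lambda, ← lintegral_mul_const' _ _ (by simp)]
    rfl
  rw [e, lintegral_radial_mul_conj_left (aemeasurable_lambdaProfile hω.weight α)
    (measurable_fracKernelNorm hω (by linarith) N)]
  calc _ ≤ (1 * ∫⁻ r in Ioo (0 : ℝ) 1, ENNReal.ofReal C * (ENNReal.ofReal (ω r) *
        (wHat ω r)⁻¹ * ENNReal.ofReal ((1 - r) ^ (α - 1) * (1 - ‖ξ‖ * r) ^ (-(α + 1))))) *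
          ENNReal.ofReal (4 * (1 - ‖ξ‖) ^ (2 : ℝ)) := by
        gcongr (?_ * ?_) * ENNReal.ofReal ?_
        · exact inv_ofReal_pi_le_one
        · refine setLIntegral_mono' measurableSet_Ioo fun r hr => ?_
          obtain ⟨g0, g1⟩ := mul_mem_Ico h0 hξ hr
          have hr1 : 0 < 1 - r := by linarith [hr.2]
          have e1 : ENNReal.ofReal r ≤ 1 := by simpa using hr.2.le
          rw [fracKernelNorm, circleMass_indicator _ g0 g1, lambdaProfile,
            ENNReal.ofReal_mul (p := (1 - r) ^ (α - 1)) (by positivity)]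
          calc _ ≤ 1 * (ENNReal.ofReal (ω r) * (wHat ω r)⁻¹ *
                ENNReal.ofReal ((1 - r) ^ (α - 1))) *
                ENNReal.ofReal (C * (1 - ‖ξ‖ * r) ^ (-(α + 1))) := by
                gcongr
                exact h _ g0 g1
            _ = _ := by
                rw [ENNReal.ofReal_mul hC.le]
                ring
        · rw [Real.rpow_ofNat]
          nlinarith [mul_nonneg h0 hd.le, mul_nonneg (mul_nonneg h0 hd.le) (mul_nonneg h0 hd.le),
            sq_nonneg (1 - ‖ξ‖)]
    _ ≤ (1 * (ENNReal.ofReal C * (D * ENNReal.ofReal ((1 - ‖ξ‖) ^ (-2 : ℝ))))) *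
          ENNReal.ofReal (4 * (1 - ‖ξ‖) ^ (2 : ℝ)) := by
        rw [lintegral_const_mul' _ _ (by simp)]
        gcongr
        refine (hJ _ h0 hξ).trans (le_of_eq ?_)
        rw [show α - 1 - (α + 1) = -2 by ring]
    _ = ENNReal.ofReal C * D * ENNReal.ofReal 4 *
        (ENNReal.ofReal ((1 - ‖ξ‖) ^ (-2 : ℝ)) * ENNReal.ofReal ((1 - ‖ξ‖) ^ (2 : ℝ))) := by
        rw [ENNReal.ofReal_mul (by norm_num)]
        ring
    _ = _ := by
        rw [← ENNReal.ofReal_mul (by positivity), ← Real.rpow_add hd, neg_add_cancel,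
          Real.rpow_zero, ENNReal.ofReal_one, mul_one]
        push_cast
        rw [ENNReal.ofReal, ENNReal.ofReal_ofNat]

/-- Used for the polynomial part of R h, which is bounded on the disk. It is the radial estimate at
ρ = 0, and λ_ω itself need not be finite. -/
lemma IsDoubling.lintegral_rpow_lambda_lt_top (hω : IsDoubling ω) {α : ℝ} (hα : 1 < α) :
    ∫⁻ z, ENNReal.ofReal ((1 - ‖z‖) ^ α) ∂(lambdaMeasure ω) < ∞ := by
  obtain ⟨D, hJ⟩ := hω.lintegral_div_wHat_rpow_le (a := α - 1) (M := α) (by linarith)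
    (by linarith)
  have e := hω.lintegral_rpow_mul_lambda α 1
  simp only [Pi.one_apply, mul_one] at e
  rw [e, lintegral_radial (aemeasurable_lambdaProfile hω.weight α)]
  refine ENNReal.mul_lt_top (by simp) (lt_of_le_of_lt ?_ ((hJ 0 le_rfl one_pos).trans_lt
    (ENNReal.mul_lt_top (by simp) (by simp))))
  refine setLIntegral_mono' measurableSet_Ioo fun r hr => ?_
  have e1 : ENNReal.ofReal r ≤ 1 := by simpa using hr.2.le
  rw [zero_mul, sub_zero, Real.one_rpow, mul_one]
  exact mul_le_of_le_one_left' e1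

lemma lintegral_standardWeight (N : ℕ) (g : ℂ → ℝ≥0∞) :
    ∫⁻ ξ, g ξ ∂(weightMeasure (standardWeight N)) = ∫⁻ ξ, ENNReal.ofReal ((1 - ‖ξ‖ ^ 2) ^ 2) *
      (ENNReal.ofReal (standardWeight N ‖ξ‖) * g ξ) ∂mobiusMeasure := by
  rw [lintegral_weightMeasure (integrable_standardWeight N), lintegral_mobius]
  refine lintegral_congr_ae ?_
  filter_upwards [ae_area_mem_disk] with ξ hξ
  rw [← mul_assoc, mobius_mul_cancel hξ, one_mul]

/-- Pointwise bound for the fractional derivative. -/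
lemma rpow_mul_coeffMul_le (hω : IsDoubling ω) {α : ℝ} (hα : 0 ≤ α) {h : ℂ → ℂ} (hh : IsHol h)
    (N : ℕ) (hi : ∫⁻ ξ, weightedDeriv N h ξ ∂areaMeasure < ∞) : ∃ K : ℝ≥0, ∀ z : ℂ, ‖z‖ < 1 →
      ENNReal.ofReal ((1 - ‖z‖) ^ α) * ‖coeffMul (momentRatio ω (powWeight ω α)) h z‖ₑ ≤
        ENNReal.ofReal ((1 - ‖z‖) ^ α) * K +
          2 ^ N * ∫⁻ ξ, dualKernel ω α N z ξ * weightedDeriv N h ξ ∂mobiusMeasure := by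
  have hint := integrable_iteratedDeriv hh hi
  refine ⟨∑ n ∈ Finset.range N, ‖momentRatio ω (powWeight ω α) n * coeff h n‖₊, fun z hz => ?_⟩
  have h0 := norm_nonneg z
  have hz1 : ‖z‖ₑ ≤ 1 := by
    rw [← ofReal_norm]
    exact ENNReal.ofReal_le_one.2 hz.le
  have hI : ‖∫ ξ, iteratedDeriv N h ξ * powerSum (fun n => (fracKernelCoeff ω α N n : ℂ))
      (z * conj ξ) ∂(weightMeasure (standardWeight N))‖ₑ ≤
      ∫⁻ ξ, fracKernelNorm ω α N (z * conj ξ) * ‖iteratedDeriv N h ξ‖ₑ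
        ∂(weightMeasure (standardWeight N)) := by
    refine (enorm_integral_le_lintegral_enorm _).trans (lintegral_mono_ae ?_)
    filter_upwards [ae_weight_mem_disk] with ξ hξ
    have hm : z * conj ξ ∈ disk := by
      rw [mem_disk, norm_mul, RCLike.norm_conj]
      nlinarith [norm_nonneg ξ]
    rw [fracKernelNorm, indicator_of_mem hm, enorm_mul, mul_comm]
  have hF : ‖((N.factorial : ℂ)⁻¹)‖ₑ ≤ 1 := by
    rw [← ofReal_norm, norm_inv, Complex.norm_natCast]
    refine ENNReal.ofReal_le_one.2 (inv_le_one_of_one_le₀ ?_)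
    exact_mod_cast Nat.one_le_iff_ne_zero.2 (Nat.factorial_ne_zero N)
  have hbound : ‖coeffMul (momentRatio ω (powWeight ω α)) h z‖ₑ ≤
      ((∑ n ∈ Finset.range N, ‖momentRatio ω (powWeight ω α) n * coeff h n‖₊ : ℝ≥0) : ℝ≥0∞) +
        ∫⁻ ξ, fracKernelNorm ω α N (z * conj ξ) * ‖iteratedDeriv N h ξ‖ₑ
          ∂(weightMeasure (standardWeight N)) := by
    rw [coeffMul_momentRatio_eq hω hα hh N hint hz, ENNReal.ofNNReal_finsetSum]
    refine (enorm_add_le _ _).trans (add_le_add ((enorm_sum_le _ _).trans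
      (Finset.sum_le_sum fun n _ => ?_)) ?_)
    · rw [enorm_mul, enorm_pow]
      exact mul_le_of_le_one_right' (pow_le_one₀ (by positivity) hz1)
    · rw [enorm_mul, enorm_mul, enorm_pow]
      exact (mul_le_of_le_one_left' (pow_le_one₀ (by positivity) hz1)).trans
        ((mul_le_of_le_one_left' hF).trans hI)
  refine (mul_le_mul_right hbound _).trans ?_
  rw [mul_add]
  refine add_le_add le_rfl ?_
  rw [lintegral_standardWeight, ← lintegral_const_mul' _ _ (by simp),
    ← lintegral_const_mul' _ _ (by simp)]
  refine lintegral_mono_ae ?_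
  filter_upwards [ae_mobius_mem_disk] with ξ hξ
  calc _ = (ENNReal.ofReal ((1 - ‖z‖) ^ α) * ENNReal.ofReal ((1 - ‖ξ‖ ^ 2) ^ 2) *
        fracKernelNorm ω α N (z * conj ξ) * ‖iteratedDeriv N h ξ‖ₑ) *
        ENNReal.ofReal (standardWeight N ‖ξ‖) := by ring
    _ ≤ (ENNReal.ofReal ((1 - ‖z‖) ^ α) * ENNReal.ofReal ((1 - ‖ξ‖ ^ 2) ^ 2) *
        fracKernelNorm ω α N (z * conj ξ) * ‖iteratedDeriv N h ξ‖ₑ) *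
        (2 ^ N * ENNReal.ofReal (1 - ‖ξ‖) ^ N) :=
        mul_le_mul_right (ofReal_standardWeight_le N (norm_nonneg ξ) hξ) _
    _ = _ := by
        rw [dualKernel, weightedDeriv]
        ring

lemma aemeasurable_weightedDeriv {h : ℂ → ℂ} (hh : IsHol h) (N : ℕ) :
    AEMeasurable (weightedDeriv N h) mobiusMeasure := by
  have h1 := ((aestronglyMeasurable_of_isHol (hh.isHol_iteratedDeriv N)).mono_ac
    (withDensity_absolutelyContinuous _ fun z => ENNReal.ofReal (1 / (1 - ‖z‖ ^ 2) ^ 2))).enorm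
  exact h1.mul (by fun_prop)

lemma lintegral_area_le_mobius (g : ℂ → ℝ≥0∞) :
    ∫⁻ ξ, g ξ ∂areaMeasure ≤ ∫⁻ ξ, g ξ ∂mobiusMeasure := by
  rw [lintegral_mobius]
  refine lintegral_mono_ae ?_
  filter_upwards [ae_area_mem_disk] with ξ hξ
  refine le_mul_of_one_le_left' ?_
  rw [ENNReal.one_le_ofReal]
  have : 0 < 1 - ‖ξ‖ ^ 2 := by nlinarith [norm_nonneg ξ]
  rw [one_le_div (by positivity)]
  exact pow_le_one₀ this.le (by nlinarith [norm_nonneg ξ])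

/-- For p = ∞ the norm is the Bloch norm whatever N is, so R h is reconstructed from the first
derivative. -/
lemma MemBesov.weightedDeriv_one_le {N : ℕ} {h : ℂ → ℂ} {ξ : ℂ} (hξ : ‖ξ‖ < 1) :
    weightedDeriv 1 h ξ ≤ besovNorm N ∞ h := by
  rw [weightedDeriv, iteratedDeriv_one, pow_one, besovNorm, if_pos rfl, blochNorm]
  refine le_trans ?_ le_self_add
  refine le_trans ?_ (le_iSup₂ (f := fun (z : ℂ) (_ : z ∈ disk) =>
    ENNReal.ofReal ((1 - ‖z‖ ^ 2) * ‖deriv h z‖)) ξ (mem_disk.2 hξ))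
  rw [mul_comm, ← ofReal_norm, ← ENNReal.ofReal_mul (by linarith)]
  refine ENNReal.ofReal_le_ofReal (mul_le_mul_of_nonneg_right ?_ (norm_nonneg _))
  nlinarith [norm_nonneg ξ]

lemma MemBesov.lintegral_weightedDeriv_lt_top {N : ℕ} {p : ℝ≥0∞} (hp : 1 ≤ p) (hpt : p ≠ ∞)
    {h : ℂ → ℂ} (hh : MemBesov N p h) :
    ∫⁻ ξ, weightedDeriv N h ξ ^ p.toReal ∂mobiusMeasure < ∞ := by
  have hq : 0 < p.toReal := ENNReal.toReal_pos (zero_lt_one.trans_le hp).ne' hpt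
  have h1 := hh.2
  rw [besovNorm, if_neg hpt, ENNReal.add_lt_top,
    ENNReal.rpow_lt_top_iff_of_pos (by positivity)] at h1
  refine lt_of_le_of_lt (le_of_eq (lintegral_congr fun ξ => ?_)) h1.1
  rw [weightedDeriv, ENNReal.mul_rpow_of_nonneg _ _ hq.le, ENNReal.rpow_mul, ENNReal.rpow_natCast]

lemma aestronglyMeasurable_fracDeriv (hω : IsDoubling ω) {α : ℝ} (hα : 0 ≤ α) {h : ℂ → ℂ}
    (hh : IsHol h) : AEStronglyMeasurable (fun z : ℂ => (((1 - ‖z‖) ^ α : ℝ) : ℂ) *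
      fracDeriv ω (powWeight ω α) h z) (lambdaMeasure ω) := by
  have hν := isRadialWeight_powWeight hω.weight hα
  have hR := (isHol_coeffMul (diskSummable_momentRatio hω.weight hν) hh).congr
    (fracDeriv_eqOn hω.weight hν hh).symm
  have hm : Measurable fun z : ℂ => (((1 - ‖z‖) ^ α : ℝ) : ℂ) := by fun_prop
  exact hm.aestronglyMeasurable.mul ((aestronglyMeasurable_of_isHol hR).mono_ac
    (withDensity_absolutelyContinuous _ _))

lemma enorm_rpow_mul_fracDeriv (hω : IsDoubling ω) {α : ℝ} (hα : 0 ≤ α) {h : ℂ → ℂ}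
    (hh : IsHol h) {z : ℂ} (hz : ‖z‖ < 1) :
    ‖(((1 - ‖z‖) ^ α : ℝ) : ℂ) * fracDeriv ω (powWeight ω α) h z‖ₑ =
      ENNReal.ofReal ((1 - ‖z‖) ^ α) * ‖coeffMul (momentRatio ω (powWeight ω α)) h z‖ₑ := by
  rw [fracDeriv_eqOn hω.weight (isRadialWeight_powWeight hω.weight hα) hh (mem_disk.2 hz),
    enorm_mul, ← ofReal_norm, Complex.norm_of_nonneg (Real.rpow_nonneg (by linarith) _)]

lemma ofReal_rpow_le_one {α : ℝ} (hα : 0 ≤ α) {z : ℂ} (hz : ‖z‖ < 1) :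
    ENNReal.ofReal ((1 - ‖z‖) ^ α) ≤ 1 :=
  ENNReal.ofReal_le_one.2 (Real.rpow_le_one (by linarith) (by linarith [norm_nonneg z]) hα)

/-- The explicit pre-image of a Bloch function is bounded. -/
lemma IsDoubling.memLp_fracDeriv_top (hω : IsDoubling ω) {α : ℝ} (hα : 0 < α) {N : ℕ} {h : ℂ → ℂ}
    (hh : MemBesov N ∞ h) : MemLp (fun z : ℂ => (((1 - ‖z‖) ^ α : ℝ) : ℂ) *
      fracDeriv ω (powWeight ω α) h z) ∞ (lambdaMeasure ω) := by
  refine ⟨aestronglyMeasurable_fracDeriv hω hα.le hh.1, ?_⟩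
  have hi : ∫⁻ ξ, weightedDeriv 1 h ξ ∂areaMeasure < ∞ := by
    calc _ ≤ ∫⁻ _, besovNorm N ∞ h ∂areaMeasure :=
          lintegral_mono_ae (ae_area_mem_disk.mono fun ξ hξ => MemBesov.weightedDeriv_one_le hξ)
      _ < ∞ := by
          rw [lintegral_const]
          exact ENNReal.mul_lt_top hh.2 (measure_lt_top _ _)
  obtain ⟨K, hK⟩ := rpow_mul_coeffMul_le hω hα.le hh.1 1 hi
  obtain ⟨A, hA⟩ := dualKernel_row hω hα 1
  rw [eLpNorm_exponent_top]
  have hlt : (K : ℝ≥0∞) + 2 ^ 1 * (A * besovNorm N ∞ h) < ∞ := by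
    refine ENNReal.add_lt_top.2 ⟨by simp, ENNReal.mul_lt_top (by simp)
      (ENNReal.mul_lt_top (by simp) hh.2)⟩
  refine lt_of_le_of_lt (eLpNormEssSup_le_of_ae_enorm_bound ?_) hlt
  filter_upwards [ae_lambda_mem_disk] with z hz
  rw [enorm_rpow_mul_fracDeriv hω hα.le hh.1 hz]
  have h2 := lintegral_mul_le_of_le (ν := mobiusMeasure) (k := dualKernel ω α 1 z)
    (f := weightedDeriv 1 h) (measurable_dualKernel hω hα.le 1).of_uncurry_left
    (ae_mobius_mem_disk.mono fun ξ hξ => MemBesov.weightedDeriv_one_le (N := N) hξ)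
  refine (hK z hz).trans (add_le_add (mul_le_of_le_one_left' (ofReal_rpow_le_one hα.le hz))
    (mul_le_mul_right (h2.trans ?_) _))
  gcongr
  exact hA z hz

/-- The explicit pre-image of a Besov function is in `L^p(λ_ω)`, for finite `p`. -/
lemma IsDoubling.memLp_fracDeriv_of_ne_top (hω : IsDoubling ω) {α : ℝ} (hα : 1 < α) {p : ℝ≥0∞}
    (hp : 1 ≤ p) (hpt : p ≠ ∞) {N : ℕ} {h : ℂ → ℂ} (hh : MemBesov N p h) :
    MemLp (fun z : ℂ => (((1 - ‖z‖) ^ α : ℝ) : ℂ) * fracDeriv ω (powWeight ω α) h z) p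
      (lambdaMeasure ω) := by
  have hα0 : 0 < α := by linarith
  refine ⟨aestronglyMeasurable_fracDeriv hω hα0.le hh.1, ?_⟩
  have hF := hh.lintegral_weightedDeriv_lt_top hp hpt
  have hFm := aemeasurable_weightedDeriv hh.1 N
  set q := p.toReal with hq
  have hq1 : 1 ≤ q := by
    rw [← ENNReal.toReal_one]
    exact ENNReal.toReal_mono hpt hp
  -- From x ≤ 1 + x^q: area measure is finite and dominated by the Möbius measure, for which the
  -- q-th power is integrable.
  have hi : ∫⁻ ξ, weightedDeriv N h ξ ∂areaMeasure < ∞ := by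
    calc _ ≤ ∫⁻ ξ, (1 + weightedDeriv N h ξ ^ q) ∂areaMeasure := by
          refine lintegral_mono fun ξ => ?_
          rcases le_total (weightedDeriv N h ξ) 1 with h1 | h1
          · exact h1.trans le_self_add
          · exact (ENNReal.le_rpow_self_of_one_le h1 hq1).trans le_add_self
      _ = ∫⁻ _, 1 ∂areaMeasure + ∫⁻ ξ, weightedDeriv N h ξ ^ q ∂areaMeasure :=
          lintegral_add_left measurable_const _
      _ < ∞ := ENNReal.add_lt_top.2 ⟨by simp [measure_lt_top],
          (lintegral_area_le_mobius _).trans_lt hF⟩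
  obtain ⟨K, hK⟩ := rpow_mul_coeffMul_le hω hα0.le hh.1 N hi
  obtain ⟨A, hA⟩ := dualKernel_row hω hα0 N
  obtain ⟨B, hB⟩ := dualKernel_col hω hα N
  have hs := lintegral_schur_le (μ := lambdaMeasure ω) (ν := mobiusMeasure)
    (measurable_dualKernel hω hα0.le N) hFm hq1 (ae_lambda_mem_disk.mono fun z hz => hA z hz)
    (ae_mobius_mem_disk.mono fun ξ hξ => hB ξ hξ)
  rw [eLpNorm_lt_top_iff_lintegral_rpow_enorm_lt_top (zero_lt_one.trans_le hp).ne' hpt, ← hq]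
  have hfin : ∫⁻ z, (∫⁻ ξ, dualKernel ω α N z ξ * weightedDeriv N h ξ ∂mobiusMeasure) ^ q
      ∂(lambdaMeasure ω) < ∞ := hs.trans_lt (ENNReal.mul_lt_top (ENNReal.mul_lt_top
        (ENNReal.rpow_lt_top_of_nonneg (by linarith) (by simp)) (by simp)) hF)
  -- Since (1 - |z|)^α ≤ 1 and q ≥ 1, its q-th power is at most itself, and α > 1 makes that
  -- integrable.
  have hpow : ∫⁻ z, (ENNReal.ofReal ((1 - ‖z‖) ^ α) * K) ^ q ∂(lambdaMeasure ω) < ∞ := by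
    calc _ ≤ ∫⁻ z, ENNReal.ofReal ((1 - ‖z‖) ^ α) * K ^ q ∂(lambdaMeasure ω) := by
          refine lintegral_mono_ae ?_
          filter_upwards [ae_lambda_mem_disk] with z hz
          rw [ENNReal.mul_rpow_of_nonneg _ _ (by linarith)]
          exact mul_le_mul_left
            (ENNReal.rpow_le_self_of_le_one (ofReal_rpow_le_one hα0.le hz) hq1) _
      _ = (∫⁻ z, ENNReal.ofReal ((1 - ‖z‖) ^ α) ∂(lambdaMeasure ω)) * K ^ q :=
          lintegral_mul_const _ (by fun_prop)
      _ < ∞ := ENNReal.mul_lt_top (hω.lintegral_rpow_lambda_lt_top hα)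
          (ENNReal.rpow_lt_top_of_nonneg (by linarith) (by simp))
  calc _ ≤ ∫⁻ z, 2 ^ (q - 1) * ((ENNReal.ofReal ((1 - ‖z‖) ^ α) * K) ^ q +
        (2 ^ N) ^ q * (∫⁻ ξ, dualKernel ω α N z ξ * weightedDeriv N h ξ ∂mobiusMeasure) ^ q)
          ∂(lambdaMeasure ω) := by
        refine lintegral_mono_ae ?_
        filter_upwards [ae_lambda_mem_disk] with z hz
        rw [enorm_rpow_mul_fracDeriv hω hα0.le hh.1 hz, ← ENNReal.mul_rpow_of_nonneg _ _
          (by linarith)]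
        exact (ENNReal.rpow_le_rpow (hK z hz) (by linarith)).trans
          (ENNReal.rpow_add_le_mul_rpow_add_rpow _ _ hq1)
    _ = 2 ^ (q - 1) * (∫⁻ z, (ENNReal.ofReal ((1 - ‖z‖) ^ α) * K) ^ q ∂(lambdaMeasure ω) +
        (2 ^ N) ^ q * ∫⁻ z, (∫⁻ ξ, dualKernel ω α N z ξ * weightedDeriv N h ξ ∂mobiusMeasure) ^ q
          ∂(lambdaMeasure ω)) := by
        rw [lintegral_const_mul' _ _ (ENNReal.rpow_ne_top_of_nonneg (by linarith) (by simp)),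
          lintegral_add_left (by fun_prop),
          lintegral_const_mul' _ _ (ENNReal.rpow_ne_top_of_nonneg (by linarith) (by simp))]
    _ < ∞ := ENNReal.mul_lt_top (ENNReal.rpow_lt_top_of_nonneg (by linarith) (by simp))
        (ENNReal.add_lt_top.2 ⟨hpow, ENNReal.mul_lt_top
          (ENNReal.rpow_lt_top_of_nonneg (by linarith) (by simp)) hfin⟩)

theorem IsDoubling.memLp_fracDeriv (hω : IsDoubling ω) {α : ℝ} (hα : 1 < α) {p : ℝ≥0∞}
    (hp : 1 ≤ p) {N : ℕ} {h : ℂ → ℂ} (hh : MemBesov N p h) :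
    MemLp (fun z : ℂ => (((1 - ‖z‖) ^ α : ℝ) : ℂ) * fracDeriv ω (powWeight ω α) h z) p
      (lambdaMeasure ω) := by
  rcases eq_or_ne p ∞ with rfl | hpt
  · exact hω.memLp_fracDeriv_top (by linarith) hh
  · exact hω.memLp_fracDeriv_of_ne_top hα hp hpt hh

/-- The projection inverts the fractional derivative. -/
theorem bergmanProj_fracDeriv (hω : IsRadialWeight ω) {α : ℝ} (hα : 0 ≤ α) {h : ℂ → ℂ}
    (hh : IsHol h) (hi : Integrable (fun z : ℂ => (((1 - ‖z‖) ^ α : ℝ) : ℂ) *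
      fracDeriv ω (powWeight ω α) h z) (weightMeasure ω)) :
    EqOn (bergmanProj ω fun z : ℂ => (((1 - ‖z‖) ^ α : ℝ) : ℂ) *
      fracDeriv ω (powWeight ω α) h z) h disk := by
  have hν := isRadialWeight_powWeight hω hα
  have hc := diskSummable_momentRatio hω hν
  set R := fracDeriv ω (powWeight ω α) h with hRdef
  have hRe : EqOn R (coeffMul (momentRatio ω (powWeight ω α)) h) disk := fracDeriv_eqOn hω hν hh
  have hR : IsHol R := (isHol_coeffMul hc hh).congr hRe.symm
  have hsmul : ∀ G : ℂ → ℂ, (fun z : ℂ => ω ‖z‖ • ((((1 - ‖z‖) ^ α : ℝ) : ℂ) * G z)) =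
      fun z => powWeight ω α ‖z‖ • G z := fun G => by
    funext z
    simp only [powWeight, Complex.real_smul, Complex.ofReal_mul]
    ring
  have hRi : Integrable R (weightMeasure (powWeight ω α)) := by
    rw [integrable_weight_iff hν.integrable hν.nonneg, ← hsmul R,
      ← integrable_weight_iff hω.integrable hω.nonneg]
    exact hi
  refine eqOn_of_coeff_eq (isHol_bergmanProj hω hi) hh fun n => ?_
  have h1 := moment_pos hω n
  have h2 := moment_pos hν n
  -- The factor (1 - |ξ|)^α turns ω into ω_α, so the pairing produces the moment of ω_α that the
  -- multiplier of R divides by.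
  have e : ∫ ξ, (((1 - ‖ξ‖) ^ α : ℝ) : ℂ) * R ξ * conj ξ ^ n ∂(weightMeasure ω) =
      ∫ ξ, R ξ * conj ξ ^ n ∂(weightMeasure (powWeight ω α)) := by
    simp only [mul_assoc]
    rw [integral_weight hω.integrable hω.nonneg, integral_weight hν.integrable hν.nonneg,
      hsmul fun ξ => R ξ * conj ξ ^ n]
  rw [coeff_bergmanProj hω hi, projCoeff, e,
    integral_mul_conj_pow hν.integrable hν.nonneg hR hRi, coeff_congr hRe, coeff_coeffMul hc hh,
    momentRatio]
  have h3 : (moment ω n : ℂ) ≠ 0 := by exact_mod_cast h1.ne'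
  have h4 : (moment (powWeight ω α) n : ℂ) ≠ 0 := by exact_mod_cast h2.ne'
  push_cast
  field_simp

end Range

end BergmanBesov

theorem theorem5p1 (ω : ℝ → ℝ) (hω : BergmanBesov.IsDoubling ω)
    (p : ℝ≥0∞) (hp : 1 ≤ p) (N : ℕ) (hN : 2 ≤ N) :
    -- the integral that defines the projection converges absolutely
    (∀ f : ℂ → ℂ, MemLp f p (BergmanBesov.lambdaMeasure ω) → ∀ z ∈ BergmanBesov.disk,
      Integrable (fun ξ => f ξ * conj (BergmanBesov.bergmanKernel ω z ξ))
        (BergmanBesov.weightMeasure ω)) ∧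
    -- boundedness
    (∃ C : ℝ≥0, ∀ f : ℂ → ℂ, MemLp f p (BergmanBesov.lambdaMeasure ω) →
      BergmanBesov.MemBesov N p (BergmanBesov.bergmanProj ω f) ∧
      BergmanBesov.besovNorm N p (BergmanBesov.bergmanProj ω f) ≤
        C * eLpNorm f p (BergmanBesov.lambdaMeasure ω)) ∧
    -- surjectivity
    (∀ h : ℂ → ℂ, BergmanBesov.MemBesov N p h →
      ∃ f : ℂ → ℂ, MemLp f p (BergmanBesov.lambdaMeasure ω) ∧
        EqOn (BergmanBesov.bergmanProj ω f) h BergmanBesov.disk) ∧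
    -- explicit pre-images
    (∀ α : ℝ, 1 < α → ∀ h : ℂ → ℂ, BergmanBesov.MemBesov N p h →
      MemLp (fun z : ℂ => (((1 - ‖z‖) ^ α : ℝ) : ℂ) *
          BergmanBesov.fracDeriv ω (BergmanBesov.powWeight ω α) h z)
        p (BergmanBesov.lambdaMeasure ω) ∧
      EqOn (BergmanBesov.bergmanProj ω fun z : ℂ => (((1 - ‖z‖) ^ α : ℝ) : ℂ) *
          BergmanBesov.fracDeriv ω (BergmanBesov.powWeight ω α) h z)
        h BergmanBesov.disk) := by
  have hproj := fun f (hf : MemLp f p (BergmanBesov.lambdaMeasure ω)) =>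
    ((hω.eLpNorm_one_le hp).choose_spec f hf).1
  have hpre := fun (α : ℝ) (hα : 1 < α) h (hh : BergmanBesov.MemBesov N p h) =>
    hω.memLp_fracDeriv hα hp hh
  have hinv := fun (α : ℝ) (hα : 1 < α) h (hh : BergmanBesov.MemBesov N p h) =>
    BergmanBesov.bergmanProj_fracDeriv hω.weight (by linarith) hh.1 (hproj _ (hpre α hα h hh))
  exact ⟨fun f hf z hz => BergmanBesov.integrable_mul_conj_bergmanKernel hω.weight (hproj f hf)
      (BergmanBesov.mem_disk.1 hz),
    hω.bergmanProj_bounded hp hN,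
    -- Any α > 1 would give a pre-image; α = 2 is taken.
    fun h hh => ⟨_, hpre 2 one_lt_two h hh, hinv 2 one_lt_two h hh⟩,
    fun α hα h hh => ⟨hpre α hα h hh, hinv α hα h hh⟩⟩
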